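/- **Notation and definitions.** For $x=(x_1,x_2,x_3)\in\mathbb R^3$ let $\rho=|x|$, $r=\sqrt{x_1^2+x_2^2}$, $z=x_3=\rho\cos\theta$, let $\phi$ be the angle with $x_1=r\cos\phi$, $x_2=r\sin\phi$, and let $e_r,e_\phi,e_z$ be the cylindrical frame. For $\alpha\in\mathbb R$, a $(-\alpha)$-homogeneous solution is a pair $(u,p)$ with $u(x)=\lambda^{\alpha}u(\lambda x)$ and $p(x)=\lambda^{2\alpha}p(\lambda x)$ for all $\lambda>0$ that satisfies the stationary Euler equations $$u\cdot\nabla u+\nabla p=0,\qquad \nabla\cdot u=0 .$$ Two classes are considered. * $(u,p)\in C^1(\mathbb R^3\setminus\{0\})$, with the equations holding pointwise in $\mathbb R^3\setminus\{0\}$. Such a solution is *Beltrami* if $(\nabla\times u)\times u=0$ and *rotational* if $\nabla\times u\not\equiv0$ in $\mathbb R^3\setminus\{0\}$. * (for $\alpha<0$) $(u,p)\in C(\mathbb R^3)$, with the equations, in the form $\nabla\cdot(u\otimes u)+\nabla p=0$, $\nabla\cdot u=0$, holding in $\mathbb R^3$ in the sense of distributions. Such a solution is *Beltrami* if $p+\tfrac12|u|^2=0$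 in $\mathbb R^3$ and *rotational* if $\nabla\times u\ne0$ as a distribution on $\mathbb R^3$. A solution is *axisymmetric* if $p$ and the components in $u=u^re_r+u^\phi e_\phi+u^ze_z$ do not depend on $\phi$; equivalently, $u(Rx)=Ru(x)$ and $p(Rx)=p(x)$ for every rotation $R$ about the $x_3$-axis. Write $u^P=u^re_r+u^ze_z$; on the axis, $u^P=u^ze_z$ and $u^\phi e_\phi=0$. **Theorem 1.1.** The following holds for rotational Beltrami $(-\alpha)$-homogeneous solutions. 1. For $1\le\alpha\le2$, no solutions $(u,p)\in C^1(\mathbb R^3\setminus\{0\})$ exist. 2. For $\alpha<1$, no solutions $(u,p)\in C^2(\mathbb R^3\setminus\{0\})$ exist. 3. For every $\alpha>2$ there is an axisymmetric solution $(u,p)\in C^1(\mathbb R^3\setminus\{0\})$ with $u^P,p\in C^2(\mathbb R^3\setminus\{0\})$ and $u^\phi e_\phi\in C^1(\mathbb R^3\setminus\{0\})$. 4. For every $\alpha<0$ there is an axisymmetric solution $(u,p)\in C(\mathbb R^3)$ with $u^P,p\in C^1(\mathbb R^3\setminus\{r=0\})\cap C(\mathbb R^3)$ and $u^\phi e_\phi\in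 C(\mathbb R^3)$. Moreover, the solutions in 3 and 4 can be chosen so that, with $\beta=\alpha-2$, there are a constant $C\ne0$ and a function $w\in C^2(-1,1)\cap C^1[-1,1]$ that solves $$-w''=\frac{\beta(\beta+1)}{1-t^2}\,w+\frac{c_2}{1-t^2}\,w|w|^{2/\beta}\quad\text{in }(-1,1),\qquad w(1)=w(-1)=0,\qquad c_2=C^2\Bigl(1+\frac1\beta\Bigr),$$ and, off the axis $\{r=0\}$, $$u=\nabla\times(\psi\nabla\phi)+\Gamma\nabla\phi=-\frac1r\,\partial_z\psi\,e_r+\frac1r\,\partial_r\psi\,e_z+\frac{\Gamma}{r}\,e_\phi,\qquad \psi=\frac{w(\cos\theta)}{\rho^{\beta}},\quad \Gamma=C\,\psi|\psi|^{1/\beta}.$$ Here $w|w|^{2/\beta}$ and $\psi|\psi|^{1/\beta}$ are read as $0$ where $w=0$ and $\psi=0$. -/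

import Mathlib

open scoped ContDiff

noncomputable section

namespace HomogeneousEuler

/-- Three-dimensional Euclidean space. -/
abbrev Space3 := EuclideanSpace ℝ (Fin 3)

/-! ### Vector calculus -/

/-- The partial derivative `∂ᵢ uⱼ` of the vector field `u` at `x`. -/
def pderiv (u : Space3 → Space3) (i j : Fin 3) (x : Space3) : ℝ :=
  (fderiv ℝ u x (EuclideanSpace.single i 1)) j

/-- The divergence of a vector field. -/
def divergence (u : Space3 → Space3) (x : Space3) : ℝ :=
  ∑ i, pderiv u i i x

/-- The rotation `∇ × u` of a vector field. -/
def curl (u : Space3 → Space3) (x : Space3) : Space3 :=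
  !₂[pderiv u 1 2 x - pderiv u 2 1 x,
     pderiv u 2 0 x - pderiv u 0 2 x,
     pderiv u 0 1 x - pderiv u 1 0 x]

/-! ### Homogeneous solutions of the stationary Euler equations -/

/-- `f` is `(-α)`-homogeneous on `s`: `f x = l ^ α f (l x)` for all `l > 0` and `x ∈ s`.
It is used for the cones `s = {0}ᶜ` and `s = univ`. -/
def IsHomogeneousOn {F : Type*} [AddCommGroup F] [Module ℝ F] (α : ℝ) (f : Space3 → F)
    (s : Set Space3) : Prop :=
  ∀ l : ℝ, 0 < l → ∀ x ∈ s, f x = l ^ α • f (l • x)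

/-- `u · ∇u + ∇p = 0` and `∇ · u = 0` hold at every point of `ℝ³ ∖ {0}`. It is only used for
`u` and `p` that are continuously differentiable there. -/
def IsClassicalEulerSolution (u : Space3 → Space3) (p : Space3 → ℝ) : Prop :=
  ∀ x : Space3, x ≠ 0 → fderiv ℝ u x (u x) + gradient p x = 0 ∧ divergence u x = 0

/-- `∇ · (u ⊗ u) + ∇p = 0` and `∇ · u = 0` hold in `ℝ³` in the sense of distributions. It is only
used for continuous `u` and `p`. -/
def IsDistributionalEulerSolution (u : Space3 → Space3) (p : Space3 → ℝ) : Prop :=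
  (∀ Φ : Space3 → Space3, ContDiff ℝ ∞ Φ → HasCompactSupport Φ →
    ∫ x, (inner ℝ (u x) (fderiv ℝ Φ x (u x)) + p x * divergence Φ x) = 0) ∧
  (∀ η : Space3 → ℝ, ContDiff ℝ ∞ η → HasCompactSupport η →
    ∫ x, fderiv ℝ η x (u x) = 0)

/-- A continuously differentiable `(-α)`-homogeneous solution in `ℝ³ ∖ {0}`: the velocity is
`(-α)`-homogeneous and the pressure is `(-2α)`-homogeneous. The values at `0` play no role. -/
structure IsClassicalHomogeneousSolution (α : ℝ) (u : Space3 → Space3) (p : Space3 → ℝ) :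
    Prop where
  contDiffOn_velocity : ContDiffOn ℝ 1 u {0}ᶜ
  contDiffOn_pressure : ContDiffOn ℝ 1 p {0}ᶜ
  homogeneous_velocity : IsHomogeneousOn α u {0}ᶜ
  homogeneous_pressure : IsHomogeneousOn (2 * α) p {0}ᶜ
  euler : IsClassicalEulerSolution u p

/-- A continuous `(-α)`-homogeneous solution in `ℝ³`. -/
structure IsContinuousHomogeneousSolution (α : ℝ) (u : Space3 → Space3) (p : Space3 → ℝ) :
    Prop where
  continuous_velocity : Continuous u
  continuous_pressure : Continuous p
  homogeneous_velocity : IsHomogeneousOn α u Set.univ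
  homogeneous_pressure : IsHomogeneousOn (2 * α) p Set.univ
  euler : IsDistributionalEulerSolution u p

/-! ### Beltrami flows and rotational flows -/

/-- `(∇ × u) × u = 0` in `ℝ³ ∖ {0}`. -/
def IsBeltrami (u : Space3 → Space3) : Prop :=
  ∀ x : Space3, x ≠ 0 → crossProduct (curl u x).ofLp (u x).ofLp = 0

/-- The Bernoulli function `p + |u|² / 2` vanishes in `ℝ³`; for a continuous homogeneous solution
this is the definition of a Beltrami flow. -/
def IsBeltramiBernoulli (u : Space3 → Space3) (p : Space3 → ℝ) : Prop :=
  ∀ x : Space3, p x + ‖u x‖ ^ 2 / 2 = 0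

/-- `∇ × u` does not vanish identically in `ℝ³ ∖ {0}`. -/
def IsRotational (u : Space3 → Space3) : Prop :=
  ∃ x : Space3, x ≠ 0 ∧ curl u x ≠ 0

/-- The distribution `∇ × u` on `ℝ³` is not zero, for a continuous field `u`. -/
def IsDistributionallyRotational (u : Space3 → Space3) : Prop :=
  ∃ Φ : Space3 → Space3, ContDiff ℝ ∞ Φ ∧ HasCompactSupport Φ ∧
    ∫ x, inner ℝ (u x) (curl Φ x) ≠ 0

/-! ### Axisymmetry and cylindrical coordinates -/

/-- The rotation by the angle `a` about the third axis. -/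
def rotZ (a : ℝ) (x : Space3) : Space3 :=
  !₂[Real.cos a * x 0 - Real.sin a * x 1, Real.sin a * x 0 + Real.cos a * x 1, x 2]

/-- `u` and `p` are axisymmetric on `s` (a set that is invariant under the rotations): the
cylindrical components of `u` and the function `p` do not depend on the angle. -/
def IsAxisymmetricOn (u : Space3 → Space3) (p : Space3 → ℝ) (s : Set Space3) : Prop :=
  ∀ a : ℝ, ∀ x ∈ s, u (rotZ a x) = rotZ a (u x) ∧ p (rotZ a x) = p x

/-- The distance `r` to the third axis. -/
def cylRadius (x : Space3) : ℝ := Real.sqrt (x 0 ^ 2 + x 1 ^ 2)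

/-- The third axis `{r = 0}`. -/
def zAxis : Set Space3 := {x | cylRadius x = 0}

/-- The frame vector `e_r`; it is zero on the axis. -/
def eR (x : Space3) : Space3 := !₂[x 0 / cylRadius x, x 1 / cylRadius x, 0]

/-- The frame vector `e_φ`; it is zero on the axis. -/
def ePhi (x : Space3) : Space3 := !₂[-x 1 / cylRadius x, x 0 / cylRadius x, 0]

/-- The frame vector `e_z`. -/
def eZ : Space3 := !₂[0, 0, 1]

/-- The poloidal component `u^r e_r + u^z e_z`. On the axis it is `u^z e_z`, which is all of `u`
if `u` is axisymmetric. -/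
def poloidal (u : Space3 → Space3) (x : Space3) : Space3 :=
  inner ℝ (u x) (eR x) • eR x + inner ℝ (u x) eZ • eZ

/-- The toroidal component `u^φ e_φ`. On the axis it is zero. -/
def toroidal (u : Space3 → Space3) (x : Space3) : Space3 :=
  inner ℝ (u x) (ePhi x) • ePhi x

/-! ### The one-dimensional Dirichlet problem and the associated fields -/

/-- `w ∈ C²(-1,1) ∩ C¹[-1,1]` solves
`-w'' = β(β+1)/(1-t²) w + c₁ w|w|^{4/β} + c₂/(1-t²) w|w|^{2/β}` in `(-1,1)`, `w(1) = w(-1) = 0`. -/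
structure IsDirichletSolution (β c₁ c₂ : ℝ) (w : ℝ → ℝ) : Prop where
  contDiffOn_Ioo : ContDiffOn ℝ 2 w (Set.Ioo (-1) 1)
  contDiffOn_Icc : ContDiffOn ℝ 1 w (Set.Icc (-1) 1)
  equation : ∀ t ∈ Set.Ioo (-1 : ℝ) 1,
    -deriv (deriv w) t = β * (β + 1) / (1 - t ^ 2) * w t
      + c₁ * (w t * |w t| ^ (4 / β)) + c₂ / (1 - t ^ 2) * (w t * |w t| ^ (2 / β))
  boundary_right : w 1 = 0
  boundary_left : w (-1) = 0

/-- The homogeneous stream function `ψ = w(cos θ) / ρ^β`, where `ρ = |x|` and `cos θ = x₃ / |x|`. -/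
def streamFunction (β : ℝ) (w : ℝ → ℝ) (x : Space3) : ℝ :=
  w (x 2 / ‖x‖) / ‖x‖ ^ β

/-- The function `Γ = C ψ |ψ|^{1/β}`. -/
def swirlFunction (β C : ℝ) (w : ℝ → ℝ) (x : Space3) : ℝ :=
  C * (streamFunction β w x * |streamFunction β w x| ^ (1 / β))

/-- The field `∇ × (ψ ∇φ) + Γ ∇φ = -(∂_z ψ / r) e_r + (∂_r ψ / r) e_z + (Γ / r) e_φ`
off the axis. -/
def clebschField (β C : ℝ) (w : ℝ → ℝ) (x : Space3) : Space3 :=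
  (-(fderiv ℝ (streamFunction β w) x eZ) / cylRadius x) • eR x
    + (fderiv ℝ (streamFunction β w) x (eR x) / cylRadius x) • eZ
    + (swirlFunction β C w x / cylRadius x) • ePhi x

/-- `u` is obtained from a solution of the Dirichlet problem with `β = α - 2`, `c₁ = 0` and
`c₂ = C² (1 + 1/β)` for a constant `C ≠ 0`. -/
def IsObtainedFromDirichlet (α : ℝ) (u : Space3 → Space3) : Prop :=
  ∃ (C : ℝ) (w : ℝ → ℝ), C ≠ 0 ∧
    IsDirichletSolution (α - 2) 0 (C ^ 2 * (1 + 1 / (α - 2))) w ∧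
    ∀ x : Space3, x ∉ zAxis → u x = clebschField (α - 2) C w x

end HomogeneousEuler

end

open HomogeneousEuler

namespace HomogeneousEuler

section

open MeasureTheory Set Filter Topology

/-! Nonexistence rests on one observation: a C¹ field that is tangential to the spheres |x| = const
and has nonnegative divergence is divergence-free, as testing with radial cutoffs shows
(`divergence_eq_zero_of_tangential`). Let f = x · u, τ = |x|² u - f x and Q = |x|²|u|² - f² ≥ 0.
Homogeneity gives ∂_x f = (1 - α) f, the Beltrami property gives ∂_u f = (1 - α)|u|², hence ∂_τ f =
(1 - α) Q, while div τ = (α - 2) f. For 1 ≤ α ≤ 2 the divergence of -f τ is (α - 1) Q + (2 - α) f² ≥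
0, so both terms vanish (`energy_identity`): u is radial if α = 2, tangential if α = 1, zero in
between, and the rotation, being parallel to u, must vanish. For α < 1 the weight is h^(2n) f with h
= x · (∇ × u) and n large. Where u ≠ 0 one has ∇ × u = l u with u · ∇l = 0, which gives f ∂_τ h = h
((1 - α) Q + f²). The divergence is again nonnegative, so h vanishes wherever u does not. A nonzero
rotation would then force f = 0 on an open set, where ∂_τ f = (1 - α)|x|²|u|² > 0. Differentiating h
is what needs u ∈ C².

For existence take C = 1 and β = α - 2, so that β > 0 or β < -2, and γ(s) = s|s|^(1/β). By the
equation for w, the rotation of the field is γ'(ψ) times its poloidal part plus the azimuthal part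
(1 + 1/β) ψ|ψ|^(2/β) / r (`swirlField_off_axis`). Since γγ' = (1 + 1/β) s|s|^(2/β), the rotation is
γ'(ψ) u wherever γ is differentiable; the pressure is -|u|²/2.

The Dirichlet problem is solved by shooting from t = 0 with w = 0 and w' = a
(`exists_shootingOrbit_tendsto_zero`). For β < -2 the nonlinearity is sublinear and not Lipschitz at
0; with w = y³ and a new time the system for (y, w', t) becomes C¹ and bounded. Two monotone
energies bound w' by a/√(1 - t²) and show that t exhausts [0, 1). If no a > 0 gave w(1) = 0, the
polar angle of every orbit in the (w', y)-plane would be trapped between two multiples of π, and the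
set of slopes whose angle exceeds Nπ would be open and closed. It is nonempty for each N, by small
slopes in the sublinear and large slopes in the superlinear case (`exists_frequency`), so it would
be everything, although a single orbit has a bounded angle. Oddness supplies the interval (-1, 0).

For β > 0, regularity at the axis comes from functions H(cos θ) with (1 - t²) H' → 0 at ±1:
multiplied by a C¹ field that vanishes on the axis they stay C¹ (`HasAxisDeriv.contDiffOn_smul`).
For β < -2 the field is only continuous. The weak equations are proved off the axis with γ replaced
by s(s² + ε²)^(1/(2β)) and ε → 0 (`integral_weakIntegrand_off_axis`). The axis is removable, since a
cutoff at scale δ has gradient of order 1/δ on a set of volume of order δ²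
(`integral_weakIntegrand_eq_zero`). -/

theorem isOpen_compl_origin : IsOpen ({0}ᶜ : Set Space3) := isOpen_compl_singleton

/-! ### Vector calculus in coordinates and integration by parts. -/

/-- A vector is the sum of its components. -/
theorem sum_single (v : Space3) : v = ∑ i, v i • (EuclideanSpace.single i 1 : Space3) := by
  ext j
  simp [Fin.sum_univ_three, PiLp.add_apply]
  fin_cases j <;> simp

theorem clm_eq_sum {F : Type*} [NormedAddCommGroup F] [NormedSpace ℝ F] (D : Space3 →L[ℝ] F)
    (v : Space3) : D v = ∑ i, v i • D (EuclideanSpace.single i 1) := by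
  conv_lhs => rw [sum_single v]
  simp

theorem inner_eq_sum (v w : Space3) : inner ℝ v w = v 0 * w 0 + v 1 * w 1 + v 2 * w 2 := by
  simp [PiLp.inner_apply, Fin.sum_univ_three]; ring

theorem normsq_eq_sum (v : Space3) : ‖v‖ ^ 2 = v 0 ^ 2 + v 1 ^ 2 + v 2 ^ 2 := by
  rw [← real_inner_self_eq_norm_sq, inner_eq_sum]; ring

theorem fderiv_component {u : Space3 → Space3} {x : Space3} (hu : DifferentiableAt ℝ u x)
    (i : Fin 3) (v : Space3) : fderiv ℝ (fun y => u y i) x v = fderiv ℝ u x v i := by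
  have h := ((EuclideanSpace.proj i : Space3 →L[ℝ] ℝ).hasFDerivAt (x := u x)).comp x hu.hasFDerivAt
  have h2 : HasFDerivAt (fun y => u y i) ((EuclideanSpace.proj i : Space3 →L[ℝ] ℝ).comp
    (fderiv ℝ u x)) x := h
  rw [h2.fderiv]; rfl

theorem divergence_eq_of_hasFDerivAt {u : Space3 → Space3} {D : Space3 →L[ℝ] Space3} {x : Space3}
    (h : HasFDerivAt u D x) : divergence u x = ∑ i, D (EuclideanSpace.single i 1) i := by
  simp [divergence, pderiv, h.fderiv]

theorem divergence_smul {g : Space3 → ℝ} {u : Space3 → Space3} {x : Space3}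
    (hg : DifferentiableAt ℝ g x) (hu : DifferentiableAt ℝ u x) :
    divergence (fun y => g y • u y) x = fderiv ℝ g x (u x) + g x * divergence u x := by
  rw [divergence_eq_of_hasFDerivAt (hg.hasFDerivAt.fun_smul hu.hasFDerivAt), clm_eq_sum _ (u x)]
  simp [divergence, pderiv, Fin.sum_univ_three]
  ring

theorem divergence_sub {u w : Space3 → Space3} {x : Space3}
    (hu : DifferentiableAt ℝ u x) (hw : DifferentiableAt ℝ w x) :
    divergence (fun y => u y - w y) x = divergence u x - divergence w x := by
  rw [divergence_eq_of_hasFDerivAt (hu.hasFDerivAt.fun_sub hw.hasFDerivAt)]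
  simp [divergence, pderiv, Fin.sum_univ_three]

theorem divergence_id (x : Space3) : divergence (fun y => y) x = 3 := by
  rw [divergence_eq_of_hasFDerivAt (u := fun y => y) (hasFDerivAt_id x)]
  simp

/-- A function that is continuous on an open set containing its topological support is
continuous. -/
theorem continuous_of_tsupport_subset {X Y : Type*} [TopologicalSpace X] [TopologicalSpace Y]
    [Zero Y] {f : X → Y} {O : Set X} (hO : IsOpen O) (hf : ContinuousOn f O)
    (hs : tsupport f ⊆ O) : Continuous f := by
  rw [continuous_iff_continuousAt]
  intro x
  by_cases hx : x ∈ tsupport f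
  · exact hf.continuousAt (hO.mem_nhds (hs hx))
  · have : f =ᶠ[𝓝 x] fun _ => 0 := notMem_tsupport_iff_eventuallyEq.1 hx
    exact (continuousAt_const (y := (0 : Y))).congr this.symm

theorem continuousOn_divergence {W : Space3 → Space3} {O : Set Space3} (hO : IsOpen O)
    (hW : ContDiffOn ℝ 1 W O) : ContinuousOn (divergence W) O := by
  unfold divergence pderiv
  refine continuousOn_finsetSum _ fun i _ => ?_
  have h := (hW.continuousOn_fderiv_of_isOpen hO le_rfl)
  have h1 := h.clm_apply (continuousOn_const (c := (EuclideanSpace.single i 1 : Space3)))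
  exact (EuclideanSpace.proj i : Space3 →L[ℝ] ℝ).continuous.comp_continuousOn h1

/-- Integration by parts against a compactly supported function. -/
theorem integral_fderiv_apply_eq_neg {f : Space3 → ℝ} {W : Space3 → Space3} {O : Set Space3}
    (hO : IsOpen O) (hf : ContDiff ℝ 1 f) (hc : HasCompactSupport f) (hs : tsupport f ⊆ O)
    (hW : ContDiffOn ℝ 1 W O) :
    ∫ x, fderiv ℝ f x (W x) = -∫ x, f x * divergence W x := by
  have hWd : ∀ x ∈ tsupport f, DifferentiableAt ℝ W x := fun x hx =>
    (hW.differentiableOn one_ne_zero).differentiableAt (hO.mem_nhds (hs hx))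
  have hWc : ∀ i, ContinuousOn (fun x => W x i) O := fun i =>
    (EuclideanSpace.proj i : Space3 →L[ℝ] ℝ).continuous.comp_continuousOn hW.continuousOn
  have hdW : ∀ i, ContinuousOn (fun x => fderiv ℝ W x (EuclideanSpace.single i 1) i) O := by
    intro i
    have h1 := (hW.continuousOn_fderiv_of_isOpen hO le_rfl).clm_apply
      (continuousOn_const (c := (EuclideanSpace.single i 1 : Space3)))
    exact (EuclideanSpace.proj i : Space3 →L[ℝ] ℝ).continuous.comp_continuousOn h1
  have hdf : ∀ i, Continuous (fun x => fderiv ℝ f x (EuclideanSpace.single i 1)) := fun i =>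
    (hf.continuous_fderiv one_ne_zero).clm_apply continuous_const
  have hdfs : ∀ i, tsupport (fun x => fderiv ℝ f x (EuclideanSpace.single i 1)) ⊆ tsupport f :=
    fun i => tsupport_fderiv_apply_subset ℝ _
  have key : ∀ (a b : Space3 → ℝ), Continuous a → tsupport a ⊆ tsupport f → ContinuousOn b O →
      Integrable (fun x => a x * b x) := by
    intro a b ha has hb
    have h1 : tsupport (fun x => a x * b x) ⊆ tsupport a := by
      refine closure_mono fun x hx => ?_
      simp only [Function.mem_support] at hx ⊢
      exact left_ne_zero_of_mul hx
    refine (continuous_of_tsupport_subset hO (ha.continuousOn.mul hb)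
      ((h1.trans has).trans hs)).integrable_of_hasCompactSupport ?_
    exact hc.of_isClosed_subset (isClosed_tsupport _) (h1.trans has)
  have hi : ∀ i, ∫ x, fderiv ℝ f x (EuclideanSpace.single i 1) * W x i
      = - ∫ x, f x * fderiv ℝ W x (EuclideanSpace.single i 1) i := by
    intro i
    have hcongr : (fun x => f x * fderiv ℝ (fun y => W y i) x (EuclideanSpace.single i 1))
        = fun x => f x * fderiv ℝ W x (EuclideanSpace.single i 1) i := by
      funext x
      by_cases hx : x ∈ tsupport f
      · rw [fderiv_component (hWd x hx)]
      · rw [image_eq_zero_of_notMem_tsupport hx]; ring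
    have := integral_mul_fderiv_eq_neg_fderiv_mul_of_integrable (μ := (volume : Measure Space3))
      (f := f) (g := fun x => W x i)
      (v := EuclideanSpace.single i 1) (key _ _ (hdf i) (hdfs i) (hWc i))
      (by rw [hcongr]; exact key _ _ hf.continuous subset_rfl (hdW i))
      (key _ _ hf.continuous subset_rfl (hWc i))
      (fun x _ => hf.differentiable one_ne_zero x)
      (fun x hx => (EuclideanSpace.proj i : Space3 →L[ℝ] ℝ).differentiableAt.comp x (hWd x hx))
    rw [hcongr] at this
    rw [this, neg_neg]
  have e1 : (fun x => fderiv ℝ f x (W x))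
      = fun x => ∑ i, fderiv ℝ f x (EuclideanSpace.single i 1) * W x i := by
    funext x
    rw [clm_eq_sum (fderiv ℝ f x) (W x)]
    simp [mul_comm]
  have e2 : (fun x => f x * divergence W x)
      = fun x => ∑ i, f x * fderiv ℝ W x (EuclideanSpace.single i 1) i := by
    funext x
    rw [divergence, Finset.mul_sum]; rfl
  rw [e1, e2, integral_finsetSum _ fun i _ => key _ _ (hdf i) (hdfs i) (hWc i),
    integral_finsetSum _ fun i _ => key _ _ hf.continuous subset_rfl (hdW i),
    ← Finset.sum_neg_distrib]
  exact Finset.sum_congr rfl fun i _ => hi i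

/-- A field that is tangential to the spheres and has a nonnegative divergence is
divergence-free. -/
theorem divergence_eq_zero_of_tangential {W : Space3 → Space3} (hW : ContDiffOn ℝ 1 W {0}ᶜ)
    (ht : ∀ x, x ≠ 0 → inner ℝ x (W x) = 0) (hd : ∀ x, x ≠ 0 → 0 ≤ divergence W x) :
    ∀ x, x ≠ 0 → divergence W x = 0 := by
  intro x₀ hx₀
  have hpos : 0 < ‖x₀‖ ^ 2 := by positivity
  -- A bump in the variable |x|²: the cutoff is radial, so its gradient is a multiple of x and
  -- annihilates W, and its support stays away from the origin.
  let χ : ContDiffBump (‖x₀‖ ^ 2 : ℝ) := ⟨‖x₀‖ ^ 2 / 4, ‖x₀‖ ^ 2 / 2, by positivity, by linarith⟩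
  let f : Space3 → ℝ := fun x => χ (‖x‖ ^ 2)
  have hf : ContDiff ℝ 1 f := χ.contDiff.comp (contDiff_norm_sq ℝ)
  have hsub : tsupport f ⊆ (fun x : Space3 => ‖x‖ ^ 2) ⁻¹' Metric.closedBall (‖x₀‖ ^ 2) (‖x₀‖ ^ 2 / 2) := by
    refine (tsupport_comp_subset_preimage χ (by fun_prop : Continuous fun x : Space3 => ‖x‖ ^ 2)).trans ?_
    rw [χ.tsupport_eq]
  have hbd : ∀ x ∈ tsupport f, ‖x₀‖ ^ 2 / 2 ≤ ‖x‖ ^ 2 ∧ ‖x‖ ^ 2 ≤ 3 / 2 * ‖x₀‖ ^ 2 := by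
    intro x hx
    have := hsub hx
    rw [mem_preimage, Metric.mem_closedBall, Real.dist_eq, abs_le] at this
    constructor <;> linarith
  have hc : HasCompactSupport f := by
    refine (isCompact_closedBall (0 : Space3) (2 * ‖x₀‖)).of_isClosed_subset (isClosed_tsupport _) ?_
    intro x hx
    rw [mem_closedBall_zero_iff]
    have := (hbd x hx).2
    nlinarith [norm_nonneg x, norm_nonneg x₀]
  have hs : tsupport f ⊆ {0}ᶜ := by
    intro x hx h0
    rw [mem_singleton_iff] at h0
    have := (hbd x hx).1
    rw [h0, norm_zero] at this
    linarith
  have hI := integral_fderiv_apply_eq_neg isOpen_compl_origin hf hc hs hW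
  have hz : ∀ x, fderiv ℝ f x (W x) = 0 := by
    intro x
    by_cases hx : x = 0
    · have : x ∉ tsupport f := fun h => hs h (by simpa using hx)
      have h2 : fderiv ℝ f x = 0 := by
        by_contra h
        exact this (support_fderiv_subset ℝ h)
      simp [h2]
    · have h1 : HasFDerivAt f (deriv χ (‖x‖ ^ 2) • (2 • (innerSL ℝ) x)) x :=
        ((χ.contDiff (n := 1)).differentiable one_ne_zero _).hasDerivAt.comp_hasFDerivAt x
          (HasStrictFDerivAt.hasFDerivAt (hasStrictFDerivAt_norm_sq x))
      rw [h1.fderiv]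
      simp [ht x hx]
  simp only [hz, integral_zero] at hI
  have hcont : Continuous fun x => f x * divergence W x := by
    refine continuous_of_tsupport_subset isOpen_compl_origin
      (hf.continuous.continuousOn.mul (continuousOn_divergence isOpen_compl_origin hW)) ?_
    refine subset_trans (closure_mono fun x hx => ?_) hs
    exact left_ne_zero_of_mul hx
  by_contra hne
  have h3 : 0 < ∫ x, f x * divergence W x := by
    refine hcont.integral_pos_of_hasCompactSupport_nonneg_nonzero (x := x₀) hc.mul_right ?_ ?_
    · intro x
      by_cases hx : x = 0
      · have : x ∉ tsupport f := fun h => hs h (by simpa using hx)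
        simp [image_eq_zero_of_notMem_tsupport this]
      · exact mul_nonneg χ.nonneg (hd x hx)
    · have : f x₀ = 1 := χ.one_of_mem_closedBall (by simp [χ]; positivity)
      rw [this, one_mul]; exact hne
  linarith

/-! ### Homogeneous functions and Beltrami fields. -/

/-- Euler's identity for homogeneous functions. -/
theorem IsHomogeneousOn.fderiv_self {F : Type*} [NormedAddCommGroup F] [NormedSpace ℝ F] {α : ℝ}
    {f : Space3 → F} (hf : IsHomogeneousOn α f {0}ᶜ) {x : Space3} (hx : x ≠ 0)
    (hd : DifferentiableAt ℝ f x) : fderiv ℝ f x x = -α • f x := by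
  have hg : ∀ l : ℝ, 0 < l → f (l • x) = l ^ (-α) • f x := by
    intro l hl
    have := hf l hl x hx
    rw [this, smul_smul, ← Real.rpow_add hl]; simp
  have h1 : HasDerivAt (fun l : ℝ => f (l • x)) (fderiv ℝ f x x) 1 := by
    have h2 : HasDerivAt (fun l : ℝ => l • x) ((1 : ℝ) • x) 1 := (hasDerivAt_id (1 : ℝ)).smul_const x
    have h3 : HasFDerivAt f (fderiv ℝ f x) ((1 : ℝ) • x) := by rw [one_smul]; exact hd.hasFDerivAt
    exact h3.comp_hasDerivAt (1 : ℝ) h2 |>.congr_deriv (by simp)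
  have h2 : HasDerivAt (fun l : ℝ => l ^ (-α) • f x) ((-α) • f x) 1 := by
    have := (Real.hasDerivAt_rpow_const (x := (1 : ℝ)) (p := -α) (Or.inl one_ne_zero)).smul_const (f x)
    simpa using this
  refine (h1.congr_of_eventuallyEq ?_).unique h2 |>.symm ▸ rfl
  filter_upwards [lt_mem_nhds (zero_lt_one (α := ℝ))] with l hl
  exact (hg l hl).symm

theorem IsHomogeneousOn.fderiv {F : Type*} [NormedAddCommGroup F] [NormedSpace ℝ F] {α : ℝ}
    {f : Space3 → F} (hf : IsHomogeneousOn α f {0}ᶜ) :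
    IsHomogeneousOn (α + 1) (fderiv ℝ f) {0}ᶜ := by
  intro l hl x hx
  have h : f =ᶠ[𝓝 x] fun y => l ^ α • f (l • y) := by
    filter_upwards [isOpen_compl_origin.mem_nhds hx] with y hy using hf l hl y hy
  rw [h.fderiv_eq]
  change _root_.fderiv ℝ (l ^ α • fun y => f (l • y)) x = _
  rw [fderiv_const_smul_field, Pi.smul_apply, _root_.fderiv_comp_smul, smul_smul,
    Real.rpow_add_one hl.ne']

/-- The rotation of a field with derivative `D`, as a linear function of `D`. -/
theorem curl_inner (u : Space3 → Space3) (x v : Space3) : inner ℝ (curl u x) v =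
    v 0 * (pderiv u 1 2 x - pderiv u 2 1 x) + v 1 * (pderiv u 2 0 x - pderiv u 0 2 x)
      + v 2 * (pderiv u 0 1 x - pderiv u 1 0 x) := by
  rw [inner_eq_sum]
  simp [curl]
  ring

theorem fderiv_apply_eq_pderiv (u : Space3 → Space3) (x v : Space3) (j : Fin 3) :
    fderiv ℝ u x v j = v 0 * pderiv u 0 j x + v 1 * pderiv u 1 j x + v 2 * pderiv u 2 j x := by
  rw [clm_eq_sum (fderiv ℝ u x) v]
  simp [Fin.sum_univ_three, pderiv]

theorem crossProduct_eq_zero_iff_inner (a b : Space3) :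
    crossProduct a.ofLp b.ofLp = 0 ↔
      a 1 * b 2 - a 2 * b 1 = 0 ∧ a 2 * b 0 - a 0 * b 2 = 0 ∧ a 0 * b 1 - a 1 * b 0 = 0 := by
  rw [cross_apply]
  constructor
  · intro h
    exact ⟨congrFun h 0, congrFun h 1, congrFun h 2⟩
  · rintro ⟨h0, h1, h2⟩
    ext i; fin_cases i <;> simpa

/-- If two vectors are parallel and the second is not zero, the first is a multiple of it. -/
theorem eq_smul_of_crossProduct_eq_zero {a b : Space3} (hb : b ≠ 0)
    (h : crossProduct a.ofLp b.ofLp = 0) : a = (inner ℝ a b / ‖b‖ ^ 2) • b := by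
  obtain ⟨h0, h1, h2⟩ := (crossProduct_eq_zero_iff_inner a b).1 h
  have hn : ‖b‖ ^ 2 ≠ 0 := by positivity
  have key : ‖b‖ ^ 2 • a = inner ℝ a b • b := by
    rw [normsq_eq_sum, inner_eq_sum]
    ext i
    fin_cases i
    · simp; linear_combination b 1 * h2 - b 2 * h1
    · simp; linear_combination b 2 * h0 - b 0 * h2
    · simp; linear_combination b 0 * h1 - b 1 * h0
  rw [div_eq_inv_mul, ← smul_smul, ← key, smul_smul, inv_mul_cancel₀ hn, one_smul]

/-- For a Beltrami field, `u · ∇u = ∇|u|²/2`. -/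
theorem inner_fderiv_of_isBeltrami {u : Space3 → Space3} (hb : IsBeltrami u) {x : Space3}
    (hx : x ≠ 0) (v : Space3) :
    inner ℝ (fderiv ℝ u x (u x)) v = inner ℝ (fderiv ℝ u x v) (u x) := by
  obtain ⟨h0, h1, h2⟩ := (crossProduct_eq_zero_iff_inner _ _).1 (hb x hx)
  simp only [curl, PiLp.toLp_apply, Matrix.cons_val_zero, Matrix.cons_val_one, Matrix.cons_val] at h0 h1 h2
  simp only [inner_eq_sum, fderiv_apply_eq_pderiv]
  linear_combination v 0 * h0 + v 1 * h1 + v 2 * h2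

/-! ### The radial velocity and the energy identity. -/

section radial
variable {α : ℝ} {u : Space3 → Space3}

/-- The velocity and vorticity structure shared by all Beltrami homogeneous solutions. -/
structure IsBeltramiHomogeneous (α : ℝ) (u : Space3 → Space3) : Prop where
  contDiffOn : ContDiffOn ℝ 1 u {0}ᶜ
  homogeneous : IsHomogeneousOn α u {0}ᶜ
  divergence_eq : ∀ x, x ≠ 0 → divergence u x = 0
  beltrami : IsBeltrami u

namespace IsBeltramiHomogeneous

theorem differentiableAt (h : IsBeltramiHomogeneous α u) {x : Space3} (hx : x ≠ 0) :
    DifferentiableAt ℝ u x :=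
  (h.contDiffOn.differentiableOn one_ne_zero).differentiableAt (isOpen_compl_origin.mem_nhds hx)

theorem hasFDerivAt_radial (h : IsBeltramiHomogeneous α u) {x : Space3} (hx : x ≠ 0) :
    HasFDerivAt (fun y => inner ℝ y (u y))
      ((fderivInnerCLM ℝ (x, u x)).comp
        ((ContinuousLinearMap.id ℝ Space3).prod (fderiv ℝ u x))) x :=
  (hasFDerivAt_id x).inner ℝ (h.differentiableAt hx).hasFDerivAt

theorem fderiv_radial (h : IsBeltramiHomogeneous α u) {x : Space3} (hx : x ≠ 0) (v : Space3) :
    fderiv ℝ (fun y => inner ℝ y (u y)) x v = inner ℝ x (fderiv ℝ u x v) + inner ℝ v (u x) := by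
  rw [(h.hasFDerivAt_radial hx).fderiv]
  simp [fderivInnerCLM_apply]

theorem fderiv_radial_self (h : IsBeltramiHomogeneous α u) {x : Space3} (hx : x ≠ 0) :
    fderiv ℝ (fun y => inner ℝ y (u y)) x x = (1 - α) * inner ℝ x (u x) := by
  rw [h.fderiv_radial hx, h.homogeneous.fderiv_self hx (h.differentiableAt hx), inner_smul_right]
  ring

/-- The Beltrami property exchanges x · ∂_u u for u · ∂_x u, which Euler's identity evaluates as
-α|u|². -/
theorem fderiv_radial_velocity (h : IsBeltramiHomogeneous α u) {x : Space3} (hx : x ≠ 0) :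
    fderiv ℝ (fun y => inner ℝ y (u y)) x (u x) = (1 - α) * ‖u x‖ ^ 2 := by
  rw [h.fderiv_radial hx, real_inner_comm, inner_fderiv_of_isBeltrami h.beltrami hx,
    h.homogeneous.fderiv_self hx (h.differentiableAt hx), inner_smul_left,
    real_inner_self_eq_norm_sq]
  simp; ring

end IsBeltramiHomogeneous

/-- The tangential part `|x|² u - (x · u) x` of the velocity. -/
noncomputable def tangential (u : Space3 → Space3) (x : Space3) : Space3 :=
  ‖x‖ ^ 2 • u x - inner ℝ x (u x) • x

theorem inner_tangential (u : Space3 → Space3) (x : Space3) : inner ℝ x (tangential u x) = 0 := by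
  rw [tangential, inner_sub_right, inner_smul_right, inner_smul_right, real_inner_self_eq_norm_sq]
  ring

theorem inner_tangential_velocity (u : Space3 → Space3) (x : Space3) :
    inner ℝ (u x) (tangential u x) = ‖x‖ ^ 2 * ‖u x‖ ^ 2 - inner ℝ x (u x) ^ 2 := by
  rw [tangential, inner_sub_right, inner_smul_right, inner_smul_right, real_inner_self_eq_norm_sq,
    real_inner_comm]
  ring

theorem radial_sq_le (u : Space3 → Space3) (x : Space3) :
    0 ≤ ‖x‖ ^ 2 * ‖u x‖ ^ 2 - inner ℝ x (u x) ^ 2 := by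
  have h := abs_real_inner_le_norm x (u x)
  have := pow_le_pow_left₀ (abs_nonneg _) h 2
  rw [sq_abs, mul_pow] at this
  linarith

theorem norm_tangential_sq (u : Space3 → Space3) (x : Space3) : ‖tangential u x‖ ^ 2
    = ‖x‖ ^ 2 * (‖x‖ ^ 2 * ‖u x‖ ^ 2 - inner ℝ x (u x) ^ 2) := by
  rw [← real_inner_self_eq_norm_sq]
  conv_lhs => arg 2; rw [tangential]
  rw [inner_sub_left, inner_smul_left, inner_smul_left, inner_tangential_velocity,
    inner_tangential]
  simp

namespace IsBeltramiHomogeneous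

theorem contDiffOn_radial (h : IsBeltramiHomogeneous α u) :
    ContDiffOn ℝ 1 (fun y => inner ℝ y (u y)) {0}ᶜ :=
  contDiffOn_id.inner ℝ h.contDiffOn

theorem contDiffOn_tangential (h : IsBeltramiHomogeneous α u) :
    ContDiffOn ℝ 1 (tangential u) {0}ᶜ :=
  ((contDiff_norm_sq ℝ).contDiffOn.smul h.contDiffOn).sub (h.contDiffOn_radial.smul contDiffOn_id)

theorem fderiv_radial_tangential (h : IsBeltramiHomogeneous α u) {x : Space3} (hx : x ≠ 0) :
    fderiv ℝ (fun y => inner ℝ y (u y)) x (tangential u x)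
      = (1 - α) * (‖x‖ ^ 2 * ‖u x‖ ^ 2 - inner ℝ x (u x) ^ 2) := by
  rw [tangential, map_sub, map_smul, map_smul, h.fderiv_radial_velocity hx, h.fderiv_radial_self hx]
  simp; ring

/-- The contributions are 2f from ∇|x|² · u, -(1 - α) f from the radial derivative of f = x · u, and
-3f from div x. -/
theorem divergence_tangential (h : IsBeltramiHomogeneous α u) {x : Space3} (hx : x ≠ 0) :
    divergence (tangential u) x = (α - 2) * inner ℝ x (u x) := by
  have hs : DifferentiableAt ℝ (fun y : Space3 => ‖y‖ ^ 2) x :=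
    (contDiff_norm_sq ℝ (n := 1)).differentiable one_ne_zero x
  have hr := (h.hasFDerivAt_radial hx).differentiableAt
  have hu := h.differentiableAt hx
  have h1 := divergence_sub (hs.fun_smul hu) (hr.fun_smul (differentiableAt_fun_id))
  have e : tangential u = fun y => ‖y‖ ^ 2 • u y - inner ℝ y (u y) • y := rfl
  rw [e, h1, divergence_smul hs hu, divergence_smul hr differentiableAt_fun_id, divergence_id,
    h.divergence_eq x hx, h.fderiv_radial_self hx,
    (HasStrictFDerivAt.hasFDerivAt (hasStrictFDerivAt_norm_sq x)).fderiv]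
  simp
  ring

theorem divergence_smul_tangential (h : IsBeltramiHomogeneous α u) {G : Space3 → ℝ} {x : Space3}
    (hx : x ≠ 0) (hG : DifferentiableAt ℝ G x) :
    divergence (fun y => G y • tangential u y) x
      = fderiv ℝ G x (tangential u x) + G x * ((α - 2) * inner ℝ x (u x)) := by
  rw [divergence_smul hG ((h.contDiffOn_tangential.differentiableOn one_ne_zero).differentiableAt
    (isOpen_compl_origin.mem_nhds hx)), h.divergence_tangential hx]

/-- If the divergence of `G` times the tangential velocity is nonnegative, it is zero. -/
theorem weighted_identity (h : IsBeltramiHomogeneous α u) {G : Space3 → ℝ}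
    (hG : ContDiffOn ℝ 1 G {0}ᶜ)
    (hd : ∀ x, x ≠ 0 → 0 ≤ fderiv ℝ G x (tangential u x) + G x * ((α - 2) * inner ℝ x (u x)))
    {x : Space3} (hx : x ≠ 0) :
    fderiv ℝ G x (tangential u x) + G x * ((α - 2) * inner ℝ x (u x)) = 0 := by
  have hG' : ∀ x, x ≠ 0 → DifferentiableAt ℝ G x := fun x hx =>
    (hG.differentiableOn one_ne_zero).differentiableAt (isOpen_compl_origin.mem_nhds hx)
  rw [← h.divergence_smul_tangential hx (hG' x hx)]
  refine divergence_eq_zero_of_tangential (hG.smul h.contDiffOn_tangential) ?_ ?_ x hx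
  · intro x _
    show inner ℝ x (G x • tangential u x) = 0
    rw [inner_smul_right, inner_tangential, mul_zero]
  · intro x hx
    show 0 ≤ divergence (fun y => G y • tangential u y) x
    rw [h.divergence_smul_tangential hx (hG' x hx)]
    exact hd x hx

/-- The energy identity for `1 ≤ α ≤ 2`. -/
theorem energy_identity (h : IsBeltramiHomogeneous α u) (h1 : 1 ≤ α) (h2 : α ≤ 2) {x : Space3}
    (hx : x ≠ 0) : (α - 1) * (‖x‖ ^ 2 * ‖u x‖ ^ 2 - inner ℝ x (u x) ^ 2) = 0 ∧
      (2 - α) * inner ℝ x (u x) ^ 2 = 0 := by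
  have hf : ∀ x, x ≠ 0 → fderiv ℝ (fun y => -inner ℝ y (u y)) x (tangential u x)
      = (α - 1) * (‖x‖ ^ 2 * ‖u x‖ ^ 2 - inner ℝ x (u x) ^ 2) := by
    intro x hx
    rw [fderiv_fun_neg, neg_apply, h.fderiv_radial_tangential hx]; ring
  have hA : ∀ x, 0 ≤ (α - 1) * (‖x‖ ^ 2 * ‖u x‖ ^ 2 - inner ℝ x (u x) ^ 2) := fun x =>
    mul_nonneg (by linarith) (radial_sq_le u x)
  have hB : ∀ x, 0 ≤ (2 - α) * inner ℝ x (u x) ^ 2 := fun x =>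
    mul_nonneg (by linarith) (sq_nonneg _)
  -- With the weight -x · u the divergence is a sum of two terms that are nonnegative for 1 ≤ α ≤ 2,
  -- so each of them vanishes.
  have := h.weighted_identity (G := fun y => -inner ℝ y (u y)) h.contDiffOn_radial.neg ?_ hx
  · rw [hf x hx] at this
    have a := hA x
    have b := hB x
    constructor <;> nlinarith
  · intro x hx
    rw [hf x hx]
    nlinarith [hA x, hB x]

/-- If the rotation vanishes wherever the velocity does not, it vanishes identically. -/
theorem curl_eq_zero_of_velocity_ne_zero (h : IsBeltramiHomogeneous α u)
    (hc : ∀ x, x ≠ 0 → u x ≠ 0 → curl u x = 0) {x : Space3} (hx : x ≠ 0) : curl u x = 0 := by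
  by_contra hne
  have hcont : ContinuousOn (curl u) {0}ᶜ := by
    have hp : ∀ i j, ContinuousOn (pderiv u i j) {0}ᶜ := fun i j =>
      (EuclideanSpace.proj j : Space3 →L[ℝ] ℝ).continuous.comp_continuousOn
        ((h.contDiffOn.continuousOn_fderiv_of_isOpen isOpen_compl_origin le_rfl).clm_apply
          continuousOn_const)
    refine (PiLp.continuous_toLp 2 _).comp_continuousOn (continuousOn_pi.2 fun i => ?_)
    fin_cases i
    · exact (hp 1 2).sub (hp 2 1)
    · exact (hp 2 0).sub (hp 0 2)
    · exact (hp 0 1).sub (hp 1 0)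
  have hev : ∀ᶠ y in 𝓝 x, curl u y ≠ 0 ∧ y ≠ 0 :=
    ((hcont.continuousAt (isOpen_compl_origin.mem_nhds hx)).eventually_ne hne).and
      (isOpen_compl_origin.mem_nhds hx)
  -- The rotation is nonzero near x, so the hypothesis forces u = 0 in a whole neighbourhood, which
  -- kills the derivative at x.
  have hu0 : u =ᶠ[𝓝 x] fun _ => 0 := by
    filter_upwards [hev] with y hy
    by_contra hy0
    exact hy.1 (hc y hy.2 hy0)
  apply hne
  have : fderiv ℝ u x = 0 := by rw [hu0.fderiv_eq]; simp
  ext i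
  fin_cases i <;> simp [curl, pderiv, this]

end IsBeltramiHomogeneous
end radial

/-- The antisymmetric part of the derivative is given by the rotation. -/
theorem crossProduct_curl_eq_zero {u : Space3 → Space3} {x w : Space3}
    (h : ∀ v, inner ℝ (fderiv ℝ u x w) v = inner ℝ (fderiv ℝ u x v) w) :
    crossProduct (curl u x).ofLp w.ofLp = 0 := by
  rw [crossProduct_eq_zero_iff_inner]
  have h0 := h (EuclideanSpace.single 0 1)
  have h1 := h (EuclideanSpace.single 1 1)
  have h2 := h (EuclideanSpace.single 2 1)
  simp [inner_eq_sum, fderiv_apply_eq_pderiv] at h0 h1 h2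
  simp [curl]
  refine ⟨?_, ?_, ?_⟩
  · linear_combination h0
  · linear_combination h1
  · linear_combination h2

theorem curl_eq_zero_of_parallel {a b : Space3} (hb : b ≠ 0)
    (h : crossProduct a.ofLp b.ofLp = 0) (hi : inner ℝ a b = 0) : a = 0 := by
  rw [eq_smul_of_crossProduct_eq_zero hb h, hi]; simp

theorem curl_congr {u v : Space3 → Space3} {x : Space3} (h : u =ᶠ[𝓝 x] v) :
    curl u x = curl v x := by
  simp only [curl, pderiv, h.fderiv_eq]

/-- The rotation of g x is ∇g × x. -/
theorem inner_curl_smul_self {g : Space3 → ℝ} {x : Space3} (hg : DifferentiableAt ℝ g x) :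
    inner ℝ (curl (fun y => g y • y) x) x = 0 := by
  have hp : ∀ i j, pderiv (fun y => g y • y) i j x
      = g x * (EuclideanSpace.single i (1 : ℝ) : Space3) j
        + fderiv ℝ g x (EuclideanSpace.single i 1) * x j := by
    intro i j
    rw [pderiv, (hg.hasFDerivAt.fun_smul (f := fun y => y) (hasFDerivAt_id x)).fderiv]
    simp
  rw [curl_inner]
  simp [hp]
  ring

/-! ### Nonexistence for 1 ≤ α ≤ 2 and for α < 1. -/

namespace IsBeltramiHomogeneous
variable {α : ℝ} {u : Space3 → Space3}

/-- Beltrami homogeneous solutions with `1 ≤ α ≤ 2` are irrotational. -/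
theorem curl_eq_zero_of_one_le (h : IsBeltramiHomogeneous α u) (h1 : 1 ≤ α) (h2 : α ≤ 2)
    {x : Space3} (hx : x ≠ 0) : curl u x = 0 := by
  refine h.curl_eq_zero_of_velocity_ne_zero (fun x hx hu => ?_) hx
  have hn : 0 < ‖x‖ ^ 2 := by positivity
  rcases eq_or_lt_of_le h2 with rfl | h2
  -- α = 2: the velocity is radial, so its rotation is orthogonal to x, hence to u, and also
  -- parallel to u.
  · have ht : ∀ y : Space3, y ≠ 0 → u y = (inner ℝ y (u y) / ‖y‖ ^ 2) • y := by
      intro y hy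
      have h3 : ‖tangential u y‖ ^ 2 = 0 := by
        rw [norm_tangential_sq]
        have := (h.energy_identity h1 le_rfl hy).1
        rw [show ‖y‖ ^ 2 * ‖u y‖ ^ 2 - inner ℝ y (u y) ^ 2 = 0 by linarith, mul_zero]
      have h4 : tangential u y = 0 := by simpa using h3
      have h5 : ‖y‖ ^ 2 • u y = inner ℝ y (u y) • y := sub_eq_zero.1 h4
      have hy2 : ‖y‖ ^ 2 ≠ 0 := by positivity
      rw [div_eq_inv_mul, ← smul_smul, ← h5, smul_smul, inv_mul_cancel₀ hy2, one_smul]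
    have hd : DifferentiableAt ℝ (fun y => inner ℝ y (u y) / ‖y‖ ^ 2) x :=
      (h.hasFDerivAt_radial hx).differentiableAt.mul
        (((contDiff_norm_sq ℝ (n := 1)).differentiable one_ne_zero x).inv hn.ne')
    have hev : u =ᶠ[𝓝 x] fun y => (inner ℝ y (u y) / ‖y‖ ^ 2) • y := by
      filter_upwards [isOpen_compl_origin.mem_nhds hx] with y hy using ht y hy
    have hc := inner_curl_smul_self hd
    rw [← curl_congr hev] at hc
    refine curl_eq_zero_of_parallel hu (h.beltrami x hx) ?_
    conv_lhs => arg 3; rw [ht x hx]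
    rw [inner_smul_right, hc, mul_zero]
  · have hr : ∀ y : Space3, y ≠ 0 → inner ℝ y (u y) = 0 := by
      intro y hy
      have := (h.energy_identity h1 h2.le hy).2
      rcases mul_eq_zero.1 this with h3 | h3
      · linarith
      · exact pow_eq_zero_iff two_ne_zero |>.1 h3
    rcases eq_or_lt_of_le h1 with rfl | h1
    -- α = 1: differentiating x · u = 0 and using ∂_x u = -u shows that the rotation is parallel to
    -- x. It is then orthogonal to u, while being parallel to u as well.
    · have hev : (fun y => inner ℝ y (u y)) =ᶠ[𝓝 x] fun _ => (0 : ℝ) := by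
        filter_upwards [isOpen_compl_origin.mem_nhds hx] with y hy using hr y hy
      have hD : ∀ v, inner ℝ x (fderiv ℝ u x v) + inner ℝ v (u x) = 0 := by
        intro v
        rw [← h.fderiv_radial hx, hev.fderiv_eq]; simp
      have hxx := h.homogeneous.fderiv_self hx (h.differentiableAt hx)
      have hcx : crossProduct (curl u x).ofLp x.ofLp = 0 := by
        refine crossProduct_curl_eq_zero fun v => ?_
        have := hD v
        rw [hxx, real_inner_comm x, inner_smul_left, real_inner_comm v]
        simp
        linarith
      refine curl_eq_zero_of_parallel hu (h.beltrami x hx) ?_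
      rw [eq_smul_of_crossProduct_eq_zero hx hcx, inner_smul_left, hr x hx, mul_zero]
    -- 1 < α < 2: both parts of the energy identity are active and force u = 0.
    · exfalso
      have := (h.energy_identity h1.le h2.le hx).1
      rw [hr x hx] at this
      have hu2 : 0 < ‖u x‖ ^ 2 := by positivity
      have : 0 < (α - 1) * (‖x‖ ^ 2 * ‖u x‖ ^ 2 - 0 ^ 2) :=
        mul_pos (by linarith) (by nlinarith [mul_pos hn hu2])
      linarith

theorem homogeneous_curl (h : IsBeltramiHomogeneous α u) :
    IsHomogeneousOn (α + 1) (curl u) {0}ᶜ := by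
  intro l hl x hx
  have hp : ∀ i j, pderiv u i j x = l ^ (α + 1) * pderiv u i j (l • x) := by
    intro i j
    rw [pderiv, h.homogeneous.fderiv l hl x hx]; rfl
  ext i
  fin_cases i <;> simp [curl, hp] <;> ring

theorem homogeneous_inner_curl (h : IsBeltramiHomogeneous α u) :
    IsHomogeneousOn α (fun x => inner ℝ x (curl u x)) {0}ᶜ := by
  intro l hl x hx
  simp only
  rw [h.homogeneous_curl l hl x hx, inner_smul_right, inner_smul_left, Real.rpow_add_one hl.ne']
  simp
  ring

theorem contDiffOn_curl (h2 : ContDiffOn ℝ 2 u {0}ᶜ) : ContDiffOn ℝ 1 (curl u) {0}ᶜ := by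
  have hp : ∀ i j, ContDiffOn ℝ 1 (pderiv u i j) {0}ᶜ := fun i j =>
    (EuclideanSpace.proj j : Space3 →L[ℝ] ℝ).contDiff.comp_contDiffOn
      ((h2.fderiv_of_isOpen isOpen_compl_origin (by norm_num)).clm_apply contDiffOn_const)
  refine contDiffOn_euclidean.2 fun i => ?_
  fin_cases i
  · exact (hp 1 2).sub (hp 2 1)
  · exact (hp 2 0).sub (hp 0 2)
  · exact (hp 0 1).sub (hp 1 0)

/-- Symmetry of the second derivative, available because u is C². -/
theorem divergence_curl (h2 : ContDiffOn ℝ 2 u {0}ᶜ) {x : Space3} (hx : x ≠ 0) :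
    divergence (curl u) x = 0 := by
  have hat : ContDiffAt ℝ 2 u x := h2.contDiffAt (isOpen_compl_origin.mem_nhds hx)
  have hd : HasFDerivAt (fderiv ℝ u) (fderiv ℝ (fderiv ℝ u) x) x :=
    ((hat.fderiv_right (m := 1) (by norm_num)).differentiableAt one_ne_zero).hasFDerivAt
  have hsym : ∀ v w, fderiv ℝ (fderiv ℝ u) x v w = fderiv ℝ (fderiv ℝ u) x w v :=
    hat.isSymmSndFDerivAt (by simp)
  have hp : ∀ i j v, fderiv ℝ (pderiv u i j) x v
      = fderiv ℝ (fderiv ℝ u) x v (EuclideanSpace.single i 1) j := by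
    intro i j v
    have h1 := hd.clm_apply (hasFDerivAt_const (EuclideanSpace.single i 1 : Space3) x)
    have h3 : HasFDerivAt (pderiv u i j) _ x :=
      (EuclideanSpace.proj j : Space3 →L[ℝ] ℝ).hasFDerivAt.comp x h1
    rw [h3.fderiv]; simp
  have hpd : ∀ i j, DifferentiableAt ℝ (pderiv u i j) x := fun i j =>
    ((EuclideanSpace.proj j : Space3 →L[ℝ] ℝ).hasFDerivAt.comp x
      (hd.clm_apply (hasFDerivAt_const (EuclideanSpace.single i 1 : Space3) x))).differentiableAt
  have hcd : DifferentiableAt ℝ (curl u) x :=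
    ((contDiffOn_curl h2).differentiableOn one_ne_zero).differentiableAt
      (isOpen_compl_origin.mem_nhds hx)
  rw [divergence, Fin.sum_univ_three]
  simp only [pderiv]
  rw [← fderiv_component hcd, ← fderiv_component hcd, ← fderiv_component hcd]
  have e0 : (fun y => curl u y 0) = fun y => pderiv u 1 2 y - pderiv u 2 1 y := rfl
  have e1 : (fun y => curl u y 1) = fun y => pderiv u 2 0 y - pderiv u 0 2 y := rfl
  have e2 : (fun y => curl u y 2) = fun y => pderiv u 0 1 y - pderiv u 1 0 y := rfl
  rw [e0, e1, e2, fderiv_fun_sub (hpd _ _) (hpd _ _), fderiv_fun_sub (hpd _ _) (hpd _ _),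
    fderiv_fun_sub (hpd _ _) (hpd _ _)]
  simp only [sub_apply, hp]
  rw [hsym (EuclideanSpace.single 0 1) (EuclideanSpace.single 1 1),
    hsym (EuclideanSpace.single 0 1) (EuclideanSpace.single 2 1),
    hsym (EuclideanSpace.single 1 1) (EuclideanSpace.single 2 1)]
  ring

/-- The derivative of `x · (∇ × u)` along the tangential velocity. -/
theorem radial_mul_fderiv_inner_curl (h : IsBeltramiHomogeneous α u)
    (h2 : ContDiffOn ℝ 2 u {0}ᶜ) {x : Space3} (hx : x ≠ 0) (hu : u x ≠ 0) :
    inner ℝ x (u x) * fderiv ℝ (fun y => inner ℝ y (curl u y)) x (tangential u x)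
      = inner ℝ x (curl u x) *
        ((1 - α) * (‖x‖ ^ 2 * ‖u x‖ ^ 2 - inner ℝ x (u x) ^ 2) + inner ℝ x (u x) ^ 2) := by
  have hud := h.differentiableAt hx
  have hcd : DifferentiableAt ℝ (curl u) x :=
    ((contDiffOn_curl h2).differentiableOn one_ne_zero).differentiableAt
      (isOpen_compl_origin.mem_nhds hx)
  -- Near a point with u ≠ 0 the proportionality factor l in ∇ × u = l u is differentiable. Taking
  -- divergences gives u · ∇l = 0, and Euler's identity for l (x · u) supplies the remaining
  -- derivative x · ∇l.
  set l : Space3 → ℝ := fun y => inner ℝ (curl u y) (u y) / ‖u y‖ ^ 2 with hl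
  have hld : DifferentiableAt ℝ l x :=
    (hcd.inner ℝ hud).mul ((hud.norm_sq ℝ).inv (pow_ne_zero 2 (norm_ne_zero_iff.2 hu)))
  have hev : curl u =ᶠ[𝓝 x] fun y => l y • u y := by
    filter_upwards [isOpen_compl_origin.mem_nhds hx, hud.continuousAt.eventually_ne hu]
      with y hy huy using eq_smul_of_crossProduct_eq_zero huy (h.beltrami y hy)
  have hlu : fderiv ℝ l x (u x) = 0 := by
    have h3 := divergence_curl h2 hx
    have h4 : divergence (curl u) x = divergence (fun y => l y • u y) x := by
      simp only [divergence, pderiv, hev.fderiv_eq]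
    rw [h4, divergence_smul hld hud, h.divergence_eq x hx] at h3
    linarith
  have hcev : (fun y => inner ℝ y (curl u y)) =ᶠ[𝓝 x] fun y => l y * inner ℝ y (u y) := by
    filter_upwards [hev] with y hy
    rw [hy, inner_smul_right]
  have hcx : inner ℝ x (curl u x) = l x * inner ℝ x (u x) := hcev.eq_of_nhds
  have hder : ∀ v, fderiv ℝ (fun y => inner ℝ y (curl u y)) x v
      = l x * fderiv ℝ (fun y => inner ℝ y (u y)) x v + inner ℝ x (u x) * fderiv ℝ l x v := by
    intro v
    rw [hcev.fderiv_eq, fderiv_fun_mul hld (h.hasFDerivAt_radial hx).differentiableAt]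
    simp
  have hxx := h.homogeneous_inner_curl.fderiv_self hx
    ((differentiableAt_fun_id).inner ℝ hcd)
  rw [hder, h.fderiv_radial_self hx, hcx] at hxx
  simp only [smul_eq_mul] at hxx
  have hlt : fderiv ℝ l x (tangential u x) = -inner ℝ x (u x) * fderiv ℝ l x x := by
    rw [tangential, map_sub, map_smul, map_smul, hlu]; simp
  rw [hder, h.fderiv_radial_tangential hx, hlt, hcx]
  linear_combination (-inner ℝ x (u x) ^ 2) * hxx

/-- Beltrami homogeneous solutions of class `C²` with `α < 1` are irrotational. -/
theorem curl_eq_zero_of_lt_one (h : IsBeltramiHomogeneous α u) (h2 : ContDiffOn ℝ 2 u {0}ᶜ)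
    (h1 : α < 1) {x : Space3} (hx : x ≠ 0) : curl u x = 0 := by
  -- The power 2n of x · (∇ × u) is even, hence nonnegative, and n > 2 - α makes the coefficient α -
  -- 2 + 2n of (x · u)² positive.
  obtain ⟨n, hn⟩ := exists_nat_gt (2 - α)
  have hc1 : ContDiffOn ℝ 1 (fun y => inner ℝ y (curl u y)) {0}ᶜ :=
    contDiffOn_id.inner ℝ (contDiffOn_curl h2)
  have hcd : ∀ y : Space3, y ≠ 0 → DifferentiableAt ℝ (fun y => inner ℝ y (curl u y)) y :=
    fun y hy => (hc1.differentiableOn one_ne_zero).differentiableAt (isOpen_compl_origin.mem_nhds hy)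
  have hn0 : n ≠ 0 := by
    rintro rfl
    norm_num at hn
    linarith
  obtain ⟨m, rfl⟩ := Nat.exists_eq_succ_of_ne_zero hn0
  have key : ∀ y : Space3, y ≠ 0 →
      fderiv ℝ (fun y => inner ℝ y (curl u y) ^ (2 * (m + 1)) * inner ℝ y (u y)) y (tangential u y)
        + inner ℝ y (curl u y) ^ (2 * (m + 1)) * inner ℝ y (u y) * ((α - 2) * inner ℝ y (u y))
      = inner ℝ y (curl u y) ^ (2 * (m + 1)) * ((α - 2 + 2 * (m + 1)) * inner ℝ y (u y) ^ 2
        + (2 * (m + 1) + 1) * (1 - α) * (‖y‖ ^ 2 * ‖u y‖ ^ 2 - inner ℝ y (u y) ^ 2)) := by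
    intro y hy
    have hpow := (hcd y hy).hasFDerivAt.pow (2 * (m + 1))
    rw [(hpow.fun_mul (h.hasFDerivAt_radial hy).differentiableAt.hasFDerivAt).fderiv]
    by_cases huy : u y = 0
    -- Where u = 0 there is no factor l, but the tangential velocity and x · u vanish, so both sides
    -- are zero.
    · simp [tangential, huy]
    · have := h.radial_mul_fderiv_inner_curl h2 hy huy
      simp only [add_apply, smul_apply, smul_eq_mul, h.fderiv_radial_tangential hy, nsmul_eq_mul]
      rw [show 2 * (m + 1) - 1 = 2 * m + 1 by omega]
      push_cast
      linear_combination (2 * (m + 1) * inner ℝ y (curl u y) ^ (2 * m + 1)) * this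
  have hcoef : 0 < α - 2 + 2 * (m + 1) := by
    push_cast at hn
    have : (0 : ℝ) ≤ m := m.cast_nonneg
    linarith
  have hcoef2 : 0 < (2 * (m + 1) + 1) * (1 - α) := by
    have : (0 : ℝ) ≤ m := m.cast_nonneg
    exact mul_pos (by linarith) (by linarith)
  have hpow0 : ∀ y : Space3, 0 ≤ inner ℝ y (curl u y) ^ (2 * (m + 1)) := fun y =>
    (even_two_mul _).pow_nonneg _
  have hzero : ∀ y : Space3, y ≠ 0 → u y ≠ 0 → inner ℝ y (curl u y) = 0 := by
    intro y hy huy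
    have := h.weighted_identity
      (G := fun y => inner ℝ y (curl u y) ^ (2 * (m + 1)) * inner ℝ y (u y))
      ((hc1.pow _).mul h.contDiffOn_radial) (fun z hz => by
        rw [key z hz]
        exact mul_nonneg (hpow0 z) (add_nonneg (mul_nonneg hcoef.le (sq_nonneg _))
          (mul_nonneg hcoef2.le (radial_sq_le u z)))) hy
    rw [key y hy] at this
    rcases mul_eq_zero.1 this with h3 | h3
    · exact pow_eq_zero_iff (by omega) |>.1 h3
    · exfalso
      have a := mul_nonneg hcoef.le (sq_nonneg (inner ℝ y (u y)))
      have b := mul_nonneg hcoef2.le (radial_sq_le u y)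
      have a0 : (α - 2 + 2 * (m + 1)) * inner ℝ y (u y) ^ 2 = 0 := by linarith
      have b0 : (2 * (m + 1) + 1) * (1 - α) * (‖y‖ ^ 2 * ‖u y‖ ^ 2 - inner ℝ y (u y) ^ 2) = 0 := by
        linarith
      have a1 := (mul_eq_zero.1 a0).resolve_left hcoef.ne'
      have b1 := (mul_eq_zero.1 b0).resolve_left hcoef2.ne'
      have : 0 < ‖y‖ ^ 2 * ‖u y‖ ^ 2 := by positivity
      linarith
  refine h.curl_eq_zero_of_velocity_ne_zero (fun x hx hux => ?_) hx
  -- A nonzero rotation at x gives l ≠ 0 nearby, so x · (∇ × u) = l (x · u) = 0 forces x · u = 0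
  -- nearby. Its derivative along the tangential velocity is then both 0 and (1 - α)|x|²|u|² > 0.
  by_contra hcx
  have hr : ∀ᶠ y in 𝓝 x, inner ℝ y (u y) = 0 := by
    have hcc : ContinuousAt (curl u) x :=
      (contDiffOn_curl h2).continuousOn.continuousAt (isOpen_compl_origin.mem_nhds hx)
    filter_upwards [isOpen_compl_origin.mem_nhds hx, hcc.eventually_ne hcx,
      (h.differentiableAt hx).continuousAt.eventually_ne hux] with y hy hcy huy
    have h3 := hzero y hy huy
    rw [eq_smul_of_crossProduct_eq_zero huy (h.beltrami y hy), inner_smul_right] at h3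
    rcases mul_eq_zero.1 h3 with h4 | h4
    · exfalso
      apply hcy
      rw [eq_smul_of_crossProduct_eq_zero huy (h.beltrami y hy), h4, zero_smul]
    · exact h4
  have h5 : fderiv ℝ (fun y => inner ℝ y (u y)) x (tangential u x) = 0 := by
    have : (fun y => inner ℝ y (u y)) =ᶠ[𝓝 x] fun _ => (0 : ℝ) := hr
    rw [this.fderiv_eq]; simp
  rw [h.fderiv_radial_tangential hx, hr.self_of_nhds] at h5
  have : 0 < (1 - α) * (‖x‖ ^ 2 * ‖u x‖ ^ 2 - 0 ^ 2) := by
    have : 0 < ‖x‖ ^ 2 * ‖u x‖ ^ 2 := by positivity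
    exact mul_pos (by linarith) (by linarith)
  linarith

end IsBeltramiHomogeneous

theorem IsClassicalHomogeneousSolution.isBeltramiHomogeneous {α : ℝ} {u : Space3 → Space3}
    {p : Space3 → ℝ} (h : IsClassicalHomogeneousSolution α u p) (hb : IsBeltrami u) :
    IsBeltramiHomogeneous α u :=
  ⟨h.contDiffOn_velocity, h.homogeneous_velocity, fun x hx => (h.euler x hx).2, hb⟩

/-! ### Global flows of bounded C¹ vector fields. -/

section flow
variable {E : Type*} [NormedAddCommGroup E] [NormedSpace ℝ E] [FiniteDimensional ℝ E]
  {F : E → E}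

theorem ContDiff.exists_lipschitzOnWith_closedBall (hF : ContDiff ℝ 1 F) (x : E) (R : ℝ) :
    ∃ K, LipschitzOnWith K F (Metric.closedBall x R) :=
  hF.contDiffOn.exists_lipschitzOnWith one_ne_zero (convex_closedBall x R)
    (haveI := FiniteDimensional.proper_real E; isCompact_closedBall x R)

/-- Integral curves of a `C¹` field on an open interval around `0` are determined by their value
at `0`. -/
theorem eqOn_of_integralCurves (hF : ContDiff ℝ 1 F) {f g : ℝ → E} {T : ℝ}
    (hf : ∀ t ∈ Icc (-T) T, HasDerivWithinAt f (F (f t)) (Icc (-T) T) t)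
    (hg : ∀ t ∈ Icc (-T) T, HasDerivWithinAt g (F (g t)) (Icc (-T) T) t)
    (h0 : f 0 = g 0) (hT : 0 < T) : EqOn f g (Icc (-T) T) := by
  have hfc : ContinuousOn f (Icc (-T) T) := fun t ht => (hf t ht).continuousWithinAt
  have hgc : ContinuousOn g (Icc (-T) T) := fun t ht => (hg t ht).continuousWithinAt
  obtain ⟨R, hR⟩ := ((isCompact_Icc.image_of_continuousOn hfc).union
    (isCompact_Icc.image_of_continuousOn hgc)).isBounded.subset_closedBall (0 : E)
  obtain ⟨K, hK⟩ := ContDiff.exists_lipschitzOnWith_closedBall hF 0 R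
  refine ODE_solution_unique_of_mem_Icc (v := fun _ => F) (s := fun _ => Metric.closedBall 0 R)
    (K := K) (t₀ := 0) (fun _ _ => hK) ⟨by linarith, hT⟩ hfc ?_ ?_ hgc ?_ ?_ h0
  · exact fun t ht => (hf t (Ioo_subset_Icc_self ht)).hasDerivAt (Icc_mem_nhds ht.1 ht.2)
  · exact fun t ht => hR (Or.inl (mem_image_of_mem _ (Ioo_subset_Icc_self ht)))
  · exact fun t ht => (hg t (Ioo_subset_Icc_self ht)).hasDerivAt (Icc_mem_nhds ht.1 ht.2)
  · exact fun t ht => hR (Or.inr (mem_image_of_mem _ (Ioo_subset_Icc_self ht)))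

theorem eq_of_integralCurves (hF : ContDiff ℝ 1 F) {f g : ℝ → E}
    (hf : ∀ t, HasDerivAt f (F (f t)) t) (hg : ∀ t, HasDerivAt g (F (g t)) t)
    (h0 : f 0 = g 0) : f = g := by
  funext t
  have h := eqOn_of_integralCurves hF (T := |t| + 1) (fun t _ => (hf t).hasDerivWithinAt)
    (fun t _ => (hg t).hasDerivWithinAt) h0 (by positivity)
  exact h ⟨by linarith [neg_abs_le t], by linarith [le_abs_self t]⟩

/-- Since |F| ≤ L everywhere, solutions that start in the unit ball stay in the ball of radius LT +
1 up to time T. The Picard–Lindelöf condition thus holds for every T, and the Lipschitz constant may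
depend on that ball. -/
theorem exists_local_flow (hF : ContDiff ℝ 1 F) {L : ℝ} (hL : ∀ x, ‖F x‖ ≤ L) (x₀ : E) {T : ℝ}
    (hT : 0 < T) : ∃ α : E × ℝ → E, (∀ x ∈ Metric.closedBall x₀ 1, α (x, 0) = x ∧
      ∀ t ∈ Icc (-T) T, HasDerivWithinAt (fun s => α (x, s)) (F (α (x, t))) (Icc (-T) T) t) ∧
      ContinuousOn α (Metric.closedBall x₀ 1 ×ˢ Icc (-T) T) := by
  have hL0 : 0 ≤ L := (norm_nonneg _).trans (hL 0)
  obtain ⟨K, hK⟩ := ContDiff.exists_lipschitzOnWith_closedBall hF x₀ (L * T + 1)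
  have hp : IsPicardLindelof (fun _ => F) (tmin := -T) (tmax := T) ⟨0, by linarith, hT.le⟩ x₀
      (NNReal.mk (L * T + 1) (by positivity)) 1 (NNReal.mk L hL0) K :=
    IsPicardLindelof.of_time_independent (fun x _ => hL x) hK (by
      simp)
  have := FiniteDimensional.complete ℝ E
  exact hp.exists_forall_mem_closedBall_eq_hasDerivWithinAt_continuousOn

/-- A bounded `C¹` vector field on a finite-dimensional space has a global flow. -/
theorem exists_global_flow (hF : ContDiff ℝ 1 F) {L : ℝ} (hL : ∀ x, ‖F x‖ ≤ L) :
    ∃ φ : E → ℝ → E, (∀ x, φ x 0 = x) ∧ (∀ x t, HasDerivAt (φ x) (F (φ x t)) t) ∧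
      Continuous (Function.uncurry φ) := by
  have hT : ∀ t : ℝ, 0 < |t| + 1 := fun t => by positivity
  choose α hα hαc using fun (x₀ : E) (T : {T : ℝ // 0 < T}) => exists_local_flow hF hL x₀ T.2
  -- The value at time t comes from the local flow centred at x, on an interval with t in its
  -- interior. By uniqueness it agrees with every local flow defined at (x, t), from which
  -- differentiability and joint continuity are read off.
  let φ : E → ℝ → E := fun x t => α x ⟨|t| + 1, hT t⟩ (x, t)
  have hself : ∀ x : E, x ∈ Metric.closedBall x 1 := fun x => Metric.mem_closedBall_self zero_le_one
  have key : ∀ x₀ (T : {T : ℝ // 0 < T}), ∀ x ∈ Metric.closedBall x₀ 1, ∀ t ∈ Icc (-T.1) T.1,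
      φ x t = α x₀ T (x, t) := by
    intro x₀ T x hx t ht
    rcases le_total (|t| + 1) T.1 with h | h
    · have hsub : Icc (-(|t| + 1)) (|t| + 1) ⊆ Icc (-T.1) T.1 :=
        Icc_subset_Icc (by linarith) h
      exact eqOn_of_integralCurves hF (T := |t| + 1) ((hα x ⟨|t| + 1, hT t⟩ x (hself x)).2)
        (fun s hs => ((hα x₀ T x hx).2 s (hsub hs)).mono hsub)
        ((hα x ⟨|t| + 1, hT t⟩ x (hself x)).1.trans (hα x₀ T x hx).1.symm) (hT t)
        ⟨by linarith [neg_abs_le t], by linarith [le_abs_self t]⟩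
    · have hsub : Icc (-T.1) T.1 ⊆ Icc (-(|t| + 1)) (|t| + 1) :=
        Icc_subset_Icc (by linarith) h
      exact eqOn_of_integralCurves hF (T := T.1)
        (fun s hs => ((hα x ⟨|t| + 1, hT t⟩ x (hself x)).2 s (hsub hs)).mono hsub)
        ((hα x₀ T x hx).2)
        ((hα x ⟨|t| + 1, hT t⟩ x (hself x)).1.trans (hα x₀ T x hx).1.symm) T.2 ht
  refine ⟨φ, fun x => (hα x _ x (hself x)).1, fun x t => ?_, ?_⟩
  · have hmem : Icc (-(|t| + 1)) (|t| + 1) ∈ 𝓝 t :=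
      Icc_mem_nhds (by linarith [neg_abs_le t]) (by linarith [le_abs_self t])
    have h := ((hα x ⟨|t| + 1, hT t⟩ x (hself x)).2 t (mem_of_mem_nhds hmem)).hasDerivAt hmem
    refine h.congr_of_eventuallyEq ?_
    filter_upwards [hmem] with s hs using key x ⟨|t| + 1, hT t⟩ x (hself x) s hs
  · rw [continuous_iff_continuousAt]
    rintro ⟨x, t⟩
    have hmem : Metric.closedBall x 1 ×ˢ Icc (-(|t| + 1)) (|t| + 1) ∈ 𝓝 (x, t) :=
      prod_mem_nhds (Metric.closedBall_mem_nhds x one_pos)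
        (Icc_mem_nhds (by linarith [neg_abs_le t]) (by linarith [le_abs_self t]))
    refine ((hαc x ⟨|t| + 1, hT t⟩).continuousAt hmem).congr ?_
    filter_upwards [hmem] with p hp
    exact (key x ⟨|t| + 1, hT t⟩ p.1 hp.1 p.2 hp.2).symm

end flow

/-! ### Polar angles of plane curves. -/

section angle

/-- The angular speed of the plane curve `(p, y)`. -/
noncomputable def angularSpeed (y p y' p' : ℝ) : ℝ := (y' * p - y * p') / (y ^ 2 + p ^ 2)

/-- A plane curve that avoids the origin and starts on the positive `p`-axis is described by
polar coordinates. -/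
theorem polar_coordinates {y p y' p' Θ : ℝ → ℝ} (hy : ∀ t, HasDerivAt y (y' t) t)
    (hp : ∀ t, HasDerivAt p (p' t) t) (hne : ∀ t, 0 < y t ^ 2 + p t ^ 2) (hy0 : y 0 = 0)
    (hp0 : 0 < p 0) (hΘ0 : Θ 0 = 0)
    (hΘ : ∀ t, HasDerivAt Θ (angularSpeed (y t) (p t) (y' t) (p' t)) t) (t : ℝ) :
    y t = Real.sqrt (y t ^ 2 + p t ^ 2) * Real.sin (Θ t) ∧
      p t = Real.sqrt (y t ^ 2 + p t ^ 2) * Real.cos (Θ t) := by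
  have hR : ∀ s, Real.sqrt (y s ^ 2 + p s ^ 2) ≠ 0 := fun s => (Real.sqrt_pos.2 (hne s)).ne'
  have hsq : ∀ s, Real.sqrt (y s ^ 2 + p s ^ 2) ^ 2 = y s ^ 2 + p s ^ 2 := fun s =>
    Real.sq_sqrt (hne s).le
  have hRd : ∀ s, HasDerivAt (fun s => Real.sqrt (y s ^ 2 + p s ^ 2))
      ((y s * y' s + p s * p' s) / Real.sqrt (y s ^ 2 + p s ^ 2)) s := by
    intro s
    refine ((((hy s).fun_pow 2).fun_add ((hp s).fun_pow 2)).sqrt (hne s).ne').congr_deriv ?_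
    have := hR s
    field_simp
    norm_num
    ring
  -- The next two quotients are the sine and cosine of the difference between the geometric angle
  -- and Θ. Both are constant, with values 0 and 1 at time 0.
  have hA : ∀ s, HasDerivAt (fun s => (y s * Real.cos (Θ s) - p s * Real.sin (Θ s)) /
      Real.sqrt (y s ^ 2 + p s ^ 2)) 0 s := by
    intro s
    refine ((((hy s).fun_mul (hΘ s).cos).fun_sub ((hp s).fun_mul (hΘ s).sin)).fun_div (hRd s)
      (hR s)).congr_deriv ?_
    rw [angularSpeed]
    have h1 := hR s
    have h2 := hsq s
    generalize Real.sqrt (y s ^ 2 + p s ^ 2) = R at h1 h2 ⊢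
    rw [← h2]
    field_simp
    rw [h2]
    ring
  have hB : ∀ s, HasDerivAt (fun s => (y s * Real.sin (Θ s) + p s * Real.cos (Θ s)) /
      Real.sqrt (y s ^ 2 + p s ^ 2)) 0 s := by
    intro s
    refine ((((hy s).fun_mul (hΘ s).sin).fun_add ((hp s).fun_mul (hΘ s).cos)).fun_div (hRd s)
      (hR s)).congr_deriv ?_
    rw [angularSpeed]
    have h1 := hR s
    have h2 := hsq s
    generalize Real.sqrt (y s ^ 2 + p s ^ 2) = R at h1 h2 ⊢
    rw [← h2]
    field_simp
    rw [h2]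
    ring
  have hA0 := is_const_of_deriv_eq_zero (fun s => (hA s).differentiableAt) (fun s => (hA s).deriv) t 0
  have hB0 := is_const_of_deriv_eq_zero (fun s => (hB s).differentiableAt) (fun s => (hB s).deriv) t 0
  simp only [hy0, hΘ0, Real.cos_zero, Real.sin_zero, mul_one, mul_zero, sub_zero, zero_div, zero_add,
    zero_pow two_ne_zero, Real.sqrt_sq hp0.le, div_self hp0.ne'] at hA0 hB0
  have h1 := (div_eq_zero_iff.1 hA0).resolve_right (hR t)
  have h2 := (div_eq_one_iff_eq (hR t)).1 hB0
  have h3 := Real.sin_sq_add_cos_sq (Θ t)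
  rw [← h2]
  constructor
  · linear_combination (Real.cos (Θ t)) * h1 - y t * h3
  · linear_combination (-Real.sin (Θ t)) * h1 - p t * h3

/-- Two polar angles of curves with the same quadrants differ by less than a right angle. -/
theorem abs_sub_lt_pi_div_two {Θ ζ : ℝ → ℝ} (hΘ : Continuous Θ) (hζ : Continuous ζ) (h0 : Θ 0 = ζ 0)
    (hs : ∀ t, 0 ≤ Real.sin (Θ t) * Real.sin (ζ t)) (hc : ∀ t, 0 ≤ Real.cos (Θ t) * Real.cos (ζ t))
    (hne : ∀ t, Real.sin (Θ t) * Real.sin (ζ t) ≠ 0 ∨ Real.cos (Θ t) * Real.cos (ζ t) ≠ 0) (t : ℝ) :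
    |Θ t - ζ t| < Real.pi / 2 := by
  -- The cosine of the difference is a sum of two nonnegative products, one of them nonzero. The
  -- continuous difference starts at 0 and so cannot reach π/2.
  have hpos : ∀ s, 0 < Real.cos (Θ s - ζ s) := by
    intro s
    rw [Real.cos_sub]
    rcases hne s with h | h
    · linarith [lt_of_le_of_ne (hs s) h.symm, hc s]
    · linarith [lt_of_le_of_ne (hc s) h.symm, hs s]
  by_contra! hcon
  have hcont : Continuous fun s => |Θ s - ζ s| := by fun_prop
  obtain ⟨s, -, hs'⟩ := intermediate_value_uIcc (a := 0) (b := t) hcont.continuousOn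
    (show Real.pi / 2 ∈ uIcc |Θ 0 - ζ 0| |Θ t - ζ t| by
      rw [h0, sub_self, abs_zero, uIcc_of_le (abs_nonneg _)]
      exact ⟨by positivity, hcon⟩)
  have := hpos s
  rw [← Real.cos_abs, show |Θ s - ζ s| = Real.pi / 2 from hs', Real.cos_pi_div_two] at this
  exact lt_irrefl _ this

end angle

/-! ### Signed powers. -/

theorem hasDerivAt_mul_abs_rpow {r : ℝ} (hr : 0 < r) (y : ℝ) :
    HasDerivAt (fun y : ℝ => y * |y| ^ r) ((1 + r) * |y| ^ r) y := by
  rcases eq_or_ne y 0 with rfl | hy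
  · rw [hasDerivAt_iff_tendsto_slope_zero]
    have h1 : Tendsto (fun t : ℝ => |t| ^ r) (𝓝[≠] 0) (𝓝 0) := by
      have : Continuous fun t : ℝ => |t| ^ r := continuous_abs.rpow_const fun _ => Or.inr hr.le
      have h2 := this.tendsto 0
      simp only [abs_zero, Real.zero_rpow hr.ne'] at h2
      exact h2.mono_left nhdsWithin_le_nhds
    simp only [abs_zero, Real.zero_rpow hr.ne', mul_zero, zero_add, sub_zero]
    refine h1.congr' ?_
    filter_upwards [self_mem_nhdsWithin] with t ht
    have : t ≠ 0 := ht
    simp only [smul_eq_mul]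
    field_simp
  · have h1 := (hasDerivAt_abs hy).rpow_const (p := r) (Or.inl (abs_ne_zero.2 hy))
    refine ((hasDerivAt_id y).fun_mul h1).congr_deriv ?_
    have h2 : |y| ^ (r - 1) = |y| ^ r / |y| := Real.rpow_sub_one (abs_ne_zero.2 hy) r
    have h3 : y * (SignType.sign y : ℝ) = |y| := by
      rcases hy.lt_or_gt with h | h
      · simp [h, abs_of_neg]
      · simp [h, abs_of_pos]
    have h4 : |y| ≠ 0 := abs_ne_zero.2 hy
    rw [h2]
    simp only [id]
    field_simp
    linear_combination r * h3

theorem continuous_abs_rpow {r : ℝ} (hr : 0 ≤ r) : Continuous fun y : ℝ => |y| ^ r :=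
  continuous_abs.rpow_const fun _ => Or.inr hr

theorem contDiff_mul_abs_rpow {r : ℝ} (hr : 0 < r) : ContDiff ℝ 1 fun y : ℝ => y * |y| ^ r := by
  rw [contDiff_one_iff_deriv]
  refine ⟨fun y => (hasDerivAt_mul_abs_rpow hr y).differentiableAt, ?_⟩
  have : deriv (fun y : ℝ => y * |y| ^ r) = fun y => (1 + r) * |y| ^ r :=
    funext fun y => (hasDerivAt_mul_abs_rpow hr y).deriv
  rw [this]
  exact continuous_const.mul (continuous_abs_rpow hr.le)

theorem hasDerivAt_abs_rpow_add_two {r : ℝ} (hr : 0 ≤ r) (y : ℝ) :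
    HasDerivAt (fun y : ℝ => |y| ^ (r + 2)) ((r + 2) * (y * |y| ^ r)) y := by
  refine (hasDerivAt_abs_rpow y (p := r + 2) (by linarith)).congr_deriv ?_
  rw [add_sub_cancel_right]; ring

/-! ### The regularized shooting system: flow, symmetry, energies. -/

section shooting

/-- The force in the regularized shooting system for `w = y³`. -/
noncomputable def shootForce (b c q y : ℝ) : ℝ := b * y ^ 5 + c * (y * |y| ^ q)

/-- The potential energy in the regularized shooting system. -/
noncomputable def shootPotential (b c q y : ℝ) : ℝ := b * y ^ 6 / 2 + 3 * c / (q + 2) * |y| ^ (q + 2)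

/-- The time rescaling that makes the shooting field bounded. -/
noncomputable def shootSpeed (b c q y p t : ℝ) : ℝ :=
  (1 + ((1 - t ^ 2) * p / 3) ^ 2 + shootForce b c q y ^ 2 + ((1 - t ^ 2) * y ^ 2) ^ 2)⁻¹

/-- The vector field of the regularized shooting system. -/
noncomputable def shootField (b c q : ℝ) (z : ℝ × ℝ × ℝ) : ℝ × ℝ × ℝ :=
  (shootSpeed b c q z.1 z.2.1 z.2.2 * ((1 - z.2.2 ^ 2) * z.2.1 / 3),
    shootSpeed b c q z.1 z.2.1 z.2.2 * -shootForce b c q z.1,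
    shootSpeed b c q z.1 z.2.1 z.2.2 * ((1 - z.2.2 ^ 2) * z.1 ^ 2))

variable {b c q a : ℝ} {y p t : ℝ → ℝ}

/-- The factor 3 compensates the 1/3 in the equation for y, so that V(y) balances the change of (1 -
t²)p²/2 at fixed t. -/
theorem hasDerivAt_shootPotential (hq : 0 ≤ q) (y : ℝ) :
    HasDerivAt (shootPotential b c q) (3 * shootForce b c q y) y := by
  have h1 := (((hasDerivAt_pow 6 y).const_mul b).div_const 2).fun_add
    ((hasDerivAt_abs_rpow_add_two hq y).const_mul (3 * c / (q + 2)))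
  refine h1.congr_deriv ?_
  have : q + 2 ≠ 0 := by linarith
  rw [shootForce]
  field_simp
  norm_num
  ring

theorem contDiff_shootForce (hq : 0 < q) : ContDiff ℝ 1 (shootForce b c q) :=
  (contDiff_const.mul (contDiff_id.pow 5)).add (contDiff_const.mul (contDiff_mul_abs_rpow hq))

theorem shootForce_neg (y : ℝ) : shootForce b c q (-y) = -shootForce b c q y := by
  rw [shootForce, shootForce, abs_neg]; ring

theorem shootForce_mul_self (y : ℝ) :
    y * shootForce b c q y = y ^ 2 * (b * y ^ 4 + c * |y| ^ q) := by
  rw [shootForce]; ring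

theorem shootForce_mul_self_nonneg (hb : 0 ≤ b) (hc : 0 ≤ c) (y : ℝ) :
    0 ≤ y * shootForce b c q y := by
  rw [shootForce_mul_self]; positivity

theorem shootPotential_ge (hc : 0 ≤ c) (hq : 0 ≤ q) (y : ℝ) :
    b * y ^ 6 / 2 ≤ shootPotential b c q y := by
  rw [shootPotential]
  have : 0 ≤ 3 * c / (q + 2) * |y| ^ (q + 2) := by positivity
  linarith

theorem shootPotential_nonneg (hb : 0 ≤ b) (hc : 0 ≤ c) (hq : 0 ≤ q) (y : ℝ) :
    0 ≤ shootPotential b c q y := by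
  rw [shootPotential]; positivity

theorem shootPotential_le (hc : 0 ≤ c) (hq : 0 ≤ q) (y : ℝ) :
    shootPotential b c q y ≤ y ^ 2 * (b * y ^ 4 / 2 + 2 * c * |y| ^ q) := by
  rw [shootPotential]
  have h1 : |y| ^ (q + 2) = |y| ^ q * y ^ 2 := by
    rw [Real.rpow_add_of_nonneg (abs_nonneg y) hq zero_le_two, Real.rpow_two, sq_abs]
  have h2 : 3 * c / (q + 2) ≤ 2 * c := by
    rw [div_le_iff₀ (by linarith)]
    nlinarith [mul_nonneg hc hq]
  have h3 : 0 ≤ |y| ^ q * y ^ 2 := by positivity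
  rw [h1]
  nlinarith [mul_le_mul_of_nonneg_right h2 h3]

theorem shootPotential_mono (hb : 0 ≤ b) (hc : 0 ≤ c) (hq : 0 ≤ q) {y z : ℝ} (h : |y| ≤ |z|) :
    shootPotential b c q y ≤ shootPotential b c q z := by
  rw [shootPotential, shootPotential]
  have h1 : y ^ 6 ≤ z ^ 6 := by
    have := pow_le_pow_left₀ (abs_nonneg y) h 6
    rwa [Even.pow_abs (by decide), Even.pow_abs (by decide)] at this
  have h2 : |y| ^ (q + 2) ≤ |z| ^ (q + 2) := Real.rpow_le_rpow (abs_nonneg _) h (by linarith)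
  have h3 : 0 ≤ 3 * c / (q + 2) := by positivity
  have := mul_le_mul_of_nonneg_left h2 h3
  have := mul_le_mul_of_nonneg_left h1 hb
  linarith

theorem shootSpeed_pos (y p t : ℝ) : 0 < shootSpeed b c q y p t := by
  rw [shootSpeed]; positivity

theorem continuous_shootSpeed (hq : 0 < q) :
    Continuous fun z : ℝ × ℝ × ℝ => shootSpeed b c q z.1 z.2.1 z.2.2 := by
  unfold shootSpeed
  have := (contDiff_shootForce (b := b) (c := c) hq).continuous
  refine Continuous.inv₀ (by fun_prop) fun z => ?_
  positivity

theorem contDiff_shootField (hq : 0 < q) : ContDiff ℝ 1 (shootField b c q) := by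
  have hk : ContDiff ℝ 1 fun z : ℝ × ℝ × ℝ => shootForce b c q z.1 :=
    (contDiff_shootForce hq).comp contDiff_fst
  have h1 : ContDiff ℝ 1 fun z : ℝ × ℝ × ℝ => z.1 := contDiff_fst
  have h2 : ContDiff ℝ 1 fun z : ℝ × ℝ × ℝ => z.2.1 := contDiff_fst.comp contDiff_snd
  have h3 : ContDiff ℝ 1 fun z : ℝ × ℝ × ℝ => z.2.2 := contDiff_snd.comp contDiff_snd
  have e1 : ContDiff ℝ 1 fun z : ℝ × ℝ × ℝ => (1 - z.2.2 ^ 2) * z.2.1 / 3 :=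
    ((contDiff_const.sub (h3.pow 2)).mul h2).div_const 3
  have e3 : ContDiff ℝ 1 fun z : ℝ × ℝ × ℝ => (1 - z.2.2 ^ 2) * z.1 ^ 2 :=
    (contDiff_const.sub (h3.pow 2)).mul (h1.pow 2)
  have hs : ContDiff ℝ 1 fun z : ℝ × ℝ × ℝ => shootSpeed b c q z.1 z.2.1 z.2.2 := by
    unfold shootSpeed
    refine (((contDiff_const.add (e1.pow 2)).add (hk.pow 2)).add (e3.pow 2)).inv fun z => ?_
    positivity
  exact (hs.mul e1).prodMk ((hs.mul hk.neg).prodMk (hs.mul e3))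

/-- Each component is, up to sign, A / (1 + A² + B² + C²), and |A| ≤ 1 + A². This bound yields the
global flow. -/
theorem norm_shootField_le (z : ℝ × ℝ × ℝ) : ‖shootField b c q z‖ ≤ 1 := by
  have key : ∀ A B C : ℝ, |(1 + A ^ 2 + B ^ 2 + C ^ 2)⁻¹ * A| ≤ 1 ∧
      |(1 + A ^ 2 + B ^ 2 + C ^ 2)⁻¹ * B| ≤ 1 ∧ |(1 + A ^ 2 + B ^ 2 + C ^ 2)⁻¹ * C| ≤ 1 := by
    intro A B C
    have h : 0 < 1 + A ^ 2 + B ^ 2 + C ^ 2 := by positivity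
    refine ⟨?_, ?_, ?_⟩ <;> rw [abs_mul, abs_of_pos (inv_pos.2 h), inv_mul_le_iff₀ h, mul_one, abs_le] <;>
      constructor <;>
      nlinarith [sq_nonneg (A - 1), sq_nonneg (A + 1), sq_nonneg (B - 1), sq_nonneg (B + 1),
        sq_nonneg (C - 1), sq_nonneg (C + 1)]
  have := key ((1 - z.2.2 ^ 2) * z.2.1 / 3) (shootForce b c q z.1) ((1 - z.2.2 ^ 2) * z.1 ^ 2)
  rw [shootField, Prod.norm_def, Prod.norm_def]
  simp only [Real.norm_eq_abs, shootSpeed, mul_neg, abs_neg]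
  exact max_le this.1 (max_le this.2.1 this.2.2)

/-- A trajectory of the shooting system that starts at `w = 0` with slope `a`. -/
structure IsShootingOrbit (b c q a : ℝ) (y p t : ℝ → ℝ) : Prop where
  y_zero : y 0 = 0
  p_zero : p 0 = a
  t_zero : t 0 = 0
  hasDerivAt_y : ∀ s, HasDerivAt y
    (shootSpeed b c q (y s) (p s) (t s) * ((1 - t s ^ 2) * p s / 3)) s
  hasDerivAt_p : ∀ s, HasDerivAt p
    (shootSpeed b c q (y s) (p s) (t s) * -shootForce b c q (y s)) s
  hasDerivAt_t : ∀ s, HasDerivAt t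
    (shootSpeed b c q (y s) (p s) (t s) * ((1 - t s ^ 2) * y s ^ 2)) s

theorem exists_shootingOrbit (b c : ℝ) (hq : 0 < q) : ∃ y p t : ℝ → ℝ → ℝ,
    (∀ a, IsShootingOrbit b c q a (y a) (p a) (t a)) ∧ Continuous (Function.uncurry y) ∧
      Continuous (Function.uncurry p) ∧ Continuous (Function.uncurry t) := by
  obtain ⟨φ, h0, hφ, hc⟩ := exists_global_flow (contDiff_shootField (b := b) (c := c) hq)
    norm_shootField_le
  have hc' : Continuous fun x : ℝ × ℝ => φ (0, x.1, 0) x.2 :=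
    hc.comp (by fun_prop : Continuous fun x : ℝ × ℝ => (((0 : ℝ), x.1, (0 : ℝ)), x.2))
  refine ⟨fun a s => (φ (0, a, 0) s).1, fun a s => (φ (0, a, 0) s).2.1,
    fun a s => (φ (0, a, 0) s).2.2, fun a => ⟨?_, ?_, ?_, ?_, ?_, ?_⟩, ?_, ?_, ?_⟩
  · simp [h0]
  · simp [h0]
  · simp [h0]
  · exact fun s => (ContinuousLinearMap.fst ℝ ℝ (ℝ × ℝ)).hasFDerivAt.comp_hasDerivAt s (hφ (0, a, 0) s)
  · exact fun s => (ContinuousLinearMap.fst ℝ ℝ ℝ).hasFDerivAt.comp_hasDerivAt s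
      ((ContinuousLinearMap.snd ℝ ℝ (ℝ × ℝ)).hasFDerivAt.comp_hasDerivAt s (hφ (0, a, 0) s))
  · exact fun s => (ContinuousLinearMap.snd ℝ ℝ ℝ).hasFDerivAt.comp_hasDerivAt s
      ((ContinuousLinearMap.snd ℝ ℝ (ℝ × ℝ)).hasFDerivAt.comp_hasDerivAt s (hφ (0, a, 0) s))
  · exact continuous_fst.comp hc'
  · exact continuous_fst.comp (continuous_snd.comp hc')
  · exact continuous_snd.comp (continuous_snd.comp hc')

namespace IsShootingOrbit

theorem continuous_y (h : IsShootingOrbit b c q a y p t) : Continuous y :=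
  continuous_iff_continuousAt.2 fun s => (h.hasDerivAt_y s).continuousAt

theorem continuous_p (h : IsShootingOrbit b c q a y p t) : Continuous p :=
  continuous_iff_continuousAt.2 fun s => (h.hasDerivAt_p s).continuousAt

theorem continuous_t (h : IsShootingOrbit b c q a y p t) : Continuous t :=
  continuous_iff_continuousAt.2 fun s => (h.hasDerivAt_t s).continuousAt

theorem continuous_speed (h : IsShootingOrbit b c q a y p t) (hq : 0 < q) :
    Continuous fun s => shootSpeed b c q (y s) (p s) (t s) :=
  (continuous_shootSpeed (b := b) (c := c) hq).comp (f := fun s => (y s, p s, t s))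
    (h.continuous_y.prodMk (h.continuous_p.prodMk h.continuous_t))

/-- The reflected trajectory is the same trajectory. -/
theorem odd (h : IsShootingOrbit b c q a y p t) (hq : 0 < q) (s : ℝ) :
    y (-s) = -y s ∧ p (-s) = p s ∧ t (-s) = -t s := by
  have hf : ∀ s, HasDerivAt (fun s => (y s, p s, t s)) (shootField b c q (y s, p s, t s)) s :=
    fun s => (h.hasDerivAt_y s).prodMk ((h.hasDerivAt_p s).prodMk (h.hasDerivAt_t s))
  have hsp : ∀ y p t, shootSpeed b c q (-y) p (-t) = shootSpeed b c q y p t := by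
    intro y p t
    simp only [shootSpeed, shootForce_neg, even_two.neg_pow]
  -- The force is odd and the speed is invariant under (y, t) ↦ (-y, -t), so the reflected curve
  -- solves the same system with the same initial value.
  have hg : ∀ s, HasDerivAt (fun s => (-y (-s), p (-s), -t (-s)))
      (shootField b c q (-y (-s), p (-s), -t (-s))) s := by
    intro s
    have h1 := ((h.hasDerivAt_y (-s)).scomp s (hasDerivAt_neg s)).fun_neg
    have h2 := ((h.hasDerivAt_p (-s)).scomp s (hasDerivAt_neg s))
    have h3 := ((h.hasDerivAt_t (-s)).scomp s (hasDerivAt_neg s)).fun_neg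
    refine (h1.prodMk (h2.prodMk h3)).congr_deriv ?_
    simp only [shootField, hsp, shootForce_neg, even_two.neg_pow]
    simp
  have := eq_of_integralCurves (contDiff_shootField hq) hg hf
    (by simp [h.y_zero, h.t_zero])
  have h3 := congrFun this s
  simp only [Prod.mk.injEq] at h3
  exact ⟨by linarith [h3.1], h3.2.1, by linarith [h3.2.2]⟩

/-- The function 1 - t² solves a linear homogeneous equation with initial value 1; the integrating
factor exp I shows that it never vanishes. -/
theorem one_sub_sq_pos (h : IsShootingOrbit b c q a y p t) (hq : 0 < q) (s : ℝ) :
    0 < 1 - t s ^ 2 := by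
  have hm := h.continuous_speed hq
  have hy := h.continuous_y
  have ht := h.continuous_t
  have hcont : Continuous fun s => 2 * t s * shootSpeed b c q (y s) (p s) (t s) * y s ^ 2 := by
    fun_prop
  have hI : ∀ s, HasDerivAt
      (fun s => ∫ r in (0 : ℝ)..s, 2 * t r * shootSpeed b c q (y r) (p r) (t r) * y r ^ 2)
      (2 * t s * shootSpeed b c q (y s) (p s) (t s) * y s ^ 2) s := fun s =>
    intervalIntegral.integral_hasDerivAt_right (hcont.intervalIntegrable _ _)
      (hcont.stronglyMeasurableAtFilter _ _) hcont.continuousAt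
  set I := fun s => ∫ r in (0 : ℝ)..s, 2 * t r * shootSpeed b c q (y r) (p r) (t r) * y r ^ 2
  have hd : ∀ s, HasDerivAt (fun s => (1 - t s ^ 2) * Real.exp (I s)) 0 s := by
    intro s
    refine ((((h.hasDerivAt_t s).fun_pow 2).const_sub 1).fun_mul (hI s).exp).congr_deriv ?_
    ring
  have h0 := is_const_of_deriv_eq_zero (fun s => (hd s).differentiableAt)
    (fun s => (hd s).deriv) s 0
  simp only [h.t_zero] at h0
  have hI0 : I 0 = 0 := by simp [I]
  rw [hI0] at h0
  have : 0 < (1 - t s ^ 2) * Real.exp (I s) := by rw [h0]; norm_num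
  exact pos_of_mul_pos_left this (Real.exp_pos _).le

theorem abs_t_lt_one (h : IsShootingOrbit b c q a y p t) (hq : 0 < q) (s : ℝ) : |t s| < 1 := by
  have := h.one_sub_sq_pos hq s
  rw [← sq_lt_one_iff_abs_lt_one]; linarith

theorem monotone_t (h : IsShootingOrbit b c q a y p t) (hq : 0 < q) : Monotone t := by
  refine monotone_of_hasDerivAt_nonneg (h.hasDerivAt_t) fun s => ?_
  exact mul_nonneg (shootSpeed_pos _ _ _).le
    (mul_nonneg (h.one_sub_sq_pos hq s).le (sq_nonneg _))

theorem t_nonneg (h : IsShootingOrbit b c q a y p t) (hq : 0 < q) {s : ℝ} (hs : 0 ≤ s) :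
    0 ≤ t s := h.t_zero ▸ h.monotone_t hq hs

end IsShootingOrbit

theorem monotoneOn_Ici_of_hasDerivAt {f f' : ℝ → ℝ} (hf : ∀ s, HasDerivAt f (f' s) s)
    (h : ∀ s, 0 ≤ s → 0 ≤ f' s) : MonotoneOn f (Ici 0) := by
  refine monotoneOn_of_deriv_nonneg (convex_Ici 0)
    (fun s _ => (hf s).continuousAt.continuousWithinAt)
    (fun s _ => (hf s).differentiableAt.differentiableWithinAt) fun s hs => ?_
  rw [interior_Ici] at hs
  rw [(hf s).deriv]
  exact h s (le_of_lt hs)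

namespace IsShootingOrbit

/-- The left side is an energy that changes at the rate -t t' p² ≤ 0 for s ≥ 0 and starts at a²/2.
-/
theorem energy_le (h : IsShootingOrbit b c q a y p t) (hq : 0 < q) {s : ℝ} (hs : 0 ≤ s) :
    (1 - t s ^ 2) * p s ^ 2 / 2 + shootPotential b c q (y s) ≤ a ^ 2 / 2 := by
  have hd : ∀ s, HasDerivAt (fun s => -((1 - t s ^ 2) * p s ^ 2 / 2 + shootPotential b c q (y s)))
      (shootSpeed b c q (y s) (p s) (t s) * (t s * ((1 - t s ^ 2) * y s ^ 2 * p s ^ 2))) s := by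
    intro s
    refine (((((h.hasDerivAt_t s).fun_pow 2).const_sub 1).fun_mul
      ((h.hasDerivAt_p s).fun_pow 2)).div_const 2 |>.fun_add
        ((hasDerivAt_shootPotential hq.le (y s)).comp s (h.hasDerivAt_y s)) |>.fun_neg).congr_deriv ?_
    ring
  have := monotoneOn_Ici_of_hasDerivAt hd (fun r hr => mul_nonneg (shootSpeed_pos _ _ _).le
    (mul_nonneg (h.t_nonneg hq hr) (mul_nonneg (mul_nonneg (h.one_sub_sq_pos hq r).le
      (sq_nonneg _)) (sq_nonneg _)))) self_mem_Ici hs hs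
  simp only [h.t_zero, h.p_zero, h.y_zero] at this
  have h0 : shootPotential b c q 0 = 0 := by
    simp [shootPotential, Real.zero_rpow (show q + 2 ≠ 0 by linarith)]
  rw [h0] at this
  linarith

/-- Dividing the energy by 1 - t² reverses the monotonicity: with p² no longer weighted, only the
growing factor 1/(1 - t²) in front of the potential contributes. This keeps p large where y is
small. -/
theorem le_energy (h : IsShootingOrbit b c q a y p t) (hb : 0 ≤ b) (hc : 0 ≤ c) (hq : 0 < q)
    {s : ℝ} (hs : 0 ≤ s) :
    a ^ 2 / 2 ≤ p s ^ 2 / 2 + shootPotential b c q (y s) / (1 - t s ^ 2) := by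
  have hd : ∀ s, HasDerivAt (fun s => p s ^ 2 / 2 + shootPotential b c q (y s) / (1 - t s ^ 2))
      (shootPotential b c q (y s) * (2 * t s * (shootSpeed b c q (y s) (p s) (t s)
        * ((1 - t s ^ 2) * y s ^ 2))) / (1 - t s ^ 2) ^ 2) s := by
    intro s
    have hne := (h.one_sub_sq_pos hq s).ne'
    refine ((((h.hasDerivAt_p s).fun_pow 2).div_const 2).fun_add
      (((hasDerivAt_shootPotential hq.le (y s)).comp s (h.hasDerivAt_y s)).fun_div
        (((h.hasDerivAt_t s).fun_pow 2).const_sub 1) hne)).congr_deriv ?_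
    simp only [Function.comp]
    field_simp
    ring
  have := monotoneOn_Ici_of_hasDerivAt hd (fun r hr => by
    have h1 := h.t_nonneg hq hr
    have h2 := h.one_sub_sq_pos hq r
    have h3 := shootPotential_nonneg hb hc hq.le (y r)
    have h4 := shootSpeed_pos (b := b) (c := c) (q := q) (y r) (p r) (t r)
    positivity) self_mem_Ici hs hs
  simp only [h.t_zero, h.p_zero, h.y_zero] at this
  have h0 : shootPotential b c q 0 = 0 := by
    simp [shootPotential, Real.zero_rpow (show q + 2 ≠ 0 by linarith)]
  rw [h0] at this
  simpa using this

/-- If y and p vanished together, `le_energy` would give a² ≤ 0. Negative times follow by oddness.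
The polar angle is therefore defined along the whole orbit. -/
theorem sq_add_sq_pos (h : IsShootingOrbit b c q a y p t) (hb : 0 ≤ b) (hc : 0 ≤ c) (hq : 0 < q)
    (ha : 0 < a) (s : ℝ) : 0 < y s ^ 2 + p s ^ 2 := by
  have key : ∀ s, 0 ≤ s → 0 < y s ^ 2 + p s ^ 2 := by
    intro s hs
    by_contra! hcon
    have hy : y s = 0 := by nlinarith [sq_nonneg (y s), sq_nonneg (p s)]
    have hp : p s = 0 := by nlinarith [sq_nonneg (y s), sq_nonneg (p s)]
    have := h.le_energy hb hc hq hs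
    have h0 : shootPotential b c q 0 = 0 := by
      simp [shootPotential, Real.zero_rpow (show q + 2 ≠ 0 by linarith)]
    rw [hy, hp, h0] at this
    simp at this
    nlinarith
  rcases le_total 0 s with hs | hs
  · exact key s hs
  · have h1 := key (-s) (by linarith)
    rw [(h.odd hq s).1, (h.odd hq s).2.1] at h1
    simpa using h1

theorem pow_six_le (h : IsShootingOrbit b c q a y p t) (hb : 0 < b) (hc : 0 ≤ c) (hq : 0 < q)
    {s : ℝ} (hs : 0 ≤ s) : y s ^ 6 ≤ a ^ 2 / b := by
  have h1 := h.energy_le hq hs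
  have h2 := shootPotential_ge (b := b) hc hq.le (y s)
  have h3 : 0 ≤ (1 - t s ^ 2) * p s ^ 2 :=
    mul_nonneg (h.one_sub_sq_pos hq s).le (sq_nonneg _)
  rw [le_div_iff₀ hb]
  nlinarith

theorem abs_y_le (h : IsShootingOrbit b c q a y p t) (hb : 0 < b) (hc : 0 ≤ c) (hq : 0 < q)
    {s : ℝ} (hs : 0 ≤ s) : |y s| ≤ 1 + a ^ 2 / b := by
  have h1 := h.pow_six_le hb hc hq hs
  have h2 : (0 : ℝ) ≤ a ^ 2 / b := by positivity
  by_contra! hcon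
  have h3 : 1 ≤ |y s| := by linarith
  have h4 : |y s| ≤ |y s| ^ 6 := le_self_pow₀ h3 (by norm_num)
  rw [Even.pow_abs (by decide)] at h4
  linarith

/-- The energy bound without the potential. The singularity at t = 1 is integrable in t, which is
what lets w = y³ converge. -/
theorem abs_p_le (h : IsShootingOrbit b c q a y p t) (hb : 0 ≤ b) (hc : 0 ≤ c) (hq : 0 < q)
    (ha : 0 ≤ a) {s : ℝ} (hs : 0 ≤ s) : |p s| ≤ a / Real.sqrt (1 - t s ^ 2) := by
  have h1 := h.energy_le hq hs
  have h2 := shootPotential_nonneg hb hc hq.le (y s)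
  have h3 := h.one_sub_sq_pos hq s
  rw [le_div_iff₀ (Real.sqrt_pos.2 h3)]
  refine abs_le_of_sq_le_sq' ?_ ha |>.2
  rw [mul_pow, Real.sq_sqrt h3.le, sq_abs]
  linarith

theorem hasDerivAt_cube (h : IsShootingOrbit b c q a y p t) (s : ℝ) :
    HasDerivAt (fun s => y s ^ 3) (p s * (shootSpeed b c q (y s) (p s) (t s) *
      ((1 - t s ^ 2) * y s ^ 2))) s :=
  ((h.hasDerivAt_y s).fun_pow 3).congr_deriv (by push_cast; ring)

/-- The oscillation of `w = y³` after the time `s`. -/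
theorem abs_cube_sub_le (h : IsShootingOrbit b c q a y p t) (hb : 0 ≤ b) (hc : 0 ≤ c) (hq : 0 < q)
    (ha : 0 ≤ a) {s r : ℝ} (hs : 0 ≤ s) (hsr : s ≤ r) :
    |y r ^ 3 - y s ^ 3| ≤ 2 * a * Real.sqrt (1 - t s) := by
  have ht1 : ∀ s, 0 < 1 - t s := fun s => by
    have := h.abs_t_lt_one hq s
    rw [abs_lt] at this; linarith
  have hsq : ∀ s, HasDerivAt (fun s => Real.sqrt (1 - t s))
      (-(shootSpeed b c q (y s) (p s) (t s) * ((1 - t s ^ 2) * y s ^ 2)) / (2 * Real.sqrt (1 - t s))) s :=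
    fun s => ((h.hasDerivAt_t s).const_sub 1).sqrt (ht1 s).ne'
  have ht' : ∀ s, 0 ≤ shootSpeed b c q (y s) (p s) (t s) * ((1 - t s ^ 2) * y s ^ 2) := fun s =>
    mul_nonneg (shootSpeed_pos _ _ _).le (mul_nonneg (h.one_sub_sq_pos hq s).le (sq_nonneg _))
  have hp : ∀ s, 0 ≤ s → |p s| ≤ a / Real.sqrt (1 - t s) := by
    intro s hs
    refine (h.abs_p_le hb hc hq ha hs).trans ?_
    have h0 := h.t_nonneg hq hs
    have h1 := ht1 s
    refine div_le_div_of_nonneg_left ha (Real.sqrt_pos.2 h1) (Real.sqrt_le_sqrt ?_)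
    nlinarith
  -- As dw = p dt and |p| ≤ a/√(1 - t), both w - 2a√(1 - t) and -w - 2a√(1 - t) are nondecreasing.
  have m1 := monotoneOn_Ici_of_hasDerivAt (fun s => (h.hasDerivAt_cube s).fun_sub ((hsq s).const_mul (2 * a)))
    (fun s hs => by
      have := (abs_le.1 (hp s hs)).1
      have h2 := mul_le_mul_of_nonneg_right this (ht' s)
      have h3 := (Real.sqrt_pos.2 (ht1 s)).ne'
      have e : 2 * a * (-(shootSpeed b c q (y s) (p s) (t s) * ((1 - t s ^ 2) * y s ^ 2)) /
        (2 * Real.sqrt (1 - t s))) = -(a / Real.sqrt (1 - t s)) *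
          (shootSpeed b c q (y s) (p s) (t s) * ((1 - t s ^ 2) * y s ^ 2)) := by field_simp
      rw [e]; linarith)
  have m2 := monotoneOn_Ici_of_hasDerivAt (fun s => (h.hasDerivAt_cube s).fun_neg.fun_sub
      ((hsq s).const_mul (2 * a)))
    (fun s hs => by
      have := (abs_le.1 (hp s hs)).2
      have h2 := mul_le_mul_of_nonneg_right this (ht' s)
      have h3 := (Real.sqrt_pos.2 (ht1 s)).ne'
      have e : 2 * a * (-(shootSpeed b c q (y s) (p s) (t s) * ((1 - t s ^ 2) * y s ^ 2)) /
        (2 * Real.sqrt (1 - t s))) = -(a / Real.sqrt (1 - t s)) *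
          (shootSpeed b c q (y s) (p s) (t s) * ((1 - t s ^ 2) * y s ^ 2)) := by field_simp
      rw [e]; linarith)
  have n1 := m1 (mem_Ici.2 hs) (mem_Ici.2 (hs.trans hsr)) hsr
  have n2 := m2 (mem_Ici.2 hs) (mem_Ici.2 (hs.trans hsr)) hsr
  have h5 : 0 ≤ 2 * a * Real.sqrt (1 - t r) := by positivity
  simp only at n1 n2
  rw [abs_le]
  constructor <;> linarith

/-- The time variable exhausts `[0, 1)`. -/
theorem exists_lt_t (h : IsShootingOrbit b c q a y p t) (hb : 0 < b) (hc : 0 ≤ c) (hq : 0 < q)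
    (ha : 0 < a) {η : ℝ} (hη : η < 1) : ∃ s, 0 ≤ s ∧ η < t s := by
  -- If t stayed below η, the orbit would remain in a compact set, where the speed is at least m₀ >
  -- 0. The bounded function y p + (D/δ) t would then grow at least linearly: (1 - t²)p²/3 drives
  -- it, the term (D/δ) t' absorbs the loss of order y², and `le_energy` turns the total into δa²/3.
  by_contra! hcon
  have hη0 : 0 ≤ η := h.t_zero ▸ hcon 0 le_rfl
  set δ := 1 - η ^ 2 with hδ
  have hδ0 : 0 < δ := by nlinarith
  have hδt : ∀ s, 0 ≤ s → δ ≤ 1 - t s ^ 2 := by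
    intro s hs
    nlinarith [hcon s hs, h.t_nonneg hq hs]
  set Y := 1 + a ^ 2 / b with hY
  have hY0 : 0 < Y := by positivity
  set P := a / Real.sqrt δ with hP
  have hP0 : 0 < P := div_pos ha (Real.sqrt_pos.2 hδ0)
  have hpb : ∀ s, 0 ≤ s → |p s| ≤ P := fun s hs =>
    (h.abs_p_le hb.le hc hq ha.le hs).trans
      (div_le_div_of_nonneg_left ha.le (Real.sqrt_pos.2 hδ0) (Real.sqrt_le_sqrt (hδt s hs)))
  have hyb : ∀ s, 0 ≤ s → |y s| ≤ Y := fun s hs => h.abs_y_le hb hc hq hs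
  obtain ⟨z₀, -, hz₀⟩ := ((isCompact_Icc (a := -Y) (b := Y)).prod
    ((isCompact_Icc (a := -P) (b := P)).prod (isCompact_Icc (a := (-1 : ℝ)) (b := 1)))).exists_isMinOn
    ⟨(0, 0, 0), by simp [hY0.le, hP0.le]⟩
    (continuous_shootSpeed (b := b) (c := c) hq).continuousOn
  set m₀ := shootSpeed b c q z₀.1 z₀.2.1 z₀.2.2 with hm₀
  have hm₀0 : 0 < m₀ := shootSpeed_pos _ _ _
  have hm : ∀ s, 0 ≤ s → m₀ ≤ shootSpeed b c q (y s) (p s) (t s) := by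
    intro s hs
    refine hz₀ (a := (y s, p s, t s)) ⟨abs_le.1 (hyb s hs), abs_le.1 (hpb s hs), ?_⟩
    exact abs_le.1 (h.abs_t_lt_one hq s).le
  set C₁ := b * Y ^ 4 + c * Y ^ q with hC₁
  set C₂ := b * Y ^ 4 / 2 + 2 * c * Y ^ q with hC₂
  have hC₁0 : 0 ≤ C₁ := by positivity
  have hC₂0 : 0 ≤ C₂ := by positivity
  have hyq : ∀ s, 0 ≤ s → y s ^ 4 ≤ Y ^ 4 ∧ |y s| ^ q ≤ Y ^ q := by
    intro s hs
    have := pow_le_pow_left₀ (abs_nonneg _) (hyb s hs) 4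
    rw [Even.pow_abs (by decide)] at this
    exact ⟨this, Real.rpow_le_rpow (abs_nonneg _) (hyb s hs) hq.le⟩
  set D := C₁ + C₂ with hD
  have hd : ∀ s, HasDerivAt (fun s => y s * p s + D / δ * t s - m₀ * δ * a ^ 2 / 3 * s)
      (shootSpeed b c q (y s) (p s) (t s) * ((1 - t s ^ 2) * p s ^ 2 / 3 - y s * shootForce b c q (y s)
        + D / δ * ((1 - t s ^ 2) * y s ^ 2)) - m₀ * δ * a ^ 2 / 3) s := by
    intro s
    refine (((h.hasDerivAt_y s).fun_mul (h.hasDerivAt_p s)).fun_add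
      ((h.hasDerivAt_t s).const_mul (D / δ)) |>.fun_sub
        ((hasDerivAt_id s).const_mul (m₀ * δ * a ^ 2 / 3))).congr_deriv ?_
    ring
  have hmono := monotoneOn_Ici_of_hasDerivAt hd (fun s hs => by
    obtain ⟨hy4, hyq'⟩ := hyq s hs
    have hδs := hδt s hs
    have k1 : b * y s ^ 4 + c * |y s| ^ q ≤ C₁ := by rw [hC₁]; gcongr
    have k2 : b * y s ^ 4 / 2 + 2 * c * |y s| ^ q ≤ C₂ := by rw [hC₂]; gcongr
    have h1 : y s * shootForce b c q (y s) ≤ C₁ * y s ^ 2 := by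
      rw [shootForce_mul_self, mul_comm C₁]
      gcongr
    have h2 : shootPotential b c q (y s) ≤ C₂ * y s ^ 2 := by
      refine (shootPotential_le hc hq.le (y s)).trans ?_
      rw [mul_comm C₂]
      gcongr
    have h3 := h.le_energy hb.le hc hq hs
    have h4 : shootPotential b c q (y s) / (1 - t s ^ 2) ≤ C₂ * y s ^ 2 / δ :=
      div_le_div₀ (by positivity) h2 hδ0 hδs
    have h5 : D * y s ^ 2 ≤ D / δ * ((1 - t s ^ 2) * y s ^ 2) := by
      have : D * y s ^ 2 = D / δ * (δ * y s ^ 2) := by field_simp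
      rw [this]
      gcongr
    have h6 : δ * p s ^ 2 ≤ (1 - t s ^ 2) * p s ^ 2 := by gcongr
    have h7 : δ * a ^ 2 ≤ δ * p s ^ 2 + 2 * C₂ * y s ^ 2 := by
      have : δ * (C₂ * y s ^ 2 / δ) = C₂ * y s ^ 2 := by field_simp
      nlinarith
    have h8 : δ * a ^ 2 / 3 ≤ (1 - t s ^ 2) * p s ^ 2 / 3 - y s * shootForce b c q (y s)
        + D / δ * ((1 - t s ^ 2) * y s ^ 2) := by
      have : 0 ≤ C₂ * y s ^ 2 := by positivity
      have : D * y s ^ 2 = C₁ * y s ^ 2 + C₂ * y s ^ 2 := by rw [hD]; ring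
      linarith
    have h9 : 0 ≤ δ * a ^ 2 / 3 := by positivity
    have := mul_le_mul (hm s hs) h8 h9 (shootSpeed_pos _ _ _).le
    linarith)
  have hpos : 0 < m₀ * δ * a ^ 2 / 3 := by positivity
  -- At the time S the linear lower bound exceeds the upper bound YP + D/δ by 1.
  set S := (Y * P + D / δ + 1) / (m₀ * δ * a ^ 2 / 3) with hS
  have hS0 : 0 ≤ S := by positivity
  have := hmono self_mem_Ici (mem_Ici.2 hS0) hS0
  simp only [h.y_zero, h.t_zero] at this
  have e : m₀ * δ * a ^ 2 / 3 * S = Y * P + D / δ + 1 := by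
    rw [hS]; field_simp
  rw [e] at this
  have h1 : y S * p S ≤ Y * P := by
    refine (le_abs_self _).trans ?_
    rw [abs_mul]
    exact mul_le_mul (hyb S hS0) (hpb S hS0) (abs_nonneg _) hY0.le
  have h2 : D / δ * t S ≤ D / δ := by
    have := (abs_lt.1 (h.abs_t_lt_one hq S)).2
    have h3 : 0 ≤ D / δ := by positivity
    nlinarith
  linarith

end IsShootingOrbit
end shooting

/-! ### Rotation of the orbits and the shooting argument. -/

variable {b c q a : ℝ} {y p t : ℝ → ℝ}

/-- The angular speed of the shooting system in the `(p, y)`-plane. -/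
noncomputable def shootAngularSpeed (b c q y p t : ℝ) : ℝ :=
  angularSpeed y p (shootSpeed b c q y p t * ((1 - t ^ 2) * p / 3))
    (shootSpeed b c q y p t * -shootForce b c q y)

/-- The polar angle of a shooting trajectory. -/
noncomputable def shootAngle (b c q : ℝ) (y p t : ℝ → ℝ) (s : ℝ) : ℝ :=
  ∫ r in (0 : ℝ)..s, shootAngularSpeed b c q (y r) (p r) (t r)

theorem continuous_shootForce (hq : 0 < q) : Continuous (shootForce b c q) :=
  (contDiff_shootForce hq).continuous

theorem hasDerivAt_integral_of_continuous {f : ℝ → ℝ} (hf : Continuous f) (s : ℝ) :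
    HasDerivAt (fun s => ∫ r in (0 : ℝ)..s, f r) (f s) s :=
  intervalIntegral.integral_hasDerivAt_right (hf.intervalIntegrable _ _)
    (hf.stronglyMeasurableAtFilter _ _) hf.continuousAt

namespace IsShootingOrbit

theorem continuous_angularSpeed (h : IsShootingOrbit b c q a y p t) (hb : 0 ≤ b) (hc : 0 ≤ c)
    (hq : 0 < q) (ha : 0 < a) :
    Continuous fun s => shootAngularSpeed b c q (y s) (p s) (t s) := by
  have h1 := h.continuous_speed hq
  have h2 := h.continuous_y
  have h3 := h.continuous_p
  have h4 := h.continuous_t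
  have h5 := (continuous_shootForce (b := b) (c := c) hq).comp h2
  simp only [Function.comp_def] at h5
  unfold shootAngularSpeed angularSpeed
  exact Continuous.div (by fun_prop) (by fun_prop) fun s => (h.sq_add_sq_pos hb hc hq ha s).ne'

theorem hasDerivAt_angle (h : IsShootingOrbit b c q a y p t) (hb : 0 ≤ b) (hc : 0 ≤ c)
    (hq : 0 < q) (ha : 0 < a) (s : ℝ) :
    HasDerivAt (shootAngle b c q y p t) (shootAngularSpeed b c q (y s) (p s) (t s)) s :=
  hasDerivAt_integral_of_continuous (h.continuous_angularSpeed hb hc hq ha) s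

theorem angle_zero : shootAngle b c q y p t 0 = 0 := intervalIntegral.integral_same

/-- The numerator y'p - yp' is the speed times (1 - t²)p²/3 + yF(y), and the force F has the sign of
y. -/
theorem monotone_angle (h : IsShootingOrbit b c q a y p t) (hb : 0 ≤ b) (hc : 0 ≤ c)
    (hq : 0 < q) (ha : 0 < a) : Monotone (shootAngle b c q y p t) := by
  refine monotone_of_hasDerivAt_nonneg (h.hasDerivAt_angle hb hc hq ha) fun s => ?_
  show 0 ≤ shootAngularSpeed b c q (y s) (p s) (t s)
  have h1 := shootForce_mul_self_nonneg (q := q) hb hc (y s)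
  have h2 := (h.one_sub_sq_pos hq s).le
  rw [shootAngularSpeed, angularSpeed]
  refine div_nonneg ?_ (by positivity)
  have e : shootSpeed b c q (y s) (p s) (t s) * ((1 - t s ^ 2) * p s / 3) * p s
      - y s * (shootSpeed b c q (y s) (p s) (t s) * -shootForce b c q (y s))
      = shootSpeed b c q (y s) (p s) (t s) *
        ((1 - t s ^ 2) * p s ^ 2 / 3 + y s * shootForce b c q (y s)) := by ring
  rw [e]
  exact mul_nonneg (shootSpeed_pos _ _ _).le (by positivity)

theorem polar (h : IsShootingOrbit b c q a y p t) (hb : 0 ≤ b) (hc : 0 ≤ c)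
    (hq : 0 < q) (ha : 0 < a) (s : ℝ) :
    y s = Real.sqrt (y s ^ 2 + p s ^ 2) * Real.sin (shootAngle b c q y p t s) ∧
      p s = Real.sqrt (y s ^ 2 + p s ^ 2) * Real.cos (shootAngle b c q y p t s) :=
  polar_coordinates h.hasDerivAt_y h.hasDerivAt_p (h.sq_add_sq_pos hb hc hq ha) h.y_zero
    (h.p_zero ▸ ha) angle_zero (h.hasDerivAt_angle hb hc hq ha) s

theorem angle_ne_of_y_ne_zero (h : IsShootingOrbit b c q a y p t) (hb : 0 ≤ b) (hc : 0 ≤ c)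
    (hq : 0 < q) (ha : 0 < a) {s : ℝ} (hy : y s ≠ 0) (n : ℕ) :
    shootAngle b c q y p t s ≠ n * Real.pi := by
  intro hcon
  apply hy
  rw [(h.polar hb hc hq ha s).1, hcon, Real.sin_nat_mul_pi, mul_zero]

theorem continuous_angle (h : IsShootingOrbit b c q a y p t) (hb : 0 ≤ b) (hc : 0 ≤ c)
    (hq : 0 < q) (ha : 0 < a) : Continuous (shootAngle b c q y p t) :=
  continuous_iff_continuousAt.2 fun s => (h.hasDerivAt_angle hb hc hq ha s).continuousAt

/-- The polar angle is large if the frequency is large on `[0, 1/2]`. -/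
theorem exists_le_angle (h : IsShootingOrbit b c q a y p t) (hb : 0 < b) (hc : 0 < c)
    (hq : 0 < q) (ha : 0 < a) {κ : ℝ} (hκ : 0 < κ)
    (hfreq : ∀ s, 0 ≤ s → t s ≤ 1 / 2 →
      κ ^ 2 * y s ^ 6 + p s ^ 2 ≤ 2 * (p s ^ 2 + (b * y s ^ 6 + c * (y s ^ 2 * |y s| ^ q)))) :
    ∃ s, 0 ≤ s ∧ κ / 4 - Real.pi / 2 ≤ shootAngle b c q y p t s := by
  have hne := h.sq_add_sq_pos hb.le hc.le hq ha
  have hX : ∀ s, HasDerivAt (fun s => κ * y s ^ 3) (κ * (p s * (shootSpeed b c q (y s) (p s) (t s) *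
      ((1 - t s ^ 2) * y s ^ 2)))) s := fun s => (h.hasDerivAt_cube s).const_mul κ
  have hneX : ∀ s, 0 < (κ * y s ^ 3) ^ 2 + p s ^ 2 := by
    intro s
    by_cases hy : y s = 0
    · have := hne s
      rw [hy] at this ⊢
      simpa using this
    · positivity
  -- A second angle, that of (p, κw) with w = y³. Its curve lies in the same quadrant as (p, y) at
  -- all times, so the two angles differ by less than π/2. In the scaled plane a frequency of order
  -- κ is visible as rotation at rate at least κ/2 in t.
  set v : ℝ → ℝ := fun s => angularSpeed (κ * y s ^ 3) (p s)
    (κ * (p s * (shootSpeed b c q (y s) (p s) (t s) * ((1 - t s ^ 2) * y s ^ 2))))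
    (shootSpeed b c q (y s) (p s) (t s) * -shootForce b c q (y s)) with hv
  have hvc : Continuous v := by
    have h1 := h.continuous_speed hq
    have h2 := h.continuous_y
    have h3 := h.continuous_p
    have h4 := h.continuous_t
    have h5 := (continuous_shootForce (b := b) (c := c) hq).comp h2
    simp only [Function.comp_def] at h5
    simp only [hv, angularSpeed]
    exact Continuous.div (by fun_prop) (by fun_prop) fun s => (hneX s).ne'
  set ζ : ℝ → ℝ := fun s => ∫ r in (0 : ℝ)..s, v r with hζ
  have hζd : ∀ s, HasDerivAt ζ (v s) s := hasDerivAt_integral_of_continuous hvc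
  have hζ0 : ζ 0 = 0 := intervalIntegral.integral_same
  have hpol := polar_coordinates hX h.hasDerivAt_p hneX (by simp [h.y_zero]) (h.p_zero ▸ ha) hζ0 hζd
  have hclose : ∀ s, |shootAngle b c q y p t s - ζ s| < Real.pi / 2 := by
    have hs : ∀ s, ∃ A B : ℝ, 0 < A ∧ 0 < B ∧ y s ^ 4 * κ
        = A * (Real.sin (shootAngle b c q y p t s) * Real.sin (ζ s)) ∧
        p s ^ 2 = B * (Real.cos (shootAngle b c q y p t s) * Real.cos (ζ s)) := by
      intro s
      obtain ⟨e1, e2⟩ := h.polar hb.le hc.le hq ha s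
      obtain ⟨e3, e4⟩ := hpol s
      have hA := mul_pos (Real.sqrt_pos.2 (hne s)) (Real.sqrt_pos.2 (hneX s))
      refine ⟨_, _, hA, hA, ?_, ?_⟩
      · have : y s ^ 4 * κ = y s * (κ * y s ^ 3) := by ring
        exact (this.trans (congrArg₂ (· * ·) e1 e3)).trans (by ring)
      · exact ((sq (p s)).trans (congrArg₂ (· * ·) e2 e4)).trans (by ring)
    refine abs_sub_lt_pi_div_two (h.continuous_angle hb.le hc.le hq ha)
      (continuous_iff_continuousAt.2 fun s => (hζd s).continuousAt) (by rw [hζ0, angle_zero]) ?_ ?_ ?_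
    · intro s
      obtain ⟨A, B, hA, hB, e1, e2⟩ := hs s
      exact (mul_nonneg_iff_of_pos_left hA).1 (e1 ▸ by positivity)
    · intro s
      obtain ⟨A, B, hA, hB, e1, e2⟩ := hs s
      exact (mul_nonneg_iff_of_pos_left hB).1 (e2 ▸ by positivity)
    · intro s
      obtain ⟨A, B, hA, hB, e1, e2⟩ := hs s
      by_contra! hcon
      rw [hcon.1, mul_zero] at e1
      rw [hcon.2, mul_zero] at e2
      have hy0 : y s = 0 := by
        rcases mul_eq_zero.1 e1 with h1 | h1
        · exact pow_eq_zero_iff (by norm_num) |>.1 h1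
        · exact absurd h1 hκ.ne'
      have hp0 : p s = 0 := pow_eq_zero_iff (by norm_num) |>.1 e2
      have := hne s
      rw [hy0, hp0] at this
      simp at this
  obtain ⟨s₁, hs₁, hts₁⟩ := h.exists_lt_t hb hc.le hq ha (η := 1 / 2) (by norm_num)
  obtain ⟨s, hs, hts⟩ := intermediate_value_Icc hs₁ h.continuous_t.continuousOn
    (show (1 / 2 : ℝ) ∈ Icc (t 0) (t s₁) by rw [h.t_zero]; exact ⟨by norm_num, hts₁.le⟩)
  refine ⟨s, hs.1, ?_⟩
  -- Here the frequency hypothesis enters: ζ' ≥ (κ/2) t' as long as t ≤ 1/2, so ζ ≥ κ/4 when t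
  -- reaches 1/2.
  have hmono : MonotoneOn (fun s => ζ s - κ / 2 * t s) (Icc 0 s) := by
    have hd : ∀ r, HasDerivAt (fun s => ζ s - κ / 2 * t s) (v r - κ / 2 *
        (shootSpeed b c q (y r) (p r) (t r) * ((1 - t r ^ 2) * y r ^ 2))) r := fun r =>
      (hζd r).fun_sub ((h.hasDerivAt_t r).const_mul (κ / 2))
    refine monotoneOn_of_deriv_nonneg (convex_Icc 0 s)
      (fun r _ => (hd r).continuousAt.continuousWithinAt)
      (fun r _ => (hd r).differentiableAt.differentiableWithinAt) fun r hr => ?_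
    rw [interior_Icc] at hr
    rw [(hd r).deriv, sub_nonneg]
    have htr : t r ≤ 1 / 2 := hts ▸ h.monotone_t hq hr.2.le
    have hf := hfreq r hr.1.le htr
    have ht0 := h.t_nonneg hq hr.1.le
    have hm := shootSpeed_pos (b := b) (c := c) (q := q) (y r) (p r) (t r)
    have hpos := h.one_sub_sq_pos hq r
    rw [hv]
    simp only [angularSpeed]
    rw [le_div_iff₀ (hneX r)]
    have e : κ * (p r * (shootSpeed b c q (y r) (p r) (t r) * ((1 - t r ^ 2) * y r ^ 2))) * p r
        - κ * y r ^ 3 * (shootSpeed b c q (y r) (p r) (t r) * -shootForce b c q (y r))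
        = κ / 2 * (shootSpeed b c q (y r) (p r) (t r) * y r ^ 2) *
          (2 * ((1 - t r ^ 2) * p r ^ 2 + (b * y r ^ 6 + c * (y r ^ 2 * |y r| ^ q)))) := by
      rw [shootForce]; ring
    have e2 : κ / 2 * (shootSpeed b c q (y r) (p r) (t r) * ((1 - t r ^ 2) * y r ^ 2)) *
        ((κ * y r ^ 3) ^ 2 + p r ^ 2) = κ / 2 * (shootSpeed b c q (y r) (p r) (t r) * y r ^ 2) *
          ((1 - t r ^ 2) * (κ ^ 2 * y r ^ 6 + p r ^ 2)) := by ring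
    rw [e, e2]
    refine mul_le_mul_of_nonneg_left ?_ (by positivity)
    have h6 := mul_le_mul_of_nonneg_left hf hpos.le
    have h7 : 0 ≤ b * y r ^ 6 + c * (y r ^ 2 * |y r| ^ q) := by positivity
    nlinarith [mul_nonneg (sq_nonneg (t r)) h7]
  have h1 := hmono ⟨le_rfl, hs.1⟩ ⟨hs.1, le_rfl⟩ hs.1
  simp only [hζ0, h.t_zero, hts] at h1
  have h2 := abs_lt.1 (hclose s)
  linarith [h2.1]

end IsShootingOrbit

/-- High frequencies are reached for small slopes in the sublinear case and for large slopes in the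
superlinear case. -/
theorem exists_frequency (hb : 0 < b) (hc : 0 < c) (hq : 0 < q) (hq4 : q ≠ 4) {κ : ℝ} (hκ : 0 < κ) :
    ∃ a, 0 < a ∧ ∀ y p t : ℝ → ℝ, IsShootingOrbit b c q a y p t → ∀ s, 0 ≤ s → t s ≤ 1 / 2 →
      κ ^ 2 * y s ^ 6 + p s ^ 2 ≤ 2 * (p s ^ 2 + (b * y s ^ 6 + c * (y s ^ 2 * |y s| ^ q))) := by
  have hpow6 : ∀ z : ℝ, |z| ^ 4 * z ^ 2 = z ^ 6 := fun z => by
    rw [Even.pow_abs (by decide)]; ring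
  have habs : ∀ z : ℝ, z ≠ 0 → |z| ^ q = |z| ^ 4 * |z| ^ (q - 4) := fun z hz => by
    rw [← Real.rpow_natCast, ← Real.rpow_add (abs_pos.2 hz)]; norm_num
  have hgood : ∀ z : ℝ, κ ^ 2 / c ≤ |z| ^ (q - 4) → κ ^ 2 * z ^ 6 ≤ c * (z ^ 2 * |z| ^ q) := by
    intro z hz
    by_cases h0 : z = 0
    · simp [h0]
    rw [habs z h0]
    rw [div_le_iff₀ hc] at hz
    have h6 : 0 ≤ z ^ 6 := by positivity
    calc κ ^ 2 * z ^ 6 ≤ |z| ^ (q - 4) * c * z ^ 6 := by gcongr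
      _ = c * (z ^ 2 * (|z| ^ 4 * |z| ^ (q - 4))) := by rw [← hpow6]; ring
  rcases lt_or_gt_of_ne hq4 with h4 | h4
  -- Sublinear case: η is the amplitude at which c|y|^(q-4) = κ², and smaller amplitudes have higher
  -- frequency. The slope √b η³ is chosen so that the energy keeps |y| ≤ η.
  · set η := (κ ^ 2 / c) ^ (1 / (q - 4)) with hη
    have hη0 : 0 < η := Real.rpow_pos_of_pos (by positivity) _
    refine ⟨Real.sqrt b * η ^ 3, by positivity, fun y p t h s hs _ => ?_⟩
    have h1 := h.pow_six_le hb hc.le hq hs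
    rw [mul_pow, Real.sq_sqrt hb.le, mul_div_cancel_left₀ _ hb.ne', ← pow_mul] at h1
    have h2 : |y s| ≤ η := by
      rw [← Even.pow_abs (by decide : Even 6)] at h1
      exact le_of_pow_le_pow_left₀ (by norm_num) hη0.le h1
    have h5 : 0 ≤ b * y s ^ 6 := by positivity
    have h6 : 0 ≤ c * (y s ^ 2 * |y s| ^ q) := by positivity
    by_cases h0 : y s = 0
    · rw [h0]; simp; nlinarith [sq_nonneg (p s)]
    have h3 : κ ^ 2 / c ≤ |y s| ^ (q - 4) := by
      have := Real.rpow_le_rpow_of_nonpos (abs_pos.2 h0) h2 (show q - 4 ≤ 0 by linarith)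
      refine le_trans (le_of_eq ?_) this
      rw [hη, ← Real.rpow_mul (by positivity), one_div_mul_cancel (by linarith), Real.rpow_one]
    have := hgood _ h3
    nlinarith [sq_nonneg (p s)]
  -- Superlinear case: amplitudes above η are fast enough. Below η the slope p itself is large,
  -- since `le_energy` gives p² ≥ a² - (8/3)V(η) ≥ κ²η⁶ for this a; the 8/3 comes from 1 - t² ≥ 3/4.
  · set η := (κ ^ 2 / c) ^ (1 / (q - 4)) with hη
    have hη0 : 0 < η := Real.rpow_pos_of_pos (by positivity) _
    have hK := shootPotential_nonneg hb.le hc.le hq.le η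
    refine ⟨1 + κ ^ 2 * η ^ 6 + 8 / 3 * shootPotential b c q η, by positivity,
      fun y p t h s hs ht => ?_⟩
    have h5 : 0 ≤ b * y s ^ 6 := by positivity
    have h6 : 0 ≤ c * (y s ^ 2 * |y s| ^ q) := by positivity
    rcases le_total η |y s| with h2 | h2
    · have h3 : κ ^ 2 / c ≤ |y s| ^ (q - 4) := by
        have := Real.rpow_le_rpow hη0.le h2 (show 0 ≤ q - 4 by linarith)
        refine le_trans (le_of_eq ?_) this
        rw [hη, ← Real.rpow_mul (by positivity), one_div_mul_cancel (by linarith), Real.rpow_one]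
      have := hgood _ h3
      nlinarith [sq_nonneg (p s)]
    · have h3 := h.le_energy hb.le hc.le hq hs
      have ht0 := h.t_nonneg hq hs
      have h7 : shootPotential b c q (y s) / (1 - t s ^ 2) ≤ shootPotential b c q η / (3 / 4) := by
        refine div_le_div₀ hK (shootPotential_mono hb.le hc.le hq.le ?_) (by norm_num) (by nlinarith)
        rwa [abs_of_pos hη0]
      have h8 : y s ^ 6 ≤ η ^ 6 := by
        rw [← Even.pow_abs (by decide : Even 6)]
        exact pow_le_pow_left₀ (abs_nonneg _) h2 6
      have h9 : κ ^ 2 * y s ^ 6 ≤ κ ^ 2 * η ^ 6 := by gcongr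
      set A := κ ^ 2 * η ^ 6 + 8 / 3 * shootPotential b c q η with hA
      have hA0 : 0 ≤ A := by positivity
      have h10 : A ≤ (1 + κ ^ 2 * η ^ 6 + 8 / 3 * shootPotential b c q η) ^ 2 := by
        rw [show 1 + κ ^ 2 * η ^ 6 + 8 / 3 * shootPotential b c q η = 1 + A by rw [hA]; ring]
        nlinarith
      nlinarith

/-- The shooting method: there is a trajectory on which `w = y³` tends to `0` as `t → 1`. -/
theorem exists_shootingOrbit_tendsto_zero (hb : 0 < b) (hc : 0 < c) (hq : 0 < q) (hq4 : q ≠ 4) :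
    ∃ a, 0 < a ∧ ∃ y p t : ℝ → ℝ, IsShootingOrbit b c q a y p t ∧
      ∀ s, 0 ≤ s → |y s ^ 3| ≤ 2 * a * Real.sqrt (1 - t s) := by
  obtain ⟨y, p, t, horb, hyc, hpc, htc⟩ := exists_shootingOrbit b c hq
  by_contra! hcon
  have hgood : ∀ a : Ioi (0 : ℝ), ∃ s, 0 ≤ s ∧ 2 * a * Real.sqrt (1 - t a s) < |y a s ^ 3| :=
    fun a => hcon a a.2 _ _ _ (horb a)
  have hang : ∀ s, Continuous fun a : Ioi (0 : ℝ) => shootAngle b c q (y a) (p a) (t a) s := by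
    intro s
    refine intervalIntegral.continuous_parametric_intervalIntegral_of_continuous
      (f := fun (a : Ioi (0 : ℝ)) r => shootAngularSpeed b c q (y a r) (p a r) (t a r)) ?_
      (continuous_const (y := s))
    have h2 : Continuous fun x : Ioi (0 : ℝ) × ℝ => y x.1 x.2 :=
      hyc.comp (by fun_prop : Continuous fun x : Ioi (0 : ℝ) × ℝ => ((x.1 : ℝ), x.2))
    have h3 : Continuous fun x : Ioi (0 : ℝ) × ℝ => p x.1 x.2 :=
      hpc.comp (by fun_prop : Continuous fun x : Ioi (0 : ℝ) × ℝ => ((x.1 : ℝ), x.2))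
    have h4 : Continuous fun x : Ioi (0 : ℝ) × ℝ => t x.1 x.2 :=
      htc.comp (by fun_prop : Continuous fun x : Ioi (0 : ℝ) × ℝ => ((x.1 : ℝ), x.2))
    have h1 : Continuous fun x : Ioi (0 : ℝ) × ℝ => shootSpeed b c q (y x.1 x.2) (p x.1 x.2) (t x.1 x.2) :=
      (continuous_shootSpeed (b := b) (c := c) hq).comp
        (f := fun x : Ioi (0 : ℝ) × ℝ => (y x.1 x.2, p x.1 x.2, t x.1 x.2))
        (h2.prodMk (h3.prodMk h4))
    have h5 := (continuous_shootForce (b := b) (c := c) hq).comp h2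
    simp only [Function.comp_def] at h5
    simp only [Function.uncurry_def, shootAngularSpeed, angularSpeed]
    exact Continuous.div (by fun_prop) (by fun_prop) fun x =>
      ((horb x.1).sq_add_sq_pos hb.le hc.le hq x.1.2 x.2).ne'
  -- Once |w| exceeds 2a√(1 - t), the later oscillation of w is too small to reach 0, so the angle
  -- can no longer cross a multiple of π.
  have hbelow : ∀ (N : ℕ) (a : Ioi (0 : ℝ)) (s₀ : ℝ), 0 ≤ s₀ →
      2 * a * Real.sqrt (1 - t a s₀) < |y a s₀ ^ 3| →
      shootAngle b c q (y a) (p a) (t a) s₀ < N * Real.pi →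
      ∀ s, 0 ≤ s → shootAngle b c q (y a) (p a) (t a) s ≤ N * Real.pi := by
    intro N a s₀ hs₀ hg hlt s hs
    have ho := horb a
    rcases le_total s s₀ with hss | hss
    · exact (ho.monotone_angle hb.le hc.le hq a.2 hss).trans hlt.le
    · by_contra! hgt
      obtain ⟨r, hr, hre⟩ := intermediate_value_Icc hss
        (ho.continuous_angle hb.le hc.le hq a.2).continuousOn
        (show (N * Real.pi : ℝ) ∈ Icc _ _ from ⟨hlt.le, hgt.le⟩)
      refine ho.angle_ne_of_y_ne_zero hb.le hc.le hq a.2 (s := r) ?_ N hre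
      intro hy0
      have := ho.abs_cube_sub_le hb.le hc.le hq (le_of_lt a.2) hs₀ hr.1
      rw [hy0] at this
      simp only [ne_eq, OfNat.ofNat_ne_zero, not_false_eq_true, zero_pow, zero_sub, abs_neg] at this
      linarith
  let A : ℕ → Set (Ioi (0 : ℝ)) := fun N =>
    {a | ∃ s, 0 ≤ s ∧ N * Real.pi < shootAngle b c q (y a) (p a) (t a) s}
  have hopen : ∀ N, IsOpen (A N) := by
    intro N
    have : A N = ⋃ s ∈ Ici (0 : ℝ), {a : Ioi (0 : ℝ) | N * Real.pi <
        shootAngle b c q (y a) (p a) (t a) s} := by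
      ext a; simp [A]
    rw [this]
    exact isOpen_biUnion fun s _ => isOpen_lt continuous_const (hang s)
  -- Outside `A N` the orbit is trapped strictly below Nπ at a time s₀ when |w| is already large.
  -- Both strict inequalities persist for nearby slopes.
  have hclosed : ∀ N, IsClosed (A N) := by
    intro N
    rw [← isOpen_compl_iff, isOpen_iff_mem_nhds]
    intro a ha
    obtain ⟨s₀, hs₀, hg⟩ := hgood a
    have hle : ∀ s, 0 ≤ s → shootAngle b c q (y a) (p a) (t a) s ≤ N * Real.pi := by
      intro s hs
      by_contra! h
      exact ha ⟨s, hs, h⟩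
    have hy0 : y a s₀ ≠ 0 := by
      intro h0
      rw [h0] at hg
      have : 0 ≤ 2 * a.1 * Real.sqrt (1 - t a s₀) := by
        have : 0 ≤ a.1 := le_of_lt a.2
        positivity
      simp at hg
      linarith
    have hlt : shootAngle b c q (y a) (p a) (t a) s₀ < N * Real.pi :=
      lt_of_le_of_ne (hle s₀ hs₀) ((horb a).angle_ne_of_y_ne_zero hb.le hc.le hq a.2 hy0 N)
    have hyca : Continuous fun a : Ioi (0 : ℝ) => y a s₀ :=
      hyc.comp (by fun_prop : Continuous fun x : Ioi (0 : ℝ) => ((x : ℝ), s₀))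
    have htca : Continuous fun a : Ioi (0 : ℝ) => t a s₀ :=
      htc.comp (by fun_prop : Continuous fun x : Ioi (0 : ℝ) => ((x : ℝ), s₀))
    have e1 : ∀ᶠ a' : Ioi (0 : ℝ) in 𝓝 a, 2 * a' * Real.sqrt (1 - t a' s₀) < |y a' s₀ ^ 3| :=
      (isOpen_lt (by fun_prop) (by fun_prop)).mem_nhds hg
    have e2 : ∀ᶠ a' : Ioi (0 : ℝ) in 𝓝 a, shootAngle b c q (y a') (p a') (t a') s₀ < N * Real.pi :=
      (isOpen_lt (hang s₀) continuous_const).mem_nhds hlt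
    filter_upwards [e1, e2] with a' h1 h2
    rintro ⟨s, hs, h3⟩
    exact absurd (hbelow N a' s₀ hs₀ h1 h2 s hs) (not_le.2 h3)
  have hnonempty : ∀ N, (A N).Nonempty := by
    intro N
    -- This κ makes κ/4 - π/2 = Nπ + π/2, which exceeds Nπ.
    have hκ : 0 < 4 * (N * Real.pi + Real.pi) := by positivity
    obtain ⟨a, ha, hf⟩ := exists_frequency hb hc hq hq4 hκ
    obtain ⟨s, hs, h1⟩ := (horb a).exists_le_angle hb hc hq ha hκ (hf _ _ _ (horb a))
    refine ⟨⟨a, ha⟩, s, hs, ?_⟩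
    have := Real.pi_pos
    refine lt_of_lt_of_le ?_ h1
    linarith
  have : PreconnectedSpace (Ioi (0 : ℝ)) := Subtype.preconnectedSpace isPreconnected_Ioi
  have huniv : ∀ N, A N = univ := fun N => IsClopen.eq_univ ⟨hclosed N, hopen N⟩ (hnonempty N)
  -- Any slope yields the contradiction: it lies in every `A N`, yet its angle stays below some Nπ.
  let a₁ : Ioi (0 : ℝ) := ⟨1, mem_Ioi.2 one_pos⟩
  obtain ⟨s₀, hs₀, hg⟩ := hgood a₁
  obtain ⟨N, hN⟩ := exists_nat_gt (shootAngle b c q (y a₁) (p a₁) (t a₁) s₀ / Real.pi)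
  rw [div_lt_iff₀ Real.pi_pos] at hN
  obtain ⟨s, hs, h1⟩ : a₁ ∈ A N := huniv N ▸ mem_univ a₁
  exact absurd (hbelow N a₁ s₀ hs₀ hg hN s hs) (not_le.2 h1)

/-! ### Return from the orbit to functions of t. -/

/-- For negative r the factor |w|^r is unbounded at 0, but the product has absolute value |w|^(1+r)
with a positive exponent. This is used with r = 2/β, which is negative for β < -2. -/
theorem continuous_mul_abs_rpow {r : ℝ} (hr : -1 < r) : Continuous fun w : ℝ => w * |w| ^ r := by
  rw [continuous_iff_continuousAt]
  intro w
  rcases eq_or_ne w 0 with rfl | hw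
  · have h1 : Tendsto (fun w : ℝ => |w| ^ (1 + r)) (𝓝 0) (𝓝 0) := by
      have := (continuous_abs_rpow (r := 1 + r) (by linarith)).tendsto 0
      simpa [Real.zero_rpow (show 1 + r ≠ 0 by linarith)] using this
    have h2 : Tendsto (fun w : ℝ => w * |w| ^ r) (𝓝 0) (𝓝 0) := by
      refine squeeze_zero_norm (fun w => le_of_eq ?_) h1
      rcases eq_or_ne w 0 with rfl | hw
      · simp [Real.zero_rpow (show 1 + r ≠ 0 by linarith)]
      · rw [norm_mul, Real.norm_eq_abs, Real.norm_eq_abs, abs_of_nonneg (Real.rpow_nonneg (abs_nonneg w) r),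
          Real.rpow_add (abs_pos.2 hw), Real.rpow_one]
    show Tendsto _ _ (𝓝 ((0 : ℝ) * |0| ^ r))
    rwa [zero_mul]
  · exact continuousAt_id.mul (continuous_abs.continuousAt.rpow_const (Or.inl (abs_ne_zero.2 hw)))

theorem abs_sub_le_of_abs_deriv_le {F G F' G' : ℝ → ℝ} {s r : ℝ}
    (hF : ∀ x ∈ Icc s r, HasDerivAt F (F' x) x) (hG : ∀ x ∈ Icc s r, HasDerivAt G (G' x) x)
    (h : ∀ x ∈ Icc s r, |F' x| ≤ G' x) (hsr : s ≤ r) : |F r - F s| ≤ G r - G s := by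
  have key : ∀ (f f' : ℝ → ℝ), (∀ x ∈ Icc s r, HasDerivAt f (f' x) x) → (∀ x ∈ Icc s r, 0 ≤ f' x) →
      f s ≤ f r := by
    intro f f' hf hf'
    refine monotoneOn_of_deriv_nonneg (convex_Icc s r)
      (fun x hx => (hf x hx).continuousAt.continuousWithinAt)
      (fun x hx => (hf x (interior_subset hx)).differentiableAt.differentiableWithinAt)
      (fun x hx => ?_) ⟨le_rfl, hsr⟩ ⟨hsr, le_rfl⟩ hsr
    rw [(hf x (interior_subset hx)).deriv]
    exact hf' x (interior_subset hx)
  have h1 := key _ _ (fun x hx => (hG x hx).fun_sub (hF x hx)) fun x hx => by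
    have := (abs_le.1 (h x hx)).2; linarith
  have h2 := key _ _ (fun x hx => (hG x hx).fun_add (hF x hx)) fun x hx => by
    have := (abs_le.1 (h x hx)).1; linarith
  rw [abs_le]; constructor <;> linarith

/-- Change of variables: if `f' = h T'` with `T' ≥ 0` and `S` inverts `T`, then `(f ∘ S)' = h ∘ S`. -/
theorem hasDerivAt_comp_inverse {T T' f h S : ℝ → ℝ} {x₀ : ℝ} {U : Set ℝ} (hU : U ∈ 𝓝 x₀)
    (hT : ∀ s, HasDerivAt T (T' s) s) (hT' : ∀ s, 0 ≤ T' s)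
    (hf : ∀ s, HasDerivAt f (h s * T' s) s) (hh : Continuous h)
    (hTS : ∀ x ∈ U, T (S x) = x) (hS : ContinuousAt S x₀) :
    HasDerivAt (fun x => f (S x)) (h (S x₀)) x₀ := by
  rw [hasDerivAt_iff_isLittleO, Asymptotics.isLittleO_iff]
  intro ε hε
  obtain ⟨δ, hδ, hball⟩ := Metric.continuousAt_iff.1 (hh.continuousAt (x := S x₀)) ε hε
  have hev : ∀ᶠ x in 𝓝 x₀, dist (S x) (S x₀) < δ := hS (Metric.ball_mem_nhds _ hδ)
  filter_upwards [hU, hev] with x hx hxδ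
  -- T' may vanish, so S need not be differentiable and the chain rule is unavailable. Instead,
  -- between S x₀ and S x the increment of f - h(S x₀) T is dominated by that of εT.
  have hF : ∀ s, HasDerivAt (fun s => f s - h (S x₀) * T s) ((h s - h (S x₀)) * T' s) s := fun s =>
    ((hf s).fun_sub ((hT s).const_mul (h (S x₀)))).congr_deriv (by ring)
  have hG : ∀ s, HasDerivAt (fun s => ε * T s) (ε * T' s) s := fun s => (hT s).const_mul ε
  have hb : ∀ s, dist s (S x₀) ≤ dist (S x) (S x₀) → |(h s - h (S x₀)) * T' s| ≤ ε * T' s := by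
    intro s hs
    rw [abs_mul, abs_of_nonneg (hT' s)]
    have := hball (lt_of_le_of_lt hs hxδ)
    rw [Real.dist_eq] at this
    exact mul_le_mul_of_nonneg_right this.le (hT' s)
  have e1 := hTS x hx
  have e2 := hTS x₀ (mem_of_mem_nhds hU)
  rw [Real.norm_eq_abs, Real.norm_eq_abs, smul_eq_mul]
  rcases le_total (S x₀) (S x) with hle | hle
  · have := abs_sub_le_of_abs_deriv_le (fun s _ => hF s) (fun s _ => hG s) (fun s hs => hb s (by
      rw [Real.dist_eq, Real.dist_eq, abs_of_nonneg (by linarith [hs.1]),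
        abs_of_nonneg (by linarith)]
      linarith [hs.2])) hle
    rw [e1, e2] at this
    calc _ = |f (S x) - h (S x₀) * x - (f (S x₀) - h (S x₀) * x₀)| := by congr 1; ring
      _ ≤ ε * x - ε * x₀ := this
      _ ≤ ε * |x - x₀| := by rw [← mul_sub]; exact mul_le_mul_of_nonneg_left (le_abs_self _) hε.le
  · have := abs_sub_le_of_abs_deriv_le (fun s _ => hF s) (fun s _ => hG s) (fun s hs => hb s (by
      rw [Real.dist_eq, Real.dist_eq, abs_of_nonpos (by linarith [hs.2]),
        abs_of_nonpos (by linarith)]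
      linarith [hs.1])) hle
    rw [e1, e2] at this
    calc _ = |f (S x₀) - h (S x₀) * x₀ - (f (S x) - h (S x₀) * x)| := by
          rw [abs_sub_comm]; congr 1; ring
      _ ≤ ε * x₀ - ε * x := this
      _ ≤ ε * |x - x₀| := by
          rw [← mul_sub, abs_sub_comm]; exact mul_le_mul_of_nonneg_left (le_abs_self _) hε.le

variable {b c q a : ℝ} {y p t : ℝ → ℝ}
namespace IsShootingOrbit

/-- On an interval of constancy of t the function y would vanish, hence so would its derivative and
with it p, which `sq_add_sq_pos` excludes. -/
theorem strictMono_t (h : IsShootingOrbit b c q a y p t) (hb : 0 < b) (hc : 0 < c) (hq : 0 < q)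
    (ha : 0 < a) : StrictMono t := by
  refine (h.monotone_t hq).strictMono_of_injective ?_
  have key : ∀ s₁ s₂, s₁ < s₂ → t s₁ ≠ t s₂ := by
    intro s₁ s₂ hlt heq
    have hconst : ∀ s ∈ Ioo s₁ s₂, t s = t s₁ := fun s hs =>
      le_antisymm (heq ▸ h.monotone_t hq hs.2.le) (h.monotone_t hq hs.1.le)
    have hy : ∀ s ∈ Ioo s₁ s₂, y s = 0 := by
      intro s hs
      have hev : t =ᶠ[𝓝 s] fun _ => t s₁ := by
        filter_upwards [isOpen_Ioo.mem_nhds hs] with r hr using hconst r hr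
      have h1 := (h.hasDerivAt_t s).unique ((hasDerivAt_const s (t s₁)).congr_of_eventuallyEq hev)
      have h2 := (mul_eq_zero.1 h1).resolve_left (shootSpeed_pos _ _ _).ne'
      have h3 := (mul_eq_zero.1 h2).resolve_left (h.one_sub_sq_pos hq s).ne'
      exact pow_eq_zero_iff two_ne_zero |>.1 h3
    obtain ⟨s, hs⟩ := nonempty_Ioo.2 hlt
    have hev : y =ᶠ[𝓝 s] fun _ => 0 := by
      filter_upwards [isOpen_Ioo.mem_nhds hs] with r hr using hy r hr
    have h1 := (h.hasDerivAt_y s).unique ((hasDerivAt_const s (0 : ℝ)).congr_of_eventuallyEq hev)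
    have h2 := (mul_eq_zero.1 h1).resolve_left (shootSpeed_pos _ _ _).ne'
    have h3 := (mul_eq_zero.1 ((div_eq_zero_iff.1 h2).resolve_right (by norm_num))).resolve_left
      (h.one_sub_sq_pos hq s).ne'
    have := h.sq_add_sq_pos hb.le hc.le hq ha s
    rw [hy s hs, h3] at this
    simp at this
  intro s₁ s₂ heq
  by_contra hne
  rcases lt_or_gt_of_ne hne with hlt | hlt
  · exact key _ _ hlt heq
  · exact key _ _ hlt heq.symm

/-- The inverse of the time variable. -/
theorem exists_inverse (h : IsShootingOrbit b c q a y p t) (hb : 0 < b) (hc : 0 < c) (hq : 0 < q)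
    (ha : 0 < a) : ∃ S : ℝ → ℝ, (∀ s, S (t s) = s) ∧ (∀ x ∈ Ioo (-1 : ℝ) 1, t (S x) = x) ∧
      (∀ x ∈ Ioo (-1 : ℝ) 1, ContinuousAt S x) := by
  have hmem : ∀ s, t s ∈ Ioo (-1 : ℝ) 1 := fun s => abs_lt.1 (h.abs_t_lt_one hq s)
  have hmono : StrictMono fun s => (⟨t s, hmem s⟩ : Ioo (-1 : ℝ) 1) := fun r s hrs =>
    h.strictMono_t hb hc hq ha hrs
  have hsurj : Function.Surjective fun s => (⟨t s, hmem s⟩ : Ioo (-1 : ℝ) 1) := by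
    rintro ⟨x, hx⟩
    -- The variable t exceeds x at a positive time and, by oddness, falls below x at a negative one.
    obtain ⟨s₁, h1, h2⟩ := h.exists_lt_t hb hc.le hq ha hx.2
    obtain ⟨s₂, h3, h4⟩ := h.exists_lt_t hb hc.le hq ha (η := -x) (by linarith [hx.1])
    have h5 := (h.odd hq s₂).2.2
    obtain ⟨s, hs, hs'⟩ := intermediate_value_Icc (show -s₂ ≤ s₁ by linarith)
      h.continuous_t.continuousOn (show x ∈ Icc _ _ by
        rw [h5]; exact ⟨by linarith, h2.le⟩)
    exact ⟨s, Subtype.ext hs'⟩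
  let e : ℝ ≃o Ioo (-1 : ℝ) 1 := StrictMono.orderIsoOfSurjective _ hmono hsurj
  have he : ∀ s, (e s : ℝ) = t s := fun s => rfl
  classical
  refine ⟨fun x => if hx : x ∈ Ioo (-1 : ℝ) 1 then e.symm ⟨x, hx⟩ else 0, fun s => ?_,
    fun x hx => ?_, fun x hx => ?_⟩
  · simp only [hmem s, dif_pos]
    exact e.symm_apply_apply s
  · simp only [hx, dif_pos]
    rw [← he, e.apply_symm_apply]
  · have hcont : ContinuousOn (fun x => if hx : x ∈ Ioo (-1 : ℝ) 1 then e.symm ⟨x, hx⟩ else 0)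
        (Ioo (-1 : ℝ) 1) := by
      rw [continuousOn_iff_continuous_domRestrict]
      refine e.symm.continuous.congr fun z => ?_
      show e.symm z = if h : z.1 ∈ Ioo (-1 : ℝ) 1 then e.symm ⟨z.1, h⟩ else 0
      rw [dif_pos z.2]
    exact hcont.continuousAt (isOpen_Ioo.mem_nhds hx)

end IsShootingOrbit

theorem hasDerivAt_one_sub_rpow {T : ℝ → ℝ} {T' s σ : ℝ} (hT : HasDerivAt T T' s) (h1 : T s < 1)
    (hσ : 0 < σ) : HasDerivAt (fun s => -(1 / σ * (1 - T s) ^ σ)) (T' * (1 - T s) ^ (σ - 1)) s := by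
  refine (((hT.const_sub 1).rpow_const (p := σ) (Or.inl (by linarith))).const_mul (1 / σ)
    |>.fun_neg).congr_deriv ?_
  field_simp

namespace IsShootingOrbit

/-- On a trajectory with `w → 0` the slope converges. -/
theorem exists_tendsto_p (h : IsShootingOrbit b c q a y p t) (hb : 0 < b) (hc : 0 < c) (hq : 1 < q)
    (ha : 0 < a) (hy : ∀ s, 0 ≤ s → |y s ^ 3| ≤ 2 * a * Real.sqrt (1 - t s)) :
    ∃ p₁, Tendsto p atTop (𝓝 p₁) := by
  have hq0 : 0 < q := by linarith
  have ht1 : ∀ s, t s < 1 := fun s => (abs_lt.1 (h.abs_t_lt_one hq0 s)).2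
  -- The hypothesis on y³ gives |y|^(q-1) ≤ (2a)^((q-1)/3) (1 - t)^σ. The exponent σ is positive
  -- because q > 1, so (1 - t)^(σ-1) is integrable up to t = 1.
  set σ := (q - 1) / 6 with hσ
  have hσ0 : 0 < σ := by rw [hσ]; linarith
  set c₁ := b * (2 * a) with hc₁
  set c₂ := c * (2 * a) ^ ((q - 1) / 3) with hc₂
  have hc₁0 : 0 < c₁ := by positivity
  have hc₂0 : 0 < c₂ := by positivity
  -- A primitive along the orbit of the bound for |p'|. It is nonpositive and tends to 0 as t → 1,
  -- so |p r - p s| ≤ -G s is a Cauchy estimate.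
  set G : ℝ → ℝ := fun s => c₁ * -(1 / (1 / 2) * (1 - t s) ^ (1 / 2 : ℝ)) +
    c₂ * -(1 / σ * (1 - t s) ^ σ) with hG
  set T' : ℝ → ℝ := fun s => shootSpeed b c q (y s) (p s) (t s) * ((1 - t s ^ 2) * y s ^ 2) with hT'
  have hGd : ∀ s, HasDerivAt G (c₁ * (T' s * (1 - t s) ^ (1 / 2 - 1 : ℝ)) +
      c₂ * (T' s * (1 - t s) ^ (σ - 1))) s := fun s =>
    ((hasDerivAt_one_sub_rpow (h.hasDerivAt_t s) (ht1 s) (by norm_num)).const_mul c₁).fun_add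
      ((hasDerivAt_one_sub_rpow (h.hasDerivAt_t s) (ht1 s) hσ0).const_mul c₂)
  have hbound : ∀ s, 0 ≤ s → |shootSpeed b c q (y s) (p s) (t s) * -shootForce b c q (y s)| ≤
      c₁ * (T' s * (1 - t s) ^ (1 / 2 - 1 : ℝ)) + c₂ * (T' s * (1 - t s) ^ (σ - 1)) := by
    intro s hs
    have hpos : 0 < 1 - t s := by linarith [ht1 s]
    have ht0 := h.t_nonneg hq0 hs
    have hm := shootSpeed_pos (b := b) (c := c) (q := q) (y s) (p s) (t s)
    have hys : |y s| ^ 3 ≤ 2 * a * Real.sqrt (1 - t s) := by rw [← abs_pow]; exact hy s hs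
    have hT1 : ∀ τ : ℝ, shootSpeed b c q (y s) (p s) (t s) * y s ^ 2 * (1 - t s) ^ τ ≤
        T' s * (1 - t s) ^ (τ - 1) := by
      intro τ
      rw [Real.rpow_sub_one hpos.ne', hT']
      have h2 : 0 ≤ shootSpeed b c q (y s) (p s) (t s) * y s ^ 2 * (1 - t s) ^ τ := by positivity
      have h3 : shootSpeed b c q (y s) (p s) (t s) * ((1 - t s ^ 2) * y s ^ 2) *
          ((1 - t s) ^ τ / (1 - t s)) = (1 + t s) *
            (shootSpeed b c q (y s) (p s) (t s) * y s ^ 2 * (1 - t s) ^ τ) := by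
        field_simp; ring
      rw [h3]
      nlinarith
    have hF : |shootForce b c q (y s)| ≤ y s ^ 2 * (b * |y s| ^ 3 + c * |y s| ^ (q - 1)) := by
      rw [shootForce]
      refine (abs_add_le _ _).trans (le_of_eq ?_)
      rw [abs_mul, abs_mul, abs_mul, abs_of_pos hb, abs_of_pos hc, abs_pow, ← sq_abs (y s),
        abs_of_nonneg (Real.rpow_nonneg (abs_nonneg _) _)]
      have : |y s| * |y s| ^ q = |y s| ^ 2 * |y s| ^ (q - 1) := by
        rcases eq_or_ne (y s) 0 with h0 | h0
        · simp [h0]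
        · rw [← Real.rpow_natCast, ← Real.rpow_add (abs_pos.2 h0), mul_comm,
            ← Real.rpow_add_one (abs_ne_zero.2 h0)]
          congr 1; push_cast; ring
      rw [this]; ring
    have hq1 : |y s| ^ (q - 1) ≤ (2 * a) ^ ((q - 1) / 3) * (1 - t s) ^ σ := by
      have e1 : |y s| ^ (q - 1) = (|y s| ^ 3) ^ ((q - 1) / 3) := by
        rw [← Real.rpow_natCast, ← Real.rpow_mul (abs_nonneg _)]
        congr 1; push_cast; ring
      have e2 : (1 - t s) ^ σ = (Real.sqrt (1 - t s)) ^ ((q - 1) / 3) := by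
        rw [Real.sqrt_eq_rpow, ← Real.rpow_mul hpos.le, hσ]
        congr 1; ring
      rw [e1, e2, ← Real.mul_rpow (by positivity) (by positivity)]
      exact Real.rpow_le_rpow (by positivity) hys (by linarith)
    have hq3 : |y s| ^ 3 ≤ 2 * a * (1 - t s) ^ (1 / 2 : ℝ) := by rwa [← Real.sqrt_eq_rpow]
    rw [abs_mul, abs_neg, abs_of_pos hm]
    calc shootSpeed b c q (y s) (p s) (t s) * |shootForce b c q (y s)|
        ≤ shootSpeed b c q (y s) (p s) (t s) * (y s ^ 2 * (b * (2 * a * (1 - t s) ^ (1 / 2 : ℝ)) +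
          c * ((2 * a) ^ ((q - 1) / 3) * (1 - t s) ^ σ))) := by
          refine mul_le_mul_of_nonneg_left (hF.trans ?_) hm.le
          gcongr
      _ = c₁ * (shootSpeed b c q (y s) (p s) (t s) * y s ^ 2 * (1 - t s) ^ (1 / 2 : ℝ)) +
          c₂ * (shootSpeed b c q (y s) (p s) (t s) * y s ^ 2 * (1 - t s) ^ σ) := by
          rw [hc₁, hc₂]; ring
      _ ≤ _ := add_le_add (mul_le_mul_of_nonneg_left (hT1 _) hc₁0.le)
          (mul_le_mul_of_nonneg_left (hT1 _) hc₂0.le)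
  have hGneg : ∀ s, G s ≤ 0 := by
    intro s
    have hpos : 0 < 1 - t s := by linarith [ht1 s]
    have h1 : 0 ≤ c₁ * (1 / (1 / 2) * (1 - t s) ^ (1 / 2 : ℝ)) := by positivity
    have h2 : 0 ≤ c₂ * (1 / σ * (1 - t s) ^ σ) := by positivity
    simp only [hG]
    linarith
  have hdiff : ∀ s r, 0 ≤ s → s ≤ r → |p r - p s| ≤ -G s := by
    intro s r hs hsr
    have := abs_sub_le_of_abs_deriv_le (fun x _ => h.hasDerivAt_p x) (fun x _ => hGd x)
      (fun x hx => hbound x (hs.trans hx.1)) hsr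
    linarith [hGneg r]
  have htt : Tendsto t atTop (𝓝 1) := by
    rw [tendsto_order]
    refine ⟨fun x hx => ?_, fun x hx => Eventually.of_forall fun s => (ht1 s).trans hx⟩
    obtain ⟨s, hs, hts⟩ := h.exists_lt_t hb hc.le hq0 ha hx
    filter_upwards [eventually_ge_atTop s] with r hr using hts.trans_le (h.monotone_t hq0 hr)
  have hG0 : Tendsto G atTop (𝓝 0) := by
    have h1 : Tendsto (fun s => 1 - t s) atTop (𝓝 0) := by
      simpa using htt.const_sub 1
    have h2 : ∀ τ : ℝ, 0 < τ → Tendsto (fun s => (1 - t s) ^ τ) atTop (𝓝 0) := by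
      intro τ hτ
      simpa [Real.zero_rpow hτ.ne'] using h1.rpow_const (p := τ) (Or.inr hτ.le)
    have h3 := ((((h2 (1 / 2) (by norm_num)).const_mul (1 / (1 / 2))).neg.const_mul c₁).add
      (((h2 σ hσ0).const_mul (1 / σ)).neg.const_mul c₂))
    have h4 : Tendsto G atTop (𝓝 (c₁ * -(1 / (1 / 2) * 0) + c₂ * -(1 / σ * 0))) := h3
    rwa [mul_zero, mul_zero, neg_zero, mul_zero, mul_zero, add_zero] at h4
  have hcauchy : CauchySeq fun s => p (max s 0) := by
    refine cauchySeq_of_le_tendsto_0 (fun N => 2 * -G (max N 0)) (fun n m N hn hm => ?_) ?_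
    · have h1 := hdiff (max N 0) (max n 0) (le_max_right _ _) (max_le_max_right 0 hn)
      have h2 := hdiff (max N 0) (max m 0) (le_max_right _ _) (max_le_max_right 0 hm)
      rw [Real.dist_eq]
      rw [abs_sub_comm] at h2
      calc |p (max n 0) - p (max m 0)| ≤ _ := abs_sub_le _ (p (max N 0)) _
        _ ≤ _ := by linarith
    · have : Tendsto (fun N : ℝ => max N 0) atTop atTop :=
        tendsto_atTop_mono (fun N => le_max_left N 0) tendsto_id
      simpa using ((hG0.comp this).neg.const_mul 2)
  obtain ⟨p₁, hp₁⟩ := cauchySeq_tendsto_of_complete hcauchy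
  refine ⟨p₁, hp₁.congr' ?_⟩
  filter_upwards [eventually_ge_atTop 0] with s hs
  rw [max_eq_left hs]

end IsShootingOrbit

/-! ### The profile. -/

/-- A nontrivial solution `w` of the Dirichlet problem with `C = 1`, with derivative `w₁`. -/
structure IsProfile (β : ℝ) (w w₁ : ℝ → ℝ) : Prop where
  hasDerivWithinAt : ∀ t ∈ Icc (-1 : ℝ) 1, HasDerivWithinAt w (w₁ t) (Icc (-1) 1) t
  continuousOn : ContinuousOn w₁ (Icc (-1) 1)
  equation : ∀ t ∈ Ioo (-1 : ℝ) 1, HasDerivAt w₁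
    (-(β * (β + 1) * w t + (1 + 1 / β) * (w t * |w t| ^ (2 / β))) / (1 - t ^ 2)) t
  boundary_right : w 1 = 0
  boundary_left : w (-1) = 0
  nontrivial : ∃ t ∈ Ioo (-1 : ℝ) 1, w t ≠ 0

/-- Both ranges of β give β(β + 1) > 0, 1 + 1/β > 0 and 2/β > -1. With w = y³ the nonlinearity
becomes y² w|w|^(2/β) = y|y|^q for q = 4 + 6/β. The condition β < -2 then reads q > 1, and q = 4 is
never attained. -/
theorem exists_isProfile {β : ℝ} (hβ : 0 < β ∨ β < -2) : ∃ w w₁, IsProfile β w w₁ := by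
  have hβ0 : β ≠ 0 := by rcases hβ with h | h <;> linarith
  have hb : 0 < β * (β + 1) := by
    rcases hβ with h | h
    · positivity
    · nlinarith
  have hr : -1 < 2 / β := by
    rcases hβ with h | h
    · have : 0 < 2 / β := by positivity
      linarith
    · rw [lt_div_iff_of_neg (by linarith)]; linarith
  have hc : 0 < 1 + 1 / β := by
    have : 1 / β = 2 / β / 2 := by ring
    linarith
  set q := 4 + 6 / β with hqdef
  have hq : 1 < q := by
    have : 6 / β = 3 * (2 / β) := by ring
    rw [hqdef]; linarith
  have hq0 : 0 < q := by linarith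
  have hq4 : q ≠ 4 := by
    rw [hqdef]
    have : 6 / β ≠ 0 := div_ne_zero (by norm_num) hβ0
    intro h; apply this; linarith
  obtain ⟨a, ha, y, p, t, h, hy⟩ := exists_shootingOrbit_tendsto_zero hb hc hq0 hq4
  obtain ⟨p₁, hp₁⟩ := h.exists_tendsto_p hb hc hq ha hy
  obtain ⟨S, hSt, htS, hSc⟩ := h.exists_inverse hb hc hq0 ha
  classical
  set I : Set ℝ := Ioo (-1 : ℝ) 1 with hI
  set w : ℝ → ℝ := fun x => if x ∈ I then y (S x) ^ 3 else 0 with hw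
  set w₁ : ℝ → ℝ := fun x => if x ∈ I then p (S x) else p₁ with hw₁
  have hwI : ∀ x ∈ I, w x = y (S x) ^ 3 := fun x hx => if_pos hx
  have hw₁I : ∀ x ∈ I, w₁ x = p (S x) := fun x hx => if_pos hx
  have hInhds : ∀ x ∈ I, I ∈ 𝓝 x := fun x hx => isOpen_Ioo.mem_nhds hx
  have hT' : ∀ s, 0 ≤ shootSpeed (β * (β + 1)) (1 + 1 / β) q (y s) (p s) (t s) *
      ((1 - t s ^ 2) * y s ^ 2) := fun s =>
    mul_nonneg (shootSpeed_pos _ _ _).le (mul_nonneg (h.one_sub_sq_pos hq0 s).le (sq_nonneg _))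
  have hwd : ∀ x ∈ I, HasDerivAt w (w₁ x) x := by
    intro x hx
    rw [hw₁I x hx]
    refine (hasDerivAt_comp_inverse (hInhds x hx) h.hasDerivAt_t hT' h.hasDerivAt_cube
      h.continuous_p htS (hSc x hx)).congr_of_eventuallyEq ?_
    filter_upwards [hInhds x hx] with z hz using hwI z hz
  have hforce : ∀ z : ℝ, shootForce (β * (β + 1)) (1 + 1 / β) q z
      = z ^ 2 * (β * (β + 1) * z ^ 3 + (1 + 1 / β) * (z ^ 3 * |z ^ 3| ^ (2 / β))) := by
    intro z
    rw [shootForce]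
    have : z * |z| ^ q = z ^ 5 * |z ^ 3| ^ (2 / β) := by
      rcases eq_or_ne z 0 with rfl | hz
      · rw [zero_mul, zero_pow (by norm_num), zero_mul]
      · have e1 : |z| ^ q = |z| ^ 4 * |z| ^ (6 / β) := by
          rw [hqdef, Real.rpow_add (abs_pos.2 hz)]
          congr 1; exact_mod_cast Real.rpow_natCast |z| 4
        have e2 : |z ^ 3| ^ (2 / β) = |z| ^ (6 / β) := by
          rw [abs_pow, ← Real.rpow_natCast, ← Real.rpow_mul (abs_nonneg _)]
          congr 1; push_cast; ring
        rw [e1, e2, Even.pow_abs (by decide)]; ring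
    rw [this]; ring
  have hw₁d : ∀ x ∈ I, HasDerivAt w₁
      (-(β * (β + 1) * w x + (1 + 1 / β) * (w x * |w x| ^ (2 / β))) / (1 - x ^ 2)) x := by
    intro x hx
    have hh : Continuous fun s => -(β * (β + 1) * y s ^ 3 +
        (1 + 1 / β) * (y s ^ 3 * |y s ^ 3| ^ (2 / β))) / (1 - t s ^ 2) := by
      have h1 := (continuous_mul_abs_rpow hr).comp (h.continuous_y.pow 3)
      have h2 := h.continuous_y
      have h3 := h.continuous_t
      simp only [Function.comp_def] at h1
      exact Continuous.div (by fun_prop) (by fun_prop) fun s => (h.one_sub_sq_pos hq0 s).ne'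
    have hd := hasDerivAt_comp_inverse (hInhds x hx) h.hasDerivAt_t hT' (f := p) (fun s => by
      refine (h.hasDerivAt_p s).congr_deriv ?_
      have := (h.one_sub_sq_pos hq0 s).ne'
      rw [hforce]
      field_simp) hh htS (hSc x hx)
    rw [htS x hx, ← hwI x hx] at hd
    refine hd.congr_of_eventuallyEq ?_
    filter_upwards [hInhds x hx] with z hz using hw₁I z hz
  have hStend : Tendsto S (𝓝[<] 1) atTop := by
    rw [tendsto_atTop]
    intro s
    have h1 : Ioo (t s) 1 ∈ 𝓝[<] (1 : ℝ) :=
      Ioo_mem_nhdsLT (abs_lt.1 (h.abs_t_lt_one hq0 s)).2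
    filter_upwards [h1] with x hx
    have hxI : x ∈ I := ⟨(abs_lt.1 (h.abs_t_lt_one hq0 s)).1.trans hx.1, hx.2⟩
    refine ((h.strictMono_t hb hc hq0 ha).lt_iff_lt.1 ?_).le
    rw [htS x hxI]; exact hx.1
  have hIlt : I ∈ 𝓝[<] (1 : ℝ) := Ioo_mem_nhdsLT (by norm_num)
  have hw₁tend : Tendsto w₁ (𝓝[<] 1) (𝓝 p₁) := by
    refine (hp₁.comp hStend).congr' ?_
    filter_upwards [hIlt] with x hx using (hw₁I x hx).symm
  have hw1 : w 1 = 0 := if_neg (by simp [hI])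
  have hwm1 : w (-1) = 0 := if_neg (by simp [hI])
  have hw₁1 : w₁ 1 = p₁ := if_neg (by simp [hI])
  have hwtend : Tendsto w (𝓝[<] 1) (𝓝 0) := by
    have h1 : Tendsto (fun x : ℝ => 2 * a * Real.sqrt (1 - x)) (𝓝[<] 1) (𝓝 0) := by
      have : Continuous fun x : ℝ => 2 * a * Real.sqrt (1 - x) := by fun_prop
      have := (this.tendsto 1).mono_left (nhdsWithin_le_nhds (s := Iio 1))
      simpa using this
    refine squeeze_zero_norm' ?_ h1
    filter_upwards [hIlt, hStend.eventually_ge_atTop 0] with x hx hx0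
    rw [hwI x hx, Real.norm_eq_abs]
    have := hy (S x) hx0
    rwa [htS x hx] at this
  -- Oddness of the orbit carries the analysis at t = 1 over to t = -1.
  have hwodd : ∀ x, w (-x) = -w x ∧ w₁ (-x) = w₁ x := by
    intro x
    by_cases hx : x ∈ I
    · have hx' : -x ∈ I := ⟨by linarith [hx.2], by linarith [hx.1]⟩
      have hS : S (-x) = -S x := by
        apply (h.strictMono_t hb hc hq0 ha).injective
        rw [htS _ hx', (h.odd hq0 _).2.2, htS _ hx]
      rw [hwI x hx, hwI _ hx', hw₁I x hx, hw₁I _ hx', hS, (h.odd hq0 _).1, (h.odd hq0 _).2.1]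
      exact ⟨by ring, rfl⟩
    · have hx' : -x ∉ I := fun h => hx ⟨by linarith [h.2], by linarith [h.1]⟩
      simp [hw, hw₁, hx, hx']
  have hd1 : HasDerivWithinAt w (w₁ 1) (Icc (-1) 1) 1 := by
    rw [hw₁1]
    refine (hasDerivWithinAt_Iic_of_tendsto_deriv (s := I)
      (fun x hx => (hwd x hx).differentiableAt.differentiableWithinAt) ?_ hIlt ?_).mono
      Icc_subset_Iic_self
    · rw [ContinuousWithinAt, hw1]
      exact hwtend.mono_left (nhdsWithin_mono _ fun x hx => hx.2)
    · refine hw₁tend.congr' ?_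
      filter_upwards [hIlt] with x hx using (hwd x hx).deriv.symm
  have hc1 : ContinuousWithinAt w₁ (Icc (-1) 1) 1 := by
    have h1 : ContinuousWithinAt w₁ (Iio 1) 1 := by rwa [ContinuousWithinAt, hw₁1]
    have h2 : ContinuousWithinAt w₁ (Iic 1) 1 := by rwa [← continuousWithinAt_Iio_iff_Iic]
    exact h2.mono Icc_subset_Iic_self
  have hmaps : MapsTo (fun x : ℝ => -x) (Icc (-1) 1) (Icc (-1) 1) := fun x hx =>
    ⟨by linarith [hx.2], by linarith [hx.1]⟩
  have hcases : ∀ x ∈ Icc (-1 : ℝ) 1, x ∈ I ∨ x = 1 ∨ x = -1 := by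
    intro x hx
    rcases eq_or_lt_of_le hx.1 with h1 | h1
    · exact Or.inr (Or.inr h1.symm)
    rcases eq_or_lt_of_le hx.2 with h2 | h2
    · exact Or.inr (Or.inl h2)
    · exact Or.inl ⟨h1, h2⟩
  refine ⟨w, w₁, ⟨fun x hx => ?_, fun x hx => ?_, hw₁d, hw1, hwm1, ?_⟩⟩
  · rcases hcases x hx with hx | rfl | rfl
    · exact (hwd x hx).hasDerivWithinAt
    · exact hd1
    · have e : HasDerivWithinAt w (w₁ 1) (Icc (-1) 1) (-(-1 : ℝ)) := by rw [neg_neg]; exact hd1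
      have h1 := (HasDerivWithinAt.scomp (-1 : ℝ) e (hasDerivAt_neg (-1 : ℝ)).hasDerivWithinAt hmaps).fun_neg
      rw [(hwodd 1).2]
      refine (h1.congr_deriv (by simp)).congr (fun z _ => ?_) ?_
      · simp [(hwodd z).1]
      · simp [(hwodd 1).1]
  · rcases hcases x hx with hx | rfl | rfl
    · exact (hw₁d x hx).continuousAt.continuousWithinAt
    · exact hc1
    · have e : ContinuousWithinAt w₁ (Icc (-1) 1) (-(-1 : ℝ)) := by rw [neg_neg]; exact hc1
      have h1 := ContinuousWithinAt.comp (f := fun x : ℝ => -x) (x := (-1 : ℝ)) e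
        continuous_neg.continuousWithinAt hmaps
      exact h1.congr (fun z _ => ((hwodd z).2).symm) ((hwodd (-1)).2).symm
  -- The profile is nontrivial because its slope at 0 is a > 0.
  · by_contra! hcon
    have h0 : (0 : ℝ) ∈ I := ⟨by norm_num, by norm_num⟩
    have hev : w =ᶠ[𝓝 0] fun _ => 0 := by
      filter_upwards [hInhds 0 h0] with x hx using hcon x hx
    have := (hwd 0 h0).unique ((hasDerivAt_const (0 : ℝ) (0 : ℝ)).congr_of_eventuallyEq hev)
    rw [hw₁I 0 h0] at this
    have hS0 : S 0 = 0 := by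
      have := hSt 0
      rwa [h.t_zero] at this
    rw [hS0, h.p_zero] at this
    exact ha.ne' this

/-! ### Axisymmetric fields -/

/-- The square of the distance to the axis. -/
noncomputable def radiusSq (x : Space3) : ℝ := x 0 ^ 2 + x 1 ^ 2

/-- The cosine of the polar angle. -/
noncomputable def cosPolar (x : Space3) : ℝ := x 2 / ‖x‖

/-- The field `r e_r`. -/
noncomputable def horizontal : Space3 →L[ℝ] Space3 :=
  (EuclideanSpace.proj 0 : Space3 →L[ℝ] ℝ).smulRight (EuclideanSpace.single 0 1) +
    (EuclideanSpace.proj 1 : Space3 →L[ℝ] ℝ).smulRight (EuclideanSpace.single 1 1)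

/-- The field `r e_φ`. -/
noncomputable def angular : Space3 →L[ℝ] Space3 :=
  (EuclideanSpace.proj 0 : Space3 →L[ℝ] ℝ).smulRight (EuclideanSpace.single 1 1) -
    (EuclideanSpace.proj 1 : Space3 →L[ℝ] ℝ).smulRight (EuclideanSpace.single 0 1)

theorem horizontal_apply (x : Space3) : horizontal x = !₂[x 0, x 1, 0] := by
  ext i; fin_cases i <;> simp [horizontal]

theorem angular_apply (x : Space3) : angular x = !₂[-x 1, x 0, 0] := by
  ext i; fin_cases i <;> simp [angular]

@[simp] theorem horizontal_zero (x : Space3) : horizontal x 0 = x 0 := by simp [horizontal_apply]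
@[simp] theorem horizontal_one (x : Space3) : horizontal x 1 = x 1 := by simp [horizontal_apply]
@[simp] theorem horizontal_two (x : Space3) : horizontal x 2 = 0 := by simp [horizontal_apply]
@[simp] theorem angular_zero (x : Space3) : angular x 0 = -x 1 := by simp [angular_apply]
@[simp] theorem angular_one (x : Space3) : angular x 1 = x 0 := by simp [angular_apply]
@[simp] theorem angular_two (x : Space3) : angular x 2 = 0 := by simp [angular_apply]
@[simp] theorem eZ_zero : eZ 0 = 0 := by simp [eZ]
@[simp] theorem eZ_one : eZ 1 = 0 := by simp [eZ]
@[simp] theorem eZ_two : eZ 2 = 1 := by simp [eZ]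

theorem radiusSq_nonneg (x : Space3) : 0 ≤ radiusSq x := by unfold radiusSq; positivity

theorem cylRadius_sq (x : Space3) : cylRadius x ^ 2 = radiusSq x :=
  Real.sq_sqrt (radiusSq_nonneg x)

theorem mem_zAxis_iff (x : Space3) : x ∈ zAxis ↔ radiusSq x = 0 := by
  rw [← cylRadius_sq, sq_eq_zero_iff]; rfl

theorem notMem_zAxis_iff (x : Space3) : x ∉ zAxis ↔ 0 < radiusSq x := by
  rw [mem_zAxis_iff]
  exact ⟨fun h => lt_of_le_of_ne (radiusSq_nonneg x) (Ne.symm h), fun h => h.ne'⟩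

theorem continuous_radiusSq : Continuous radiusSq := by unfold radiusSq; fun_prop

theorem isOpen_compl_zAxis : IsOpen (zAxisᶜ : Set Space3) := by
  have : (zAxisᶜ : Set Space3) = {x | 0 < radiusSq x} := by
    ext x; exact notMem_zAxis_iff x
  rw [this]
  exact isOpen_lt continuous_const continuous_radiusSq

theorem ne_zero_of_notMem_zAxis {x : Space3} (hx : x ∉ zAxis) : x ≠ 0 := by
  rintro rfl
  exact hx ((mem_zAxis_iff 0).2 (by simp [radiusSq]))

theorem radiusSq_add (x : Space3) : radiusSq x + x 2 ^ 2 = ‖x‖ ^ 2 := by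
  rw [normsq_eq_sum, radiusSq]

theorem cosPolar_mul_norm {x : Space3} (hx : x ≠ 0) : cosPolar x * ‖x‖ = x 2 :=
  div_mul_cancel₀ _ (norm_ne_zero_iff.2 hx)

theorem radiusSq_eq {x : Space3} (hx : x ≠ 0) : radiusSq x = ‖x‖ ^ 2 * (1 - cosPolar x ^ 2) := by
  have h1 := radiusSq_add x
  rw [← cosPolar_mul_norm hx] at h1
  linear_combination h1

theorem cosPolar_mem_Icc (x : Space3) : cosPolar x ∈ Icc (-1 : ℝ) 1 := by
  rcases eq_or_ne x 0 with rfl | hx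
  · simp [cosPolar]
  · have h1 := radiusSq_eq hx
    have h2 := radiusSq_nonneg x
    have h3 : 0 < ‖x‖ ^ 2 := by positivity
    have : 0 ≤ 1 - cosPolar x ^ 2 := by
      by_contra hc
      rw [not_le] at hc
      nlinarith
    exact abs_le.1 (by rw [← sq_le_one_iff_abs_le_one]; linarith)

theorem cosPolar_mem_Ioo {x : Space3} (hx : x ∉ zAxis) : cosPolar x ∈ Ioo (-1 : ℝ) 1 := by
  have hx0 := ne_zero_of_notMem_zAxis hx
  have h1 := radiusSq_eq hx0
  have h2 := (notMem_zAxis_iff x).1 hx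
  rw [h1] at h2
  have := pos_of_mul_pos_right h2 (by positivity)
  exact abs_lt.1 (by rw [← sq_lt_one_iff_abs_lt_one]; linarith)

theorem one_sub_cosPolar_sq_pos {x : Space3} (hx : x ∉ zAxis) : 0 < 1 - cosPolar x ^ 2 := by
  have := abs_lt.2 (cosPolar_mem_Ioo hx)
  rw [← sq_lt_one_iff_abs_lt_one] at this
  linarith

theorem hasFDerivAt_norm_of_ne_zero {x : Space3} (hx : x ≠ 0) :
    HasFDerivAt (fun y : Space3 => ‖y‖) (‖x‖⁻¹ • innerSL ℝ x) x := by
  have h1 := (hasStrictFDerivAt_norm_sq x).hasFDerivAt.sqrt (pow_ne_zero 2 (norm_ne_zero_iff.2 hx))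
  have e : (fun y : Space3 => √(‖y‖ ^ 2)) = fun y => ‖y‖ := by
    funext y; exact Real.sqrt_sq (norm_nonneg y)
  rw [e, Real.sqrt_sq (norm_nonneg x)] at h1
  refine h1.congr_fderiv ?_
  ext v
  have := norm_ne_zero_iff.2 hx
  simp
  field_simp

/-- The gradient of the cosine of the polar angle. -/
noncomputable def gradCosPolar (x : Space3) : Space3 := ‖x‖⁻¹ • (eZ - (cosPolar x / ‖x‖) • x)

theorem inner_eZ (x : Space3) : inner ℝ eZ x = x 2 := by simp [inner_eq_sum]

theorem hasFDerivAt_cosPolar {x : Space3} (hx : x ≠ 0) :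
    HasFDerivAt cosPolar (innerSL ℝ (gradCosPolar x)) x := by
  have hn := norm_ne_zero_iff.2 hx
  have h1 : HasFDerivAt (fun y : Space3 => y 2) (EuclideanSpace.proj 2 : Space3 →L[ℝ] ℝ) x :=
    (EuclideanSpace.proj 2 : Space3 →L[ℝ] ℝ).hasFDerivAt
  have h2 := h1.mul ((hasDerivAt_inv hn).comp_hasFDerivAt x (hasFDerivAt_norm_of_ne_zero hx))
  refine h2.congr_fderiv ?_
  ext v
  simp only [gradCosPolar, innerSL_apply_apply, inner_smul_left, inner_sub_left, inner_eZ, cosPolar,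
    add_apply, smul_apply, smul_eq_mul, Function.comp]
  simp
  field_simp
  ring

/-- The gradient of `ρ ^ q F(cos θ)`. -/
theorem hasFDerivAt_rpow_mul_comp_cosPolar {F : ℝ → ℝ} {F' q : ℝ} {x : Space3} (hx : x ≠ 0)
    (hF : HasDerivAt F F' (cosPolar x)) :
    HasFDerivAt (fun y => ‖y‖ ^ q * F (cosPolar y))
      (innerSL ℝ (!₂[x 0 * (‖x‖ ^ (q - 2) * (q * F (cosPolar x) - cosPolar x * F')),
        x 1 * (‖x‖ ^ (q - 2) * (q * F (cosPolar x) - cosPolar x * F')),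
        x 2 * (‖x‖ ^ (q - 2) * (q * F (cosPolar x) - cosPolar x * F')) + ‖x‖ ^ (q - 1) * F'] :
          Space3)) x := by
  have hn := norm_ne_zero_iff.2 hx
  have hp := norm_pos_iff.2 hx
  have h1 := (hasFDerivAt_norm_of_ne_zero hx).rpow_const (p := q) (Or.inl hn)
  have h2 := hF.comp_hasFDerivAt x (hasFDerivAt_cosPolar hx)
  refine (h1.mul h2).congr_fderiv ?_
  have e1 : ‖x‖ ^ (q - 1) = ‖x‖ ^ (q - 2) * ‖x‖ := by
    rw [← Real.rpow_add_one hn]; congr 1; ring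
  have e2 : ‖x‖ ^ q = ‖x‖ ^ (q - 2) * ‖x‖ ^ 2 := by
    rw [← Real.rpow_add_natCast hn]; congr 1; push_cast; ring
  ext v
  simp only [gradCosPolar, add_apply, smul_apply, smul_eq_mul, innerSL_apply_apply, inner_smul_left,
    inner_sub_left, e1, e2, Function.comp, inner_eq_sum]
  simp
  field_simp
  ring

/-- An axisymmetric field `A r e_r + B e_z + D r e_φ`. -/
noncomputable def axisymField (A B D : Space3 → ℝ) (x : Space3) : Space3 :=
  A x • horizontal x + B x • eZ + D x • angular x

section AxisymField

variable {A B D : Space3 → ℝ} {x : Space3} {a a₃ b b₃ d d₃ : ℝ}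

theorem hasFDerivAt_axisymField {A' B' D' : Space3 →L[ℝ] ℝ} (hA : HasFDerivAt A A' x)
    (hB : HasFDerivAt B B' x) (hD : HasFDerivAt D D' x) :
    HasFDerivAt (axisymField A B D) (A x • horizontal + A'.smulRight (horizontal x) +
      B'.smulRight eZ + (D x • angular + D'.smulRight (angular x))) x :=
  ((hA.fun_smul horizontal.hasFDerivAt).fun_add (hB.smul_const eZ)).fun_add
    (hD.fun_smul angular.hasFDerivAt)

/-- Gradients of axisymmetric functions have the form (x₀ a, x₁ a, a₃), where a is the radial
derivative divided by r. This avoids the frame vectors, which are singular on the axis. -/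
theorem pderiv_axisymField
    (hA : HasFDerivAt A (innerSL ℝ (!₂[x 0 * a, x 1 * a, a₃] : Space3)) x)
    (hB : HasFDerivAt B (innerSL ℝ (!₂[x 0 * b, x 1 * b, b₃] : Space3)) x)
    (hD : HasFDerivAt D (innerSL ℝ (!₂[x 0 * d, x 1 * d, d₃] : Space3)) x) (i j : Fin 3) :
    pderiv (axisymField A B D) i j x =
      A x * horizontal (EuclideanSpace.single i 1) j +
        inner ℝ (!₂[x 0 * a, x 1 * a, a₃] : Space3) (EuclideanSpace.single i 1) * horizontal x j +
      inner ℝ (!₂[x 0 * b, x 1 * b, b₃] : Space3) (EuclideanSpace.single i 1) * eZ j +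
      (D x * angular (EuclideanSpace.single i 1) j +
        inner ℝ (!₂[x 0 * d, x 1 * d, d₃] : Space3) (EuclideanSpace.single i 1) * angular x j) := by
  rw [pderiv, (hasFDerivAt_axisymField hA hB hD).fderiv]
  simp only [add_apply, smul_apply, ContinuousLinearMap.smulRight_apply, innerSL_apply_apply,
    PiLp.add_apply, PiLp.smul_apply, smul_eq_mul]

theorem divergence_axisymField
    (hA : HasFDerivAt A (innerSL ℝ (!₂[x 0 * a, x 1 * a, a₃] : Space3)) x)
    (hB : HasFDerivAt B (innerSL ℝ (!₂[x 0 * b, x 1 * b, b₃] : Space3)) x)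
    (hD : HasFDerivAt D (innerSL ℝ (!₂[x 0 * d, x 1 * d, d₃] : Space3)) x) :
    divergence (axisymField A B D) x = 2 * A x + radiusSq x * a + b₃ := by
  simp only [divergence, Fin.sum_univ_three, pderiv_axisymField hA hB hD, inner_eq_sum]
  simp [radiusSq]
  ring

theorem curl_axisymField
    (hA : HasFDerivAt A (innerSL ℝ (!₂[x 0 * a, x 1 * a, a₃] : Space3)) x)
    (hB : HasFDerivAt B (innerSL ℝ (!₂[x 0 * b, x 1 * b, b₃] : Space3)) x)
    (hD : HasFDerivAt D (innerSL ℝ (!₂[x 0 * d, x 1 * d, d₃] : Space3)) x) :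
    curl (axisymField A B D) x =
      (-d₃) • horizontal x + (2 * D x + radiusSq x * d) • eZ - (b - a₃) • angular x := by
  simp only [curl, pderiv_axisymField hA hB hD, inner_eq_sum]
  ext i
  fin_cases i <;> simp [radiusSq] <;> ring

end AxisymField

/-! ### The fields obtained from a profile -/

/-- The continuous extension of `w / (1 - t²)` to `[-1, 1]`. -/
noncomputable def profileQuot (w w₁ : ℝ → ℝ) (t : ℝ) : ℝ :=
  if t ^ 2 = 1 then -(t * w₁ t) / 2 else w t / (1 - t ^ 2)

/-- The radial component of the poloidal field, divided by `r`. -/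
noncomputable def radialCoeff (β : ℝ) (w w₁ : ℝ → ℝ) (x : Space3) : ℝ :=
  ‖x‖ ^ (-β - 3) * (-w₁ (cosPolar x) + β * (cosPolar x * profileQuot w w₁ (cosPolar x)))

/-- The axial component of the poloidal field. -/
noncomputable def axialCoeff (β : ℝ) (w w₁ : ℝ → ℝ) (x : Space3) : ℝ :=
  ‖x‖ ^ (-β - 2) * (-(cosPolar x * w₁ (cosPolar x)) - β * w (cosPolar x))

/-- The azimuthal component for the circulation function `γ ∘ ψ`, divided by `r`. -/
noncomputable def swirlCoeff (β : ℝ) (γ w : ℝ → ℝ) (x : Space3) : ℝ :=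
  γ (streamFunction β w x) / radiusSq x

/-- The field `∇ × (ψ ∇φ) + γ(ψ) ∇φ`. -/
noncomputable def swirlField (β : ℝ) (γ w w₁ : ℝ → ℝ) : Space3 → Space3 :=
  axisymField (radialCoeff β w w₁) (axialCoeff β w w₁) (swirlCoeff β γ w)

theorem streamFunction_eq (β : ℝ) (w : ℝ → ℝ) :
    streamFunction β w = fun x => ‖x‖ ^ (-β) * w (cosPolar x) := by
  funext x
  rw [streamFunction, Real.rpow_neg (norm_nonneg x), div_eq_inv_mul]; rfl

theorem radiusSq_mul_radialCoeff {β : ℝ} {w w₁ : ℝ → ℝ} {x : Space3} (hx : x ∉ zAxis) :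
    radiusSq x * radialCoeff β w w₁ x = ‖x‖ ^ (-β - 1) *
      (-(1 - cosPolar x ^ 2) * w₁ (cosPolar x) + β * cosPolar x * w (cosPolar x)) := by
  have hx0 := ne_zero_of_notMem_zAxis hx
  have h1 := one_sub_cosPolar_sq_pos hx
  have h2 : cosPolar x ^ 2 ≠ 1 := by linarith
  rw [radiusSq_eq hx0, radialCoeff, profileQuot, if_neg h2]
  have e : ‖x‖ ^ (-β - 1) = ‖x‖ ^ (-β - 3) * ‖x‖ ^ 2 := by
    rw [← Real.rpow_add_natCast (norm_ne_zero_iff.2 hx0)]; congr 1; push_cast; ring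
  rw [e]
  field_simp

namespace IsProfile

variable {β : ℝ} {w w₁ : ℝ → ℝ}

theorem hasDerivAt (h : IsProfile β w w₁) {t : ℝ} (ht : t ∈ Ioo (-1 : ℝ) 1) :
    HasDerivAt w (w₁ t) t :=
  (h.hasDerivWithinAt t (Ioo_subset_Icc_self ht)).hasDerivAt (Icc_mem_nhds ht.1 ht.2)

theorem hasDerivAt_profileQuot (h : IsProfile β w w₁) {t : ℝ} (ht : t ∈ Ioo (-1 : ℝ) 1) :
    HasDerivAt (profileQuot w w₁) ((w₁ t + 2 * t * profileQuot w w₁ t) / (1 - t ^ 2)) t := by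
  have hne : ∀ s ∈ Ioo (-1 : ℝ) 1, s ^ 2 < 1 := fun s hs =>
    (sq_lt_one_iff_abs_lt_one s).2 (abs_lt.2 hs)
  have h0 := hne t ht
  have h1 : 1 - t ^ 2 ≠ 0 := by linarith
  have h2 := (h.hasDerivAt ht).div (((hasDerivAt_id t).pow 2).const_sub 1) h1
  have h3 : profileQuot w w₁ =ᶠ[𝓝 t] fun s => w s / (1 - s ^ 2) := by
    filter_upwards [isOpen_Ioo.mem_nhds ht] with s hs
    rw [profileQuot, if_neg (hne s hs).ne]
  rw [h3.eq_of_nhds]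
  refine (h2.congr_of_eventuallyEq h3).congr_deriv ?_
  simp
  field_simp

variable {x : Space3}

/-- This identifies the axial coefficient with ∂_r ψ / r and the radial one with -∂_z ψ / r², so the
poloidal part is ∇ × (ψ∇φ). -/
theorem hasFDerivAt_streamFunction (h : IsProfile β w w₁) (hx : x ∉ zAxis) :
    HasFDerivAt (streamFunction β w) (innerSL ℝ (!₂[x 0 * axialCoeff β w w₁ x,
      x 1 * axialCoeff β w w₁ x, -(radiusSq x * radialCoeff β w w₁ x)] : Space3)) x := by
  rw [streamFunction_eq]
  have hx0 := ne_zero_of_notMem_zAxis hx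
  have hn := norm_ne_zero_iff.2 hx0
  refine (hasFDerivAt_rpow_mul_comp_cosPolar (q := -β) hx0
    (h.hasDerivAt (cosPolar_mem_Ioo hx))).congr_fderiv ?_
  rw [radiusSq_mul_radialCoeff hx, axialCoeff]
  congr 2
  have e : ‖x‖ ^ (-β - 1) = ‖x‖ ^ (-β - 2) * ‖x‖ := by
    rw [← Real.rpow_add_one hn]; congr 1; ring
  rw [e, ← cosPolar_mul_norm hx0]
  have e' : -β * w (cosPolar x) - cosPolar x * w₁ (cosPolar x) =
      -(cosPolar x * w₁ (cosPolar x)) - β * w (cosPolar x) := by ring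
  rw [e']
  congr 3
  rw [← eq_sub_iff_add_eq]
  ring

theorem hasFDerivAt_swirlCoeff (h : IsProfile β w w₁) (hx : x ∉ zAxis) {γ : ℝ → ℝ} {γ' : ℝ}
    (hγ : HasDerivAt γ γ' (streamFunction β w x)) :
    HasFDerivAt (swirlCoeff β γ w) (innerSL ℝ (!₂[
      x 0 * ((γ' * axialCoeff β w w₁ x - 2 * swirlCoeff β γ w x) / radiusSq x),
      x 1 * ((γ' * axialCoeff β w w₁ x - 2 * swirlCoeff β γ w x) / radiusSq x),
      -(γ' * radialCoeff β w w₁ x)] : Space3)) x := by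
  have hr := (notMem_zAxis_iff x).1 hx
  have hp : ∀ i : Fin 3, HasFDerivAt (fun y : Space3 => y i) (EuclideanSpace.proj i : Space3 →L[ℝ] ℝ) x :=
    fun i => (EuclideanSpace.proj i : Space3 →L[ℝ] ℝ).hasFDerivAt
  have h1 : HasFDerivAt radiusSq _ x := ((hp 0).pow 2).fun_add ((hp 1).pow 2)
  have h2 := (hγ.comp_hasFDerivAt x (h.hasFDerivAt_streamFunction hx)).mul
    ((hasDerivAt_inv hr.ne').comp_hasFDerivAt x h1)
  refine h2.congr_fderiv ?_
  ext v
  simp only [swirlCoeff, innerSL_apply_apply, inner_eq_sum, add_apply, smul_apply, smul_eq_mul,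
    Function.comp]
  simp
  field_simp
  ring

theorem hasFDerivAt_axialCoeff (h : IsProfile β w w₁) (hx : x ∉ zAxis) {w₂ : ℝ}
    (hw₂ : HasDerivAt w₁ w₂ (cosPolar x)) :
    HasFDerivAt (axialCoeff β w w₁) (innerSL ℝ (!₂[
      x 0 * (‖x‖ ^ (-β - 4) * ((-β - 2) * (-(cosPolar x * w₁ (cosPolar x)) - β * w (cosPolar x))
        - cosPolar x * (-(w₁ (cosPolar x) + cosPolar x * w₂) - β * w₁ (cosPolar x)))),
      x 1 * (‖x‖ ^ (-β - 4) * ((-β - 2) * (-(cosPolar x * w₁ (cosPolar x)) - β * w (cosPolar x))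
        - cosPolar x * (-(w₁ (cosPolar x) + cosPolar x * w₂) - β * w₁ (cosPolar x)))),
      x 2 * (‖x‖ ^ (-β - 4) * ((-β - 2) * (-(cosPolar x * w₁ (cosPolar x)) - β * w (cosPolar x))
        - cosPolar x * (-(w₁ (cosPolar x) + cosPolar x * w₂) - β * w₁ (cosPolar x))))
        + ‖x‖ ^ (-β - 3) * (-(w₁ (cosPolar x) + cosPolar x * w₂) - β * w₁ (cosPolar x))]
      : Space3)) x := by
  have hF : HasDerivAt (fun t => -(t * w₁ t) - β * w t)
      (-(w₁ (cosPolar x) + cosPolar x * w₂) - β * w₁ (cosPolar x)) (cosPolar x) :=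
    ((((hasDerivAt_id (cosPolar x)).fun_mul hw₂).fun_neg).fun_sub
      ((h.hasDerivAt (cosPolar_mem_Ioo hx)).const_mul β)).congr_deriv (by simp)
  have := hasFDerivAt_rpow_mul_comp_cosPolar (q := -β - 2) (ne_zero_of_notMem_zAxis hx) hF
  rw [show -β - 2 - 2 = -β - 4 by ring, show -β - 2 - 1 = -β - 3 by ring] at this
  exact this

theorem hasFDerivAt_radialCoeff (h : IsProfile β w w₁) (hx : x ∉ zAxis) {w₂ φ φ₁ G G' : ℝ}
    (hw₂ : HasDerivAt w₁ w₂ (cosPolar x)) (hφ : φ = profileQuot w w₁ (cosPolar x))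
    (hφ₁ : φ₁ = (w₁ (cosPolar x) + 2 * cosPolar x * φ) / (1 - cosPolar x ^ 2))
    (hG : G = -w₁ (cosPolar x) + β * (cosPolar x * φ)) (hG' : G' = -w₂ + β * (φ + cosPolar x * φ₁)) :
    HasFDerivAt (radialCoeff β w w₁) (innerSL ℝ (!₂[
      x 0 * (‖x‖ ^ (-β - 5) * ((-β - 3) * G - cosPolar x * G')),
      x 1 * (‖x‖ ^ (-β - 5) * ((-β - 3) * G - cosPolar x * G')),
      x 2 * (‖x‖ ^ (-β - 5) * ((-β - 3) * G - cosPolar x * G')) + ‖x‖ ^ (-β - 4) * G']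
      : Space3)) x := by
  have hF : HasDerivAt (fun t => -w₁ t + β * (t * profileQuot w w₁ t)) G' (cosPolar x) := by
    refine (hw₂.fun_neg.fun_add (((hasDerivAt_id (cosPolar x)).fun_mul
      (h.hasDerivAt_profileQuot (cosPolar_mem_Ioo hx))).const_mul β)).congr_deriv ?_
    rw [hG', hφ₁, hφ]; simp
  have := hasFDerivAt_rpow_mul_comp_cosPolar (q := -β - 3) (ne_zero_of_notMem_zAxis hx) hF
  rw [show -β - 3 - 2 = -β - 5 by ring, show -β - 3 - 1 = -β - 4 by ring, ← hφ, ← hG] at this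
  exact this

/-- The field is divergence free off the axis, and its rotation is `γ'(ψ)` times the poloidal field
plus a toroidal part that depends on `ψ` only. -/
theorem swirlField_off_axis (h : IsProfile β w w₁) (hβ : β ≠ 0) (hx : x ∉ zAxis) {γ : ℝ → ℝ} {γ' : ℝ}
    (hγ : HasDerivAt γ γ' (streamFunction β w x)) :
    DifferentiableAt ℝ (swirlField β γ w w₁) x ∧ divergence (swirlField β γ w w₁) x = 0 ∧
    curl (swirlField β γ w w₁) x = γ' • radialCoeff β w w₁ x • horizontal x +
      γ' • axialCoeff β w w₁ x • eZ + ((1 + 1 / β) *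
        (streamFunction β w x * |streamFunction β w x| ^ (2 / β)) / radiusSq x) • angular x := by
  have hT := cosPolar_mem_Ioo hx
  have hx0 := ne_zero_of_notMem_zAxis hx
  have hn := norm_pos_iff.2 hx0
  have hr := (notMem_zAxis_iff x).1 hx
  have h1T := one_sub_cosPolar_sq_pos hx
  obtain ⟨φ, hφ⟩ : ∃ φ, φ = profileQuot w w₁ (cosPolar x) := ⟨_, rfl⟩
  obtain ⟨w₂, hw₂⟩ : ∃ w₂, w₂ = -(β * (β + 1) * w (cosPolar x) + (1 + 1 / β) *
    (w (cosPolar x) * |w (cosPolar x)| ^ (2 / β))) / (1 - cosPolar x ^ 2) := ⟨_, rfl⟩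
  obtain ⟨φ₁, hφ₁⟩ : ∃ φ₁, φ₁ = (w₁ (cosPolar x) + 2 * cosPolar x * φ) / (1 - cosPolar x ^ 2) :=
    ⟨_, rfl⟩
  have hwφ : w (cosPolar x) = φ * (1 - cosPolar x ^ 2) := by
    rw [hφ, profileQuot, if_neg (by linarith)]
    field_simp
  have hd := h.equation _ hT
  rw [← hw₂] at hd
  have hA := h.hasFDerivAt_radialCoeff hx hd hφ hφ₁ rfl rfl
  have hB := h.hasFDerivAt_axialCoeff hx hd
  have hD := h.hasFDerivAt_swirlCoeff hx hγ
  have e3 : ‖x‖ ^ (-β - 3) = ‖x‖ ^ (-β - 5) * ‖x‖ ^ 2 := by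
    rw [← Real.rpow_add_natCast hn.ne']; congr 1; push_cast; ring
  have e4 : ‖x‖ ^ (-β - 4) = ‖x‖ ^ (-β - 5) * ‖x‖ := by
    rw [← Real.rpow_add_one hn.ne']; congr 1; ring
  have hφ₁' : φ₁ * (1 - cosPolar x ^ 2) = w₁ (cosPolar x) + 2 * cosPolar x * φ := by
    rw [hφ₁]; field_simp
  refine ⟨(hasFDerivAt_axisymField hA hB hD).differentiableAt, ?_, ?_⟩
  · rw [swirlField, divergence_axisymField hA hB hD, radialCoeff, ← hφ, e3, e4, hwφ,
      radiusSq_eq hx0, ← cosPolar_mul_norm hx0]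
    linear_combination (-‖x‖ ^ (-β - 5) * ‖x‖ ^ 2 * β * cosPolar x ^ 2) * hφ₁'
  · rw [swirlField, curl_axisymField hA hB hD]
    -- The azimuthal rotation is, up to sign, ρ^(-β-4) times w'' + β(β + 1) w/(1 - t²); the profile
    -- equation turns this into the power of ψ.
    have key : ‖x‖ ^ (-β - 4) * ((-β - 2) * (-(cosPolar x * w₁ (cosPolar x)) - β * w (cosPolar x))
        - cosPolar x * (-(w₁ (cosPolar x) + cosPolar x * w₂) - β * w₁ (cosPolar x)))
        - (x 2 * (‖x‖ ^ (-β - 5) * ((-β - 3) * (-w₁ (cosPolar x) + β * (cosPolar x * φ))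
          - cosPolar x * (-w₂ + β * (φ + cosPolar x * φ₁))))
          + ‖x‖ ^ (-β - 4) * (-w₂ + β * (φ + cosPolar x * φ₁)))
        = -((1 + 1 / β) * (streamFunction β w x * |streamFunction β w x| ^ (2 / β)) / radiusSq x) := by
      have eψ : streamFunction β w x * |streamFunction β w x| ^ (2 / β) =
          ‖x‖ ^ (-β - 5) * ‖x‖ ^ 3 * (w (cosPolar x) * |w (cosPolar x)| ^ (2 / β)) := by
        rw [streamFunction_eq, abs_mul, abs_of_pos (Real.rpow_pos_of_pos hn _),
          Real.mul_rpow (Real.rpow_nonneg hn.le _) (abs_nonneg _), ← Real.rpow_mul hn.le,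
          ← Real.rpow_add_natCast hn.ne', show -β * (2 / β) = -2 by field_simp,
          show -β - 5 + (3 : ℕ) = -β + -2 by push_cast; ring, Real.rpow_add hn]
        ring
      have hode : (1 + 1 / β) * (w (cosPolar x) * |w (cosPolar x)| ^ (2 / β)) =
          -(1 - cosPolar x ^ 2) * (w₂ + β * (β + 1) * φ) := by
        rw [hw₂]
        field_simp
        rw [hwφ]; ring
      have e6 : (1 + 1 / β) * (‖x‖ ^ (-β - 5) * ‖x‖ ^ 3 *
          (w (cosPolar x) * |w (cosPolar x)| ^ (2 / β))) =
          ‖x‖ ^ (-β - 5) * ‖x‖ ^ 3 * (-(1 - cosPolar x ^ 2) * (w₂ + β * (β + 1) * φ)) := by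
        rw [← hode]; ring
      rw [eψ, e6, radiusSq_eq hx0, e4, hwφ, ← cosPolar_mul_norm hx0]
      have : -(‖x‖ ^ (-β - 5) * ‖x‖ ^ 3 * (-(1 - cosPolar x ^ 2) * (w₂ + β * (β + 1) * φ)) /
          (‖x‖ ^ 2 * (1 - cosPolar x ^ 2))) = ‖x‖ ^ (-β - 5) * ‖x‖ * (w₂ + β * (β + 1) * φ) := by
        field_simp
      rw [this]
      linear_combination (-‖x‖ ^ (-β - 5) * ‖x‖ * β * cosPolar x) * hφ₁'
    rw [key]
    have e5 : 2 * swirlCoeff β γ w x + radiusSq x * ((γ' * axialCoeff β w w₁ x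
        - 2 * swirlCoeff β γ w x) / radiusSq x) = γ' * axialCoeff β w w₁ x := by
      field_simp; ring
    rw [e5]
    simp only [neg_neg, smul_smul, neg_smul, sub_neg_eq_add]

end IsProfile

/-! ### The Beltrami field: homogeneity, rotation invariance, components. -/

/-- The circulation function `s ↦ s |s| ^ (1 / β)`. -/
noncomputable def circulation (β s : ℝ) : ℝ := s * |s| ^ (1 / β)

/-- The Beltrami field of a profile. -/
noncomputable def beltramiField (β : ℝ) (w w₁ : ℝ → ℝ) : Space3 → Space3 :=
  swirlField β (circulation β) w w₁

/-- The exponent 1/β is forced by scaling: ψ has degree -β, so Γ has degree -β - 1, and Γ/r has the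
degree -β - 2 of the poloidal part. -/
theorem circulation_mul {β l : ℝ} (hβ : β ≠ 0) (hl : 0 < l) (s : ℝ) :
    circulation β (l ^ (-β) * s) = l ^ (-β - 1) * circulation β s := by
  have h1 : 0 < l ^ (-β) := Real.rpow_pos_of_pos hl _
  rw [circulation, circulation, abs_mul, abs_of_pos h1, Real.mul_rpow h1.le (abs_nonneg s),
    ← Real.rpow_mul hl.le, show -β * (1 / β) = -1 by field_simp, sub_eq_add_neg,
    Real.rpow_add hl]
  ring

section Homogeneity

variable {β l : ℝ} {w w₁ : ℝ → ℝ}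

theorem cosPolar_smul (hl : 0 < l) (x : Space3) : cosPolar (l • x) = cosPolar x := by
  rw [cosPolar, cosPolar, norm_smul, Real.norm_of_nonneg hl.le, PiLp.smul_apply, smul_eq_mul,
    mul_div_mul_left _ _ hl.ne']

theorem rpow_norm_smul (hl : 0 < l) (x : Space3) (q : ℝ) : ‖l • x‖ ^ q = l ^ q * ‖x‖ ^ q := by
  rw [norm_smul, Real.norm_of_nonneg hl.le, Real.mul_rpow hl.le (norm_nonneg x)]

theorem radialCoeff_smul (hl : 0 < l) (x : Space3) :
    radialCoeff β w w₁ (l • x) = l ^ (-β - 3) * radialCoeff β w w₁ x := by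
  rw [radialCoeff, radialCoeff, cosPolar_smul hl, rpow_norm_smul hl, mul_assoc]

theorem axialCoeff_smul (hl : 0 < l) (x : Space3) :
    axialCoeff β w w₁ (l • x) = l ^ (-β - 2) * axialCoeff β w w₁ x := by
  rw [axialCoeff, axialCoeff, cosPolar_smul hl, rpow_norm_smul hl, mul_assoc]

theorem streamFunction_smul (hl : 0 < l) (x : Space3) :
    streamFunction β w (l • x) = l ^ (-β) * streamFunction β w x := by
  simp only [streamFunction_eq]
  rw [cosPolar_smul hl, rpow_norm_smul hl, mul_assoc]

theorem radiusSq_smul (x : Space3) : radiusSq (l • x) = l ^ 2 * radiusSq x := by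
  simp only [radiusSq, PiLp.smul_apply, smul_eq_mul]; ring

theorem swirlCoeff_smul (hβ : β ≠ 0) (hl : 0 < l) (x : Space3) :
    swirlCoeff β (circulation β) w (l • x) = l ^ (-β - 3) * swirlCoeff β (circulation β) w x := by
  rw [swirlCoeff, swirlCoeff, streamFunction_smul hl, circulation_mul hβ hl, radiusSq_smul]
  have e : l ^ (-β - 1) = l ^ (-β - 3) * l ^ 2 := by
    rw [← Real.rpow_add_natCast hl.ne']; congr 1; push_cast; ring
  rw [e]
  field_simp

theorem beltramiField_smul (hβ : β ≠ 0) (hl : 0 < l) (x : Space3) :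
    beltramiField β w w₁ (l • x) = l ^ (-β - 2) • beltramiField β w w₁ x := by
  rw [beltramiField, swirlField, axisymField, axisymField, radialCoeff_smul hl,
    axialCoeff_smul hl, swirlCoeff_smul hβ hl, map_smul, map_smul]
  have e : l ^ (-β - 2) = l ^ (-β - 3) * l := by
    rw [← Real.rpow_add_one hl.ne']; congr 1; ring
  simp only [smul_add, smul_smul, e]
  congr 2 <;> ring_nf

theorem isHomogeneousOn_beltramiField (hβ : β ≠ 0) (s : Set Space3) :
    IsHomogeneousOn (β + 2) (beltramiField β w w₁) s := by
  intro l hl x _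
  rw [beltramiField_smul hβ hl, smul_smul, ← Real.rpow_add hl]
  simp

end Homogeneity

section Rotation

variable {β : ℝ} {w w₁ : ℝ → ℝ}

theorem radiusSq_rotZ (a : ℝ) (x : Space3) : radiusSq (rotZ a x) = radiusSq x := by
  simp [radiusSq, rotZ]
  linear_combination (x 0 ^ 2 + x 1 ^ 2) * Real.sin_sq_add_cos_sq a

theorem norm_rotZ (a : ℝ) (x : Space3) : ‖rotZ a x‖ = ‖x‖ := by
  have h : ‖rotZ a x‖ ^ 2 = ‖x‖ ^ 2 := by
    rw [← radiusSq_add, ← radiusSq_add, radiusSq_rotZ]; simp [rotZ]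
  exact (pow_left_inj₀ (norm_nonneg _) (norm_nonneg _) two_ne_zero).1 h

theorem cosPolar_rotZ (a : ℝ) (x : Space3) : cosPolar (rotZ a x) = cosPolar x := by
  rw [cosPolar, cosPolar, norm_rotZ]; simp [rotZ]

theorem beltramiField_rotZ (a : ℝ) (x : Space3) :
    beltramiField β w w₁ (rotZ a x) = rotZ a (beltramiField β w w₁ x) := by
  have h1 : radialCoeff β w w₁ (rotZ a x) = radialCoeff β w w₁ x := by
    simp only [radialCoeff, norm_rotZ, cosPolar_rotZ]
  have h2 : axialCoeff β w w₁ (rotZ a x) = axialCoeff β w w₁ x := by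
    simp only [axialCoeff, norm_rotZ, cosPolar_rotZ]
  have h3 : swirlCoeff β (circulation β) w (rotZ a x) = swirlCoeff β (circulation β) w x := by
    simp only [swirlCoeff, streamFunction_eq, norm_rotZ, cosPolar_rotZ, radiusSq_rotZ]
  rw [beltramiField, swirlField, axisymField, h1, h2, h3]
  ext i
  fin_cases i <;> simp [axisymField, rotZ] <;> ring

/-- The pressure of a Beltrami flow. -/
noncomputable def bernoulliPressure (u : Space3 → Space3) (x : Space3) : ℝ := -(‖u x‖ ^ 2 / 2)

theorem isAxisymmetricOn_beltramiField (s : Set Space3) :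
    IsAxisymmetricOn (beltramiField β w w₁) (bernoulliPressure (beltramiField β w w₁)) s := by
  intro a x _
  refine ⟨beltramiField_rotZ a x, ?_⟩
  rw [bernoulliPressure, bernoulliPressure, beltramiField_rotZ, norm_rotZ]

theorem IsHomogeneousOn.bernoulliPressure {α : ℝ} {u : Space3 → Space3} {s : Set Space3}
    (h : IsHomogeneousOn α u s) : IsHomogeneousOn (2 * α) (bernoulliPressure u) s := by
  intro l hl x hx
  rw [HomogeneousEuler.bernoulliPressure, HomogeneousEuler.bernoulliPressure, h l hl x hx,
    norm_smul, Real.norm_of_nonneg (Real.rpow_nonneg hl.le _), mul_pow, ← Real.rpow_mul_natCast hl.le,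
    smul_eq_mul, show α * (2 : ℕ) = 2 * α by push_cast; ring]
  ring

end Rotation

section Components

variable {A B D : Space3 → ℝ}

theorem coords_eq_zero_of_cylRadius_eq_zero {x : Space3} (h : cylRadius x = 0) : x 0 = 0 ∧ x 1 = 0 := by
  have h1 := cylRadius_sq x
  rw [h, radiusSq] at h1
  constructor <;> nlinarith [sq_nonneg (x 0), sq_nonneg (x 1)]

theorem eR_eq (x : Space3) : eR x = (cylRadius x)⁻¹ • horizontal x := by
  ext i; fin_cases i <;> simp [eR, div_eq_inv_mul]

theorem ePhi_eq (x : Space3) : ePhi x = (cylRadius x)⁻¹ • angular x := by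
  ext i; fin_cases i <;> simp [ePhi, div_eq_inv_mul]

theorem inner_horizontal_axisymField (x : Space3) :
    inner ℝ (axisymField A B D x) (horizontal x) = A x * radiusSq x := by
  simp [inner_eq_sum, axisymField, radiusSq]; ring

theorem inner_angular_axisymField (x : Space3) :
    inner ℝ (axisymField A B D x) (angular x) = D x * radiusSq x := by
  simp [inner_eq_sum, axisymField, radiusSq]; ring

theorem norm_axisymField_sq (x : Space3) :
    ‖axisymField A B D x‖ ^ 2 = A x ^ 2 * radiusSq x + B x ^ 2 + D x ^ 2 * radiusSq x := by
  simp [normsq_eq_sum, axisymField, radiusSq]; ring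

theorem poloidal_axisymField : poloidal (axisymField A B D) =
    fun x => A x • horizontal x + B x • eZ := by
  funext x
  rw [poloidal, real_inner_comm, real_inner_comm eZ, inner_eZ, eR_eq, inner_smul_left,
    real_inner_comm, inner_horizontal_axisymField, smul_smul]
  congr 1
  · rcases eq_or_ne (cylRadius x) 0 with h | h
    · obtain ⟨h0, h1⟩ := coords_eq_zero_of_cylRadius_eq_zero h
      have : horizontal x = 0 := by ext i; fin_cases i <;> simp [h0, h1]
      simp [this]
    · congr 1
      rw [← cylRadius_sq]
      simp
      field_simp
  · simp [axisymField]

theorem toroidal_axisymField : toroidal (axisymField A B D) = fun x => D x • angular x := by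
  funext x
  rw [toroidal, real_inner_comm, ePhi_eq, inner_smul_left,
    real_inner_comm, inner_angular_axisymField, smul_smul]
  rcases eq_or_ne (cylRadius x) 0 with h | h
  · obtain ⟨h0, h1⟩ := coords_eq_zero_of_cylRadius_eq_zero h
    have : angular x = 0 := by ext i; fin_cases i <;> simp [h0, h1]
    simp [this]
  · congr 1
    rw [← cylRadius_sq]
    simp
    field_simp

end Components

namespace IsProfile

variable {β : ℝ} {w w₁ : ℝ → ℝ} {x : Space3}

theorem beltramiField_eq_clebschField (h : IsProfile β w w₁) (hx : x ∉ zAxis) :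
    beltramiField β w w₁ x = clebschField β 1 w x := by
  have hr : cylRadius x ≠ 0 := hx
  have hr2 := cylRadius_sq x
  have hr0 := ((notMem_zAxis_iff x).1 hx).ne'
  have e1 : fderiv ℝ (streamFunction β w) x eZ = -(radiusSq x * radialCoeff β w w₁ x) := by
    rw [(h.hasFDerivAt_streamFunction hx).fderiv]; simp [inner_eq_sum]
  have e2 : fderiv ℝ (streamFunction β w) x (eR x) = cylRadius x * axialCoeff β w w₁ x := by
    rw [(h.hasFDerivAt_streamFunction hx).fderiv]
    simp [inner_eq_sum, eR]
    field_simp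
    rw [hr2, radiusSq]
  have e3 : swirlFunction β 1 w x = radiusSq x * swirlCoeff β (circulation β) w x := by
    rw [swirlFunction, one_mul, swirlCoeff, mul_div_cancel₀ _ hr0]; rfl
  rw [clebschField, e1, e2, e3, eR_eq, ePhi_eq, ← hr2, beltramiField, swirlField, axisymField,
    smul_smul, smul_smul]
  congr 2
  · congr 1; field_simp
  · field_simp
  · field_simp

theorem exponent_gt (hβ : 0 < β ∨ β < -2) : -1 < 2 / β := by
  rcases hβ with h | h
  · have : 0 < 2 / β := by positivity
    linarith
  · rw [lt_div_iff_of_neg (by linarith)]; linarith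

theorem continuousOn_w (h : IsProfile β w w₁) : ContinuousOn w (Icc (-1) 1) := fun t ht =>
  (h.hasDerivWithinAt t ht).continuousWithinAt

theorem contDiffOn_deriv (h : IsProfile β w w₁) (hβ : 0 < β ∨ β < -2) :
    ContDiffOn ℝ 1 w₁ (Ioo (-1) 1) := by
  rw [show (1 : WithTop ℕ∞) = 0 + 1 by norm_num, contDiffOn_succ_iff_deriv_of_isOpen isOpen_Ioo]
  refine ⟨fun t ht => (h.equation t ht).differentiableAt.differentiableWithinAt, by simp, ?_⟩
  rw [contDiffOn_zero]
  have hw := h.continuousOn_w.mono Ioo_subset_Icc_self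
  have hL := (continuous_mul_abs_rpow (exponent_gt hβ)).comp_continuousOn hw
  have : ContinuousOn (fun t => -(β * (β + 1) * w t + (1 + 1 / β) * (w t * |w t| ^ (2 / β)))
      / (1 - t ^ 2)) (Ioo (-1) 1) := by
    refine ContinuousOn.div ((hw.const_mul _).add (hL.const_mul _)).neg (by fun_prop) fun t ht => ?_
    have := (sq_lt_one_iff_abs_lt_one t).2 (abs_lt.2 ht)
    linarith
  exact this.congr fun t ht => (h.equation t ht).deriv

theorem contDiffOn_two (h : IsProfile β w w₁) (hβ : 0 < β ∨ β < -2) :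
    ContDiffOn ℝ 2 w (Ioo (-1) 1) := by
  rw [show (2 : WithTop ℕ∞) = 1 + 1 by norm_num, contDiffOn_succ_iff_deriv_of_isOpen isOpen_Ioo]
  exact ⟨fun t ht => (h.hasDerivAt ht).differentiableAt.differentiableWithinAt, by simp,
    (h.contDiffOn_deriv hβ).congr fun t ht => (h.hasDerivAt ht).deriv⟩

theorem isDirichletSolution (h : IsProfile β w w₁) (hβ : 0 < β ∨ β < -2) :
    IsDirichletSolution β 0 (1 ^ 2 * (1 + 1 / β)) w where
  contDiffOn_Ioo := h.contDiffOn_two hβ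
  contDiffOn_Icc := by
    have hu := uniqueDiffOn_Icc (show (-1 : ℝ) < 1 by norm_num)
    rw [show (1 : WithTop ℕ∞) = 0 + 1 by norm_num, contDiffOn_succ_iff_derivWithin hu]
    exact ⟨fun t ht => (h.hasDerivWithinAt t ht).differentiableWithinAt, by simp,
      contDiffOn_zero.2 (h.continuousOn.congr fun t ht => (h.hasDerivWithinAt t ht).derivWithin (hu t ht))⟩
  equation := by
    intro t ht
    have h1 : deriv w =ᶠ[𝓝 t] w₁ := by
      filter_upwards [isOpen_Ioo.mem_nhds ht] with s hs using (h.hasDerivAt hs).deriv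
    rw [h1.deriv_eq, (h.equation t ht).deriv]
    ring
  boundary_right := h.boundary_right
  boundary_left := h.boundary_left

theorem isObtainedFromDirichlet (h : IsProfile β w w₁) (hβ : 0 < β ∨ β < -2) :
    IsObtainedFromDirichlet (β + 2) (beltramiField β w w₁) := by
  refine ⟨1, w, one_ne_zero, ?_, fun x hx => ?_⟩
  · rw [add_sub_cancel_right]; exact h.isDirichletSolution hβ
  · rw [add_sub_cancel_right]; exact h.beltramiField_eq_clebschField hx

/-- The stream function does not vanish identically off the axis. -/
theorem exists_streamFunction_ne_zero (h : IsProfile β w w₁) :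
    ∃ x, x ∉ zAxis ∧ streamFunction β w x ≠ 0 := by
  obtain ⟨t, ht, hw⟩ := h.nontrivial
  have h1 : 0 < 1 - t ^ 2 := by
    have := (sq_lt_one_iff_abs_lt_one t).2 (abs_lt.2 ht)
    linarith
  set x : Space3 := !₂[√(1 - t ^ 2), 0, t] with hx
  have hn : ‖x‖ = 1 := by
    have : ‖x‖ ^ 2 = 1 := by
      rw [normsq_eq_sum]; simp [hx, Real.sq_sqrt h1.le]
    exact (pow_eq_one_iff_of_nonneg (norm_nonneg x) two_ne_zero).1 this
  refine ⟨x, (notMem_zAxis_iff x).2 ?_, ?_⟩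
  · simp [radiusSq, hx, Real.sq_sqrt h1.le, h1]
  · rw [streamFunction, hn]
    simpa [hx] using hw

end IsProfile

/-! ### Regularity across the axis -/

/-- `H` is continuous on `[-1, 1]`, differentiable inside, and `K = (1 - t²) H'` extends continuously
by zero to the end points. -/
structure HasAxisDeriv (H K : ℝ → ℝ) : Prop where
  continuousOn : ContinuousOn H (Icc (-1) 1)
  continuousOn_deriv : ContinuousOn K (Icc (-1) 1)
  hasDerivAt : ∀ t ∈ Ioo (-1 : ℝ) 1, HasDerivAt H (K t / (1 - t ^ 2)) t
  right : K 1 = 0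
  left : K (-1) = 0

namespace HasAxisDeriv

variable {H K H₂ K₂ : ℝ → ℝ}

theorem add (h : HasAxisDeriv H K) (h₂ : HasAxisDeriv H₂ K₂) :
    HasAxisDeriv (fun t => H t + H₂ t) (fun t => K t + K₂ t) where
  continuousOn := h.continuousOn.add h₂.continuousOn
  continuousOn_deriv := h.continuousOn_deriv.add h₂.continuousOn_deriv
  hasDerivAt := fun t ht => ((h.hasDerivAt t ht).fun_add (h₂.hasDerivAt t ht)).congr_deriv
    (by ring)
  right := by rw [h.right, h₂.right, add_zero]
  left := by rw [h.left, h₂.left, add_zero]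

theorem mul (h : HasAxisDeriv H K) (h₂ : HasAxisDeriv H₂ K₂) :
    HasAxisDeriv (fun t => H t * H₂ t) (fun t => K t * H₂ t + H t * K₂ t) where
  continuousOn := h.continuousOn.mul h₂.continuousOn
  continuousOn_deriv := (h.continuousOn_deriv.mul h₂.continuousOn).add
    (h.continuousOn.mul h₂.continuousOn_deriv)
  hasDerivAt := fun t ht => ((h.hasDerivAt t ht).fun_mul (h₂.hasDerivAt t ht)).congr_deriv
    (by ring)
  right := by rw [h.right, h₂.right]; ring
  left := by rw [h.left, h₂.left]; ring

theorem const (c : ℝ) : HasAxisDeriv (fun _ => c) (fun _ => 0) where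
  continuousOn := continuousOn_const
  continuousOn_deriv := continuousOn_const
  hasDerivAt := fun t _ => (hasDerivAt_const t c).congr_deriv (by simp)
  right := rfl
  left := rfl

theorem id : HasAxisDeriv (fun t => t) (fun t => 1 - t ^ 2) where
  continuousOn := continuousOn_id
  continuousOn_deriv := by fun_prop
  hasDerivAt := fun t ht => by
    have := (sq_lt_one_iff_abs_lt_one t).2 (abs_lt.2 ht)
    rw [div_self (by linarith)]
    exact hasDerivAt_id t
  right := by norm_num
  left := by norm_num

end HasAxisDeriv

theorem hasDerivWithinAt_Icc_of_Ioo {F F' : ℝ → ℝ} (hF : ContinuousOn F (Icc (-1) 1))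
    (hd : ∀ t ∈ Ioo (-1 : ℝ) 1, HasDerivAt F (F' t) t) (hF' : ContinuousOn F' (Icc (-1) 1)) :
    ∀ t ∈ Icc (-1 : ℝ) 1, HasDerivWithinAt F (F' t) (Icc (-1) 1) t := by
  have hdiff : DifferentiableOn ℝ F (Ioo (-1) 1) := fun t ht =>
    (hd t ht).differentiableAt.differentiableWithinAt
  intro t ht
  rcases eq_or_lt_of_le ht.1 with h1 | h1
  · subst h1
    have hI : Ioo (-1 : ℝ) 1 ∈ 𝓝[>] (-1 : ℝ) := Ioo_mem_nhdsGT (by norm_num)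
    refine (hasDerivWithinAt_Ici_of_tendsto_deriv hdiff
      ((hF _ ht).mono Ioo_subset_Icc_self) hI ?_).mono Icc_subset_Ici_self
    have h2 : Tendsto F' (𝓝[>] (-1)) (𝓝 (F' (-1))) :=
      ((hF' _ ht).mono_of_mem_nhdsWithin (mem_of_superset hI Ioo_subset_Icc_self))
    refine h2.congr' ?_
    filter_upwards [hI] with s hs using (hd s hs).deriv.symm
  rcases eq_or_lt_of_le ht.2 with h2 | h2
  · subst h2
    have hI : Ioo (-1 : ℝ) 1 ∈ 𝓝[<] (1 : ℝ) := Ioo_mem_nhdsLT (by norm_num)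
    refine (hasDerivWithinAt_Iic_of_tendsto_deriv hdiff
      ((hF _ ht).mono Ioo_subset_Icc_self) hI ?_).mono Icc_subset_Iic_self
    have h2 : Tendsto F' (𝓝[<] 1) (𝓝 (F' 1)) :=
      ((hF' _ ht).mono_of_mem_nhdsWithin (mem_of_superset hI Ioo_subset_Icc_self))
    refine h2.congr' ?_
    filter_upwards [hI] with s hs using (hd s hs).deriv.symm
  · exact (hd t ⟨h1, h2⟩).hasDerivWithinAt

theorem cosPolar_sq_of_mem_zAxis {x : Space3} (hx : x ≠ 0) (hz : x ∈ zAxis) :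
    cosPolar x ^ 2 = 1 := by
  have h1 := radiusSq_eq hx
  rw [(mem_zAxis_iff x).1 hz] at h1
  have := (mul_eq_zero.1 h1.symm).resolve_left (by positivity)
  linarith

theorem norm_gradCosPolar_sq {x : Space3} (hx : x ≠ 0) :
    ‖gradCosPolar x‖ ^ 2 = (1 - cosPolar x ^ 2) / ‖x‖ ^ 2 := by
  have hn := norm_ne_zero_iff.2 hx
  have h2 := cosPolar_mul_norm hx
  have h1 := radiusSq_add x
  rw [radiusSq] at h1
  have h3 : ‖gradCosPolar x‖ ^ 2 = (‖x‖⁻¹) ^ 2 * (1 - 2 * (cosPolar x / ‖x‖) * x 2 +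
      (cosPolar x / ‖x‖) ^ 2 * (x 0 ^ 2 + x 1 ^ 2 + x 2 ^ 2)) := by
    rw [normsq_eq_sum]; simp [gradCosPolar]; ring
  rw [h3, h1, ← h2]
  field_simp
  ring

theorem cylRadius_nonneg (x : Space3) : 0 ≤ cylRadius x := Real.sqrt_nonneg _

/-- The gradient of cos θ has norm r/ρ², and r² = ρ²(1 - t²). Hence a factor 1/(1 - t²) in a
derivative is compensated by a field that vanishes like r. -/
theorem norm_gradCosPolar_mul {x : Space3} (hx : x ≠ 0) :
    ‖gradCosPolar x‖ * cylRadius x = 1 - cosPolar x ^ 2 := by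
  have hT : 0 ≤ 1 - cosPolar x ^ 2 := by
    have := (sq_le_one_iff_abs_le_one _).2 (abs_le.2 (cosPolar_mem_Icc x)); linarith
  refine (pow_left_inj₀ (mul_nonneg (norm_nonneg _) (cylRadius_nonneg x)) hT two_ne_zero).1 ?_
  have hn := norm_ne_zero_iff.2 hx
  rw [mul_pow, norm_gradCosPolar_sq hx, cylRadius_sq, radiusSq_eq hx]
  field_simp

theorem contDiffOn_norm_rpow (q : ℝ) {n : WithTop ℕ∞} :
    ContDiffOn ℝ n (fun x : Space3 => ‖x‖ ^ q) {0}ᶜ := by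
  intro x hx
  exact ((contDiffAt_id.norm ℝ hx).rpow_const_of_ne (norm_ne_zero_iff.2 hx)).contDiffWithinAt

theorem contDiffOn_cosPolar {n : WithTop ℕ∞} : ContDiffOn ℝ n cosPolar {0}ᶜ := by
  intro x hx
  exact ((EuclideanSpace.proj 2 : Space3 →L[ℝ] ℝ).contDiff.contDiffAt.div (contDiffAt_id.norm ℝ hx)
    (norm_ne_zero_iff.2 hx)).contDiffWithinAt

theorem contDiffOn_gradCosPolar {n : WithTop ℕ∞} : ContDiffOn ℝ n gradCosPolar {0}ᶜ := by
  have h1 : ContDiffOn ℝ n (fun x : Space3 => ‖x‖⁻¹) {0}ᶜ := fun x hx =>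
    ((contDiffAt_id.norm ℝ hx).inv (norm_ne_zero_iff.2 hx)).contDiffWithinAt
  exact h1.smul (contDiffOn_const.sub ((contDiffOn_cosPolar.mul h1).smul contDiffOn_id))

theorem ContinuousOn.comp_cosPolar {H : ℝ → ℝ} (h : ContinuousOn H (Icc (-1) 1)) :
    ContinuousOn (fun x => H (cosPolar x)) {0}ᶜ :=
  h.comp (contDiffOn_cosPolar (n := 0)).continuousOn fun x _ => cosPolar_mem_Icc x

/-- A `C¹` map that vanishes on the axis is bounded by a multiple of the distance to the axis. -/
theorem eventually_norm_le_mul_cylRadius {E : Type*} [NormedAddCommGroup E] [NormedSpace ℝ E]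
    {q : Space3 → E} {x : Space3} (hq : ContDiffAt ℝ 1 q x) (hz : x ∈ zAxis) (hx : x ≠ 0)
    (hq0 : ∀ y ∈ zAxis, y ≠ 0 → q y = 0) :
    ∃ C : ℝ, ∀ᶠ y in 𝓝 x, ‖q y‖ ≤ C * cylRadius y := by
  obtain ⟨C, s, hs, hC⟩ := hq.exists_lipschitzOnWith
  -- This is the projection onto the axis, where q vanishes; it moves y by the distance r, so a
  -- local Lipschitz bound suffices.
  have hP : Continuous fun y : Space3 => y - horizontal y := by fun_prop
  obtain ⟨h0, h1⟩ := coords_eq_zero_of_cylRadius_eq_zero hz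
  have hPx : x - horizontal x = x := by
    have : horizontal x = 0 := by ext i; fin_cases i <;> simp [h0, h1]
    rw [this, sub_zero]
  have hPs : ∀ᶠ y in 𝓝 x, y - horizontal y ∈ s ∩ {0}ᶜ := by
    have := hP.tendsto x
    rw [hPx] at this
    exact this (inter_mem hs (isOpen_compl_origin.mem_nhds hx))
  refine ⟨C, ?_⟩
  filter_upwards [hs, hPs] with y hy hy'
  have hmem : y - horizontal y ∈ zAxis := (mem_zAxis_iff _).2 (by simp [radiusSq])
  have := hC.dist_le_mul y hy _ hy'.1
  rw [dist_eq_norm, dist_eq_norm, hq0 _ hmem hy'.2, sub_zero, sub_sub_cancel] at this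
  have hn : ‖horizontal y‖ = cylRadius y := by
    refine (pow_left_inj₀ (norm_nonneg _) (cylRadius_nonneg y) two_ne_zero).1 ?_
    rw [cylRadius_sq, normsq_eq_sum, radiusSq]; simp
  rwa [hn] at this

namespace HasAxisDeriv

variable {H K : ℝ → ℝ} {E : Type*} [NormedAddCommGroup E] [NormedSpace ℝ E] {q : Space3 → E}

/-- The derivative of `H(cos θ) q`. -/
noncomputable def derivSmul (H K : ℝ → ℝ) (q : Space3 → E) (x : Space3) : Space3 →L[ℝ] E :=
  H (cosPolar x) • fderiv ℝ q x +
    (innerSL ℝ (gradCosPolar x)).smulRight ((K (cosPolar x) / (1 - cosPolar x ^ 2)) • q x)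

/-- On the axis continuity of H is enough: q is O(|y - x|), so replacing H(cos θ) by its value at x
changes the product by o(|y - x|). Off the axis this is the product rule. -/
theorem hasFDerivAt_smul (h : HasAxisDeriv H K) (hq : ContDiffOn ℝ 1 q {0}ᶜ)
    (hq0 : ∀ x ∈ zAxis, x ≠ 0 → q x = 0) {x : Space3} (hx : x ≠ 0) :
    HasFDerivAt (fun x => H (cosPolar x) • q x) (derivSmul H K q x) x := by
  have hqd : HasFDerivAt q (fderiv ℝ q x) x :=
    ((hq.differentiableOn one_ne_zero).differentiableAt (isOpen_compl_origin.mem_nhds hx)).hasFDerivAt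
  by_cases hz : x ∈ zAxis
  · have hqx := hq0 x hz hx
    have hHc : Tendsto (fun y => H (cosPolar y) - H (cosPolar x)) (𝓝 x) (𝓝 0) := by
      have := ((ContinuousOn.comp_cosPolar h.continuousOn).continuousAt
        (isOpen_compl_origin.mem_nhds hx)).tendsto.sub_const (H (cosPolar x))
      rwa [sub_self] at this
    have h1 : (fun y => (H (cosPolar y) - H (cosPolar x)) • q y) =o[𝓝 x] fun y => y - x := by
      have h2 : q =O[𝓝 x] fun y => y - x := by
        have := hqd.isBigO_sub
        simpa [hqx] using this
      have h3 := ((Asymptotics.isLittleO_one_iff ℝ).2 hHc).smul_isBigO h2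
      simpa using h3
    have h2 := (hasFDerivAt_iff_isLittleO.1 hqd).const_smul_left (H (cosPolar x))
    rw [hasFDerivAt_iff_isLittleO]
    refine (h1.add h2).congr_left fun y => ?_
    simp only [derivSmul, hqx, smul_zero, sub_zero, add_apply, smul_apply,
      ContinuousLinearMap.smulRight_apply, add_zero, Pi.smul_apply, smul_sub, sub_smul]
    abel
  · refine (((h.hasDerivAt _ (cosPolar_mem_Ioo hz)).comp_hasFDerivAt x
      (hasFDerivAt_cosPolar hx)).fun_smul hqd).congr_fderiv ?_
    ext v
    simp [derivSmul, smul_smul, mul_comm]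

/-- Near the axis the term with H' is at most C|K(cos θ)|, by `norm_gradCosPolar_mul` and |q| ≤ Cr,
and K vanishes at ±1. -/
theorem continuousOn_derivSmul (h : HasAxisDeriv H K) (hq : ContDiffOn ℝ 1 q {0}ᶜ)
    (hq0 : ∀ x ∈ zAxis, x ≠ 0 → q x = 0) : ContinuousOn (derivSmul H K q) {0}ᶜ := by
  have h1 : ContinuousOn (fun x => H (cosPolar x) • fderiv ℝ q x) {0}ᶜ :=
    (ContinuousOn.comp_cosPolar h.continuousOn).smul
      (hq.continuousOn_fderiv_of_isOpen isOpen_compl_origin le_rfl)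
  have hK0 : ∀ y : Space3, y ≠ 0 → y ∈ zAxis → K (cosPolar y) = 0 := by
    intro y hy hyz
    have := cosPolar_sq_of_mem_zAxis hy hyz
    rw [sq, mul_self_eq_one_iff] at this
    rcases this with h4 | h4
    · rw [h4, h.right]
    · rw [h4, h.left]
  refine h1.add fun x hx => ?_
  by_cases hz : x ∈ zAxis
  · have hqx := hq0 x hz hx
    obtain ⟨C, hC⟩ := eventually_norm_le_mul_cylRadius
      (hq.contDiffAt (isOpen_compl_origin.mem_nhds hx)) hz hx hq0
    have hK : Tendsto (fun y => C * |K (cosPolar y)|) (𝓝 x) (𝓝 0) := by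
      have h2 := (((ContinuousOn.comp_cosPolar h.continuousOn_deriv).continuousAt
        (isOpen_compl_origin.mem_nhds hx)).abs).const_mul C
      simp only [ContinuousAt, hK0 x hx hz, abs_zero, mul_zero] at h2
      exact h2
    refine ContinuousAt.continuousWithinAt ?_
    rw [ContinuousAt, hqx, smul_zero, ContinuousLinearMap.smulRight_zero]
    refine squeeze_zero_norm' ?_ hK
    filter_upwards [hC, isOpen_compl_origin.mem_nhds hx] with y hy hy0
    rw [ContinuousLinearMap.norm_smulRight_apply, innerSL_apply_norm, norm_smul, norm_div,
      Real.norm_eq_abs]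
    by_cases hyz : y ∈ zAxis
    · rw [hq0 y hyz hy0, norm_zero, mul_zero, mul_zero, hK0 y hy0 hyz, abs_zero, mul_zero]
    · have hT := one_sub_cosPolar_sq_pos hyz
      rw [Real.norm_of_nonneg hT.le]
      calc ‖gradCosPolar y‖ * (|K (cosPolar y)| / (1 - cosPolar y ^ 2) * ‖q y‖)
          ≤ ‖gradCosPolar y‖ * (|K (cosPolar y)| / (1 - cosPolar y ^ 2) * (C * cylRadius y)) := by
            gcongr
        _ = ‖gradCosPolar y‖ * cylRadius y * (|K (cosPolar y)| / (1 - cosPolar y ^ 2) * C) := by ring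
        _ = C * |K (cosPolar y)| := by
            rw [norm_gradCosPolar_mul hy0]; field_simp
  · have hT := one_sub_cosPolar_sq_pos hz
    have hnhds := isOpen_compl_origin.mem_nhds hx
    have hc : ContinuousAt cosPolar x := (contDiffOn_cosPolar (n := 0)).continuousOn.continuousAt hnhds
    have hKc := (ContinuousOn.comp_cosPolar h.continuousOn_deriv).continuousAt hnhds
    have hg := (contDiffOn_gradCosPolar (n := 0)).continuousOn.continuousAt hnhds
    have hqc := hq.continuousOn.continuousAt hnhds
    have h2 : ContinuousAt (fun y => (K (cosPolar y) / (1 - cosPolar y ^ 2)) • q y) x :=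
      (hKc.div (continuousAt_const.sub (hc.pow 2)) hT.ne').smul hqc
    have h3 := ((innerSL ℝ : Space3 →L⋆[ℝ] Space3 →L[ℝ] ℝ).continuous.continuousAt.comp hg)
    exact (((ContinuousLinearMap.smulRightL ℝ Space3 E).continuous.continuousAt.comp h3).clm_apply
      h2).continuousWithinAt

theorem contDiffOn_smul (h : HasAxisDeriv H K) (hq : ContDiffOn ℝ 1 q {0}ᶜ)
    (hq0 : ∀ x ∈ zAxis, x ≠ 0 → q x = 0) :
    ContDiffOn ℝ 1 (fun x => H (cosPolar x) • q x) {0}ᶜ := by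
  rw [show (1 : WithTop ℕ∞) = 0 + 1 by norm_num,
    contDiffOn_succ_iff_fderiv_of_isOpen isOpen_compl_origin]
  exact ⟨fun x hx => (h.hasFDerivAt_smul hq hq0 hx).differentiableAt.differentiableWithinAt,
    by simp, contDiffOn_zero.2 ((h.continuousOn_derivSmul hq hq0).congr fun x hx =>
      (h.hasFDerivAt_smul hq hq0 hx).fderiv)⟩

/-- The derivative is F'(cos θ) times ∇cos θ, a smooth field off the origin that vanishes on the
axis, so `contDiffOn_smul` applies to it. -/
theorem contDiffOn_two_comp {F F' : ℝ → ℝ} (hF : ContinuousOn F (Icc (-1) 1))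
    (hd : ∀ t ∈ Ioo (-1 : ℝ) 1, HasDerivAt F (F' t) t) (h : HasAxisDeriv F' K) :
    ContDiffOn ℝ 2 (fun x => F (cosPolar x)) {0}ᶜ := by
  have hd' := hasDerivWithinAt_Icc_of_Ioo hF hd h.continuousOn
  have hf : ∀ x : Space3, x ≠ 0 →
      HasFDerivAt (fun x => F (cosPolar x)) (F' (cosPolar x) • innerSL ℝ (gradCosPolar x)) x := by
    intro x hx
    rw [← hasFDerivWithinAt_univ]
    exact (hd' _ (cosPolar_mem_Icc x)).comp_hasFDerivWithinAt x
      (hasFDerivAt_cosPolar hx).hasFDerivWithinAt fun y _ => cosPolar_mem_Icc y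
  rw [show (2 : WithTop ℕ∞) = 1 + 1 by norm_num,
    contDiffOn_succ_iff_fderiv_of_isOpen isOpen_compl_origin]
  refine ⟨fun x hx => (hf x hx).differentiableAt.differentiableWithinAt, by simp, ?_⟩
  refine (h.contDiffOn_smul (q := fun x => innerSL ℝ (gradCosPolar x))
    ((innerSL ℝ : Space3 →L⋆[ℝ] Space3 →L[ℝ] ℝ).contDiff.comp_contDiffOn contDiffOn_gradCosPolar)
    fun x hz hx => ?_).congr fun x hx => (hf x hx).fderiv
  have h1 := norm_gradCosPolar_sq hx
  rw [cosPolar_sq_of_mem_zAxis hx hz, sub_self, zero_div, sq_eq_zero_iff, norm_eq_zero] at h1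
  rw [h1, map_zero]

end HasAxisDeriv

namespace IsProfile

variable {β : ℝ} {w w₁ : ℝ → ℝ}

theorem one_sub_sq_pos {t : ℝ} (ht : t ∈ Ioo (-1 : ℝ) 1) : 0 < 1 - t ^ 2 := by
  have := (sq_lt_one_iff_abs_lt_one t).2 (abs_lt.2 ht)
  linarith

theorem profileQuot_mul (_h : IsProfile β w w₁) {t : ℝ} (ht : t ∈ Ioo (-1 : ℝ) 1) :
    profileQuot w w₁ t * (1 - t ^ 2) = w t := by
  have := one_sub_sq_pos ht
  rw [profileQuot, if_neg (by linarith), div_mul_cancel₀ _ this.ne']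

theorem eq_zero_of_sq_eq_one (h : IsProfile β w w₁) {t : ℝ} (ht : t ^ 2 = 1) : w t = 0 := by
  rw [sq, mul_self_eq_one_iff] at ht
  rcases ht with rfl | rfl
  · exact h.boundary_right
  · exact h.boundary_left

theorem mem_Ioo_or_sq {t : ℝ} (ht : t ∈ Icc (-1 : ℝ) 1) : t ∈ Ioo (-1 : ℝ) 1 ∨ t ^ 2 = 1 := by
  by_cases h : t ^ 2 = 1
  · exact Or.inr h
  · refine Or.inl (abs_lt.1 ((sq_lt_one_iff_abs_lt_one t).1 (lt_of_le_of_ne ?_ h)))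
    exact (sq_le_one_iff_abs_le_one t).2 (abs_le.2 ht)

/-- At an end point e one has w(e) = 0 and e² = 1, so w(t)/(1 - t²) is minus the difference quotient
of w divided by t + e. Its limit is -w'(e)/(2e) = -e w'(e)/2. -/
theorem continuousOn_profileQuot (h : IsProfile β w w₁) :
    ContinuousOn (profileQuot w w₁) (Icc (-1) 1) := by
  intro e he
  rcases mem_Ioo_or_sq he with hI | he1
  · exact (h.hasDerivAt_profileQuot hI).continuousAt.continuousWithinAt
  have he0 : e ≠ 0 := by rintro rfl; norm_num at he1
  have hs := hasDerivWithinAt_iff_tendsto_slope.1 (h.hasDerivWithinAt e he)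
  rw [← continuousWithinAt_sdiff_self, ContinuousWithinAt]
  have h1 : Tendsto (fun t : ℝ => t + e) (𝓝[Icc (-1) 1 \ {e}] e) (𝓝 (e + e)) :=
    ((continuous_id.add continuous_const).tendsto e).mono_left nhdsWithin_le_nhds
  have h2 := (hs.div h1 (by intro h0; apply he0; linarith)).neg
  have h3 : -(w₁ e / (e + e)) = profileQuot w w₁ e := by
    rw [profileQuot, if_pos he1]
    field_simp
    rw [he1]; ring
  rw [h3] at h2
  refine h2.congr' ?_
  filter_upwards [self_mem_nhdsWithin, h1.eventually_ne (show e + e ≠ 0 by simpa using he0)]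
    with t ht hee
  have hte : t - e ≠ 0 := sub_ne_zero.2 ht.2
  have e2 : 1 - t ^ 2 = -((t - e) * (t + e)) := by linear_combination -he1
  have h1t : 1 - t ^ 2 ≠ 0 := by
    rw [e2]; exact neg_ne_zero.2 (mul_ne_zero hte hee)
  show -(slope w e t / (t + e)) = _
  rw [slope_def_field, h.eq_zero_of_sq_eq_one he1, sub_zero, profileQuot,
    if_neg fun h0 => h1t (by linarith), e2]
  field_simp

/-- The end value -t w'/2 of the quotient is exactly the one for which w' + 2t w/(1 - t²) vanishes
at ±1. -/
theorem hasAxisDeriv_profileQuot (h : IsProfile β w w₁) :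
    HasAxisDeriv (profileQuot w w₁) (fun t => w₁ t + 2 * t * profileQuot w w₁ t) where
  continuousOn := h.continuousOn_profileQuot
  continuousOn_deriv := h.continuousOn.add (ContinuousOn.mul (by fun_prop) h.continuousOn_profileQuot)
  hasDerivAt := fun t ht => h.hasDerivAt_profileQuot ht
  right := by rw [profileQuot, if_pos (by norm_num)]; ring
  left := by rw [profileQuot, if_pos (by norm_num)]; ring

theorem hasAxisDeriv_slope (h : IsProfile β w w₁) (hβ : 0 < β) : HasAxisDeriv w₁
    (fun t => -(β * (β + 1) * w t + (1 + 1 / β) * (w t * |w t| ^ (2 / β)))) where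
  continuousOn := h.continuousOn
  continuousOn_deriv := ((h.continuousOn_w.const_mul _).add
    (((continuous_mul_abs_rpow (exponent_gt (Or.inl hβ))).comp_continuousOn
      h.continuousOn_w).const_mul _)).neg
  hasDerivAt := h.equation
  right := by rw [h.boundary_right]; ring
  left := by rw [h.boundary_left]; ring

/-- Writing the function as w|w|^r/(1 - t²) puts the signed power, which is differentiable, in place
of |w|^r, which need not be differentiable at zeros of w. -/
theorem hasAxisDeriv_profileQuot_mul_rpow (h : IsProfile β w w₁) {r : ℝ} (hr : 0 < r) :
    HasAxisDeriv (fun t => profileQuot w w₁ t * |w t| ^ r)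
      (fun t => (1 + r) * |w t| ^ r * w₁ t + 2 * t * (profileQuot w w₁ t * |w t| ^ r)) where
  continuousOn := h.continuousOn_profileQuot.mul ((continuous_abs_rpow hr.le).comp_continuousOn
    h.continuousOn_w)
  continuousOn_deriv := by
    have h1 := (continuous_abs_rpow hr.le).comp_continuousOn h.continuousOn_w
    exact ((h1.const_mul (1 + r)).mul h.continuousOn).add
      (ContinuousOn.mul (by fun_prop) (h.continuousOn_profileQuot.mul h1))
  hasDerivAt := fun t ht => by
    have h1 := one_sub_sq_pos ht
    have h2 := ((hasDerivAt_mul_abs_rpow hr (w t)).comp t (h.hasDerivAt ht)).div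
      (((hasDerivAt_id t).pow 2).const_sub 1) h1.ne'
    have h3 : (fun t => profileQuot w w₁ t * |w t| ^ r) =ᶠ[𝓝 t]
        fun s => (w s * |w s| ^ r) / (1 - s ^ 2) := by
      filter_upwards [isOpen_Ioo.mem_nhds ht] with s hs
      rw [← h.profileQuot_mul hs]
      have := one_sub_sq_pos hs
      field_simp
    refine (h2.congr_of_eventuallyEq h3).congr_deriv ?_
    have h4 := h.profileQuot_mul ht
    simp only [Function.comp, id, Pi.pow_apply]
    field_simp
    rw [← h4]; push_cast; ring
  right := by simp [h.boundary_right, Real.zero_rpow hr.ne']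
  left := by simp [h.boundary_left, Real.zero_rpow hr.ne']

/-- The continuous extension of `w''`. -/
noncomputable def secondDeriv (β : ℝ) (w w₁ : ℝ → ℝ) (t : ℝ) : ℝ :=
  -(β * (β + 1)) * profileQuot w w₁ t +
    -(1 + 1 / β) * (profileQuot w w₁ t * |w t| ^ (2 / β))

theorem hasDerivAt_slope (h : IsProfile β w w₁) {t : ℝ} (ht : t ∈ Ioo (-1 : ℝ) 1) :
    HasDerivAt w₁ (secondDeriv β w w₁ t) t := by
  refine (h.equation t ht).congr_deriv ?_
  have h1 := one_sub_sq_pos ht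
  rw [secondDeriv, div_eq_iff h1.ne']
  linear_combination (β * (β + 1) + (1 + 1 / β) * |w t| ^ (2 / β)) * h.profileQuot_mul ht

theorem exists_hasAxisDeriv_secondDeriv (h : IsProfile β w w₁) (hβ : 0 < β) :
    ∃ K, HasAxisDeriv (secondDeriv β w w₁) K :=
  ⟨_, ((HasAxisDeriv.const _).mul h.hasAxisDeriv_profileQuot).add
    ((HasAxisDeriv.const _).mul (h.hasAxisDeriv_profileQuot_mul_rpow (by positivity)))⟩

/-- The continuous extension of the derivative of `w / (1 - t²)`. -/
noncomputable def quotDeriv (β : ℝ) (w w₁ : ℝ → ℝ) (t : ℝ) : ℝ :=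
  if t ^ 2 = 1 then -(t * (secondDeriv β w w₁ t + 2 * profileQuot w w₁ t)) / 4
  else (w₁ t + 2 * t * profileQuot w w₁ t) / (1 - t ^ 2)

theorem quotDeriv_of_mem (w w₁ : ℝ → ℝ) {t : ℝ} (ht : t ∈ Ioo (-1 : ℝ) 1) : quotDeriv β w w₁ t =
    (w₁ t + 2 * t * profileQuot w w₁ t) / (1 - t ^ 2) :=
  if_neg (by linarith [one_sub_sq_pos ht])

/-- L'Hôpital's rule for ((1 - t²)w' + 2tw)/(1 - t²)²: after cancelling 1 - t² the quotient of
derivatives is -(w'' + 2w/(1 - t²))/(4t). The rule enters as the hypothesis `hop`, so that one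
argument serves both end points. -/
theorem tendsto_quotDeriv (h : IsProfile β w w₁) (hβ : 0 < β) {e : ℝ} (he : e ^ 2 = 1) {l : Filter ℝ}
    (hl : l ≤ 𝓝[Icc (-1) 1] e) (hI : Ioo (-1 : ℝ) 1 ∈ l)
    (hop : ∀ {f f' g g' : ℝ → ℝ} {m : Filter ℝ}, (∀ᶠ x in l, HasDerivAt f (f' x) x) →
      (∀ᶠ x in l, HasDerivAt g (g' x) x) → (∀ᶠ x in l, g' x ≠ 0) → Tendsto f l (𝓝 0) →
      Tendsto g l (𝓝 0) → Tendsto (fun x => f' x / g' x) l m → Tendsto (fun x => f x / g x) l m) :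
    Tendsto (quotDeriv β w w₁) l (𝓝 (quotDeriv β w w₁ e)) := by
  have heI : e ∈ Icc (-1 : ℝ) 1 := abs_le.1 ((sq_le_one_iff_abs_le_one e).1 he.le)
  have he0 : e ≠ 0 := by rintro rfl; norm_num at he
  obtain ⟨K, hK⟩ := h.exists_hasAxisDeriv_secondDeriv hβ
  have hid : Tendsto (fun t : ℝ => t) l (𝓝 e) := hl.trans nhdsWithin_le_nhds
  have hw : Tendsto w l (𝓝 0) := by
    have := (h.continuousOn_w e heI).mono_left hl
    rwa [h.eq_zero_of_sq_eq_one he] at this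
  have hw₁ : Tendsto w₁ l (𝓝 (w₁ e)) := (h.continuousOn e heI).mono_left hl
  have hw₂ : Tendsto (secondDeriv β w w₁) l (𝓝 (secondDeriv β w w₁ e)) :=
    (hK.continuousOn e heI).mono_left hl
  have hφ : Tendsto (profileQuot w w₁) l (𝓝 (profileQuot w w₁ e)) :=
    (h.continuousOn_profileQuot e heI).mono_left hl
  have hsq : Tendsto (fun t : ℝ => 1 - t ^ 2) l (𝓝 0) := by
    have := (hid.pow 2).const_sub 1
    rwa [he, sub_self] at this
  have hne : ∀ᶠ t in l, t ≠ 0 := hid.eventually_ne he0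
  have key := hop (f := fun t => w₁ t * (1 - t ^ 2) + 2 * t * w t)
    (f' := fun t => secondDeriv β w w₁ t * (1 - t ^ 2) + 2 * w t)
    (g := fun t => (1 - t ^ 2) ^ 2) (g' := fun t => -(4 * t) * (1 - t ^ 2))
    (m := 𝓝 (quotDeriv β w w₁ e)) ?_ ?_ ?_ ?_ ?_ ?_
  · refine key.congr' ?_
    filter_upwards [hI] with t ht
    rw [quotDeriv_of_mem w w₁ ht]
    have h1 := one_sub_sq_pos ht
    have h2 := h.profileQuot_mul ht
    nth_rw 1 [← h2]
    field_simp
  · filter_upwards [hI] with t ht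
    have h1 : HasDerivAt (fun t : ℝ => 1 - t ^ 2) (-(2 * t)) t := by
      simpa using ((hasDerivAt_id t).pow 2).const_sub 1
    have h2 : HasDerivAt (fun t : ℝ => 2 * t) 2 t := by
      simpa using (hasDerivAt_id t).const_mul 2
    exact (((h.hasDerivAt_slope ht).fun_mul h1).fun_add (h2.fun_mul (h.hasDerivAt ht))).congr_deriv
      (by ring)
  · refine Eventually.of_forall fun t => ?_
    have h1 : HasDerivAt (fun t : ℝ => 1 - t ^ 2) (-(2 * t)) t := by
      simpa using ((hasDerivAt_id t).pow 2).const_sub 1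
    exact (h1.fun_pow 2).congr_deriv (by push_cast; ring)
  · filter_upwards [hI, hne] with t ht ht0
    exact mul_ne_zero (by simpa using ht0) (one_sub_sq_pos ht).ne'
  · have := (hw₁.mul hsq).add ((hid.const_mul 2).mul hw)
    simpa using this
  · simpa using hsq.pow 2
  · have h1 : Tendsto (fun t => -(secondDeriv β w w₁ t + 2 * profileQuot w w₁ t) / (4 * t)) l
        (𝓝 (-(secondDeriv β w w₁ e + 2 * profileQuot w w₁ e) / (4 * e))) :=
      (hw₂.add (hφ.const_mul 2)).neg.div (hid.const_mul 4) (by simpa using he0)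
    have h2 : -(secondDeriv β w w₁ e + 2 * profileQuot w w₁ e) / (4 * e) = quotDeriv β w w₁ e := by
      rw [quotDeriv, if_pos he]
      field_simp
      rw [he]; ring
    rw [h2] at h1
    refine h1.congr' ?_
    filter_upwards [hI, hne] with t ht ht0
    have h3 := one_sub_sq_pos ht
    rw [← h.profileQuot_mul ht]
    field_simp

/-- Differentiating once more leaves a single division by 1 - t². Its numerator vanishes at ±1,
since there the end value of `quotDeriv` satisfies 4t φ' = -(w'' + 2φ) with φ = w/(1 - t²). -/
theorem hasAxisDeriv_quotDeriv (h : IsProfile β w w₁) (hβ : 0 < β) :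
    HasAxisDeriv (quotDeriv β w w₁) (fun t => secondDeriv β w w₁ t + 4 * t * quotDeriv β w w₁ t +
      2 * profileQuot w w₁ t) := by
  obtain ⟨K, hK⟩ := h.exists_hasAxisDeriv_secondDeriv hβ
  have hd : ∀ t ∈ Ioo (-1 : ℝ) 1, HasDerivAt (quotDeriv β w w₁)
      ((secondDeriv β w w₁ t + 4 * t * quotDeriv β w w₁ t + 2 * profileQuot w w₁ t) / (1 - t ^ 2))
      t := by
    intro t ht
    have h1 := one_sub_sq_pos ht
    have h2 : HasDerivAt (fun t : ℝ => 1 - t ^ 2) (-(2 * t)) t := by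
      simpa using ((hasDerivAt_id t).pow 2).const_sub 1
    have h3 : HasDerivAt (fun t : ℝ => 2 * t) 2 t := by
      simpa using (hasDerivAt_id t).const_mul 2
    have h4 := (((h.hasDerivAt_slope ht).fun_add (h3.fun_mul (h.hasDerivAt_profileQuot ht)))).fun_div h2
      h1.ne'
    have h5 : quotDeriv β w w₁ =ᶠ[𝓝 t] fun t => (w₁ t + 2 * t * profileQuot w w₁ t) / (1 - t ^ 2) := by
      filter_upwards [isOpen_Ioo.mem_nhds ht] with s hs using quotDeriv_of_mem w w₁ hs
    refine (h4.congr_of_eventuallyEq h5).congr_deriv ?_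
    rw [quotDeriv_of_mem w w₁ ht]
    field_simp
    ring
  have hc : ContinuousOn (quotDeriv β w w₁) (Icc (-1) 1) := by
    intro t ht
    rcases mem_Ioo_or_sq ht with hI | h1
    · exact (hd t hI).continuousAt.continuousWithinAt
    have hop := h1
    rw [sq, mul_self_eq_one_iff] at h1
    rcases h1 with rfl | rfl
    · have hI : Ioo (-1 : ℝ) 1 ∈ 𝓝[<] (1 : ℝ) := Ioo_mem_nhdsLT (by norm_num)
      have h2 : ContinuousWithinAt (quotDeriv β w w₁) (Iio 1) 1 :=
        h.tendsto_quotDeriv hβ hop (nhdsWithin_le_iff.2 (mem_of_superset hI Ioo_subset_Icc_self)) hI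
          HasDerivAt.lhopital_zero_nhdsLT
      exact (continuousWithinAt_Iio_iff_Iic.1 h2).mono Icc_subset_Iic_self
    · have hI : Ioo (-1 : ℝ) 1 ∈ 𝓝[>] (-1 : ℝ) := Ioo_mem_nhdsGT (by norm_num)
      have h2 : ContinuousWithinAt (quotDeriv β w w₁) (Ioi (-1)) (-1) :=
        h.tendsto_quotDeriv hβ hop (nhdsWithin_le_iff.2 (mem_of_superset hI Ioo_subset_Icc_self)) hI
          HasDerivAt.lhopital_zero_nhdsGT
      exact (continuousWithinAt_Ioi_iff_Ici.1 h2).mono Icc_subset_Ici_self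
  exact ⟨hc, (hK.continuousOn.add (ContinuousOn.mul (by fun_prop) hc)).add
    (h.continuousOn_profileQuot.const_mul 2), hd,
    by rw [quotDeriv, if_pos (by norm_num)]; ring, by rw [quotDeriv, if_pos (by norm_num)]; ring⟩

end IsProfile

/-! ### Classical solutions for α > 2. -/

theorem angular_eq_zero_of_mem_zAxis {x : Space3} (hx : x ∈ zAxis) : angular x = 0 := by
  obtain ⟨h0, h1⟩ := coords_eq_zero_of_cylRadius_eq_zero hx
  ext i; fin_cases i <;> simp [h0, h1]

theorem mem_closure_compl_zAxis (x : Space3) : x ∈ closure (zAxisᶜ : Set Space3) := by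
  by_cases hx : x ∈ zAxis
  · obtain ⟨h0, h1⟩ := coords_eq_zero_of_cylRadius_eq_zero hx
    have hc : Continuous fun s : ℝ => x + s • (EuclideanSpace.single 0 1 : Space3) := by fun_prop
    have ht : Tendsto (fun s : ℝ => x + s • (EuclideanSpace.single 0 1 : Space3)) (𝓝[≠] 0) (𝓝 x) := by
      have := (hc.tendsto 0).mono_left (nhdsWithin_le_nhds (s := {0}ᶜ))
      simpa using this
    refine mem_closure_of_tendsto ht ?_
    filter_upwards [self_mem_nhdsWithin] with s hs
    refine (notMem_zAxis_iff _).2 ?_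
    have : s ≠ 0 := hs
    simp [radiusSq, h0, h1]
    positivity
  · exact subset_closure hx

/-- A continuous function on the punctured space that vanishes off the axis vanishes. -/
theorem eq_zero_of_eq_zero_off_axis {F : Type*} [TopologicalSpace F] [T2Space F] [Zero F]
    {f : Space3 → F} (hf : ContinuousOn f {0}ᶜ) (h : ∀ x, x ∉ zAxis → f x = 0) {x : Space3}
    (hx : x ≠ 0) : f x = 0 := by
  have := mem_closure_iff_nhdsWithin_neBot.1 (mem_closure_compl_zAxis x)
  have h1 : Tendsto f (𝓝[zAxisᶜ] x) (𝓝 (f x)) :=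
    (hf.continuousAt (isOpen_compl_origin.mem_nhds hx)).tendsto.mono_left nhdsWithin_le_nhds
  have h2 : Tendsto f (𝓝[zAxisᶜ] x) (𝓝 0) := by
    refine tendsto_const_nhds.congr' ?_
    filter_upwards [self_mem_nhdsWithin] with y hy using (h y hy).symm
  exact tendsto_nhds_unique h1 h2

theorem continuousOn_curl {u : Space3 → Space3} {O : Set Space3} (hO : IsOpen O)
    (hu : ContDiffOn ℝ 1 u O) : ContinuousOn (curl u) O := by
  have hp : ∀ i j, ContinuousOn (pderiv u i j) O := fun i j =>
    (EuclideanSpace.proj j : Space3 →L[ℝ] ℝ).continuous.comp_continuousOn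
      ((hu.continuousOn_fderiv_of_isOpen hO le_rfl).clm_apply continuousOn_const)
  refine (PiLp.continuous_toLp 2 _).comp_continuousOn (continuousOn_pi.2 fun i => ?_)
  fin_cases i
  · exact (hp 1 2).sub (hp 2 1)
  · exact (hp 2 0).sub (hp 0 2)
  · exact (hp 0 1).sub (hp 1 0)

/-- A differentiable Beltrami field satisfies the Euler equation with the Bernoulli pressure. -/
theorem euler_of_isBeltrami {u : Space3 → Space3} (hb : IsBeltrami u) {x : Space3} (hx : x ≠ 0)
    (hd : DifferentiableAt ℝ u x) :
    fderiv ℝ u x (u x) + gradient (bernoulliPressure u) x = 0 := by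
  have h1 : HasFDerivAt (bernoulliPressure u)
      (-((2 : ℝ)⁻¹ • (2 • (innerSL ℝ (u x)).comp (fderiv ℝ u x)))) x := by
    have := ((hd.hasFDerivAt.norm_sq).const_mul (2 : ℝ)⁻¹).fun_neg
    refine this.congr_of_eventuallyEq (Eventually.of_forall fun y => ?_)
    simp only [bernoulliPressure]; ring
  refine ext_inner_right ℝ fun v => ?_
  rw [inner_add_left, inner_fderiv_of_isBeltrami hb hx, gradient, InnerProductSpace.toDual_symm_apply,
    h1.fderiv, real_inner_comm]
  simp

theorem contDiff_radiusSq {n : WithTop ℕ∞} : ContDiff ℝ n radiusSq := by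
  have hp : ∀ i : Fin 3, ContDiff ℝ n (fun y : Space3 => y i) := fun i =>
    (EuclideanSpace.proj i : Space3 →L[ℝ] ℝ).contDiff
  exact ((hp 0).pow 2).add ((hp 1).pow 2)

namespace IsProfile

variable {β : ℝ} {w w₁ : ℝ → ℝ} {x : Space3}

/-- The rotation of the Beltrami field off the axis, where the circulation is differentiable. -/
theorem crossProduct_curl_off_axis (h : IsProfile β w w₁) (hβ : β ≠ 0) (hx : x ∉ zAxis)
    (hγ : HasDerivAt (circulation β) ((1 + 1 / β) * |streamFunction β w x| ^ (1 / β))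
      (streamFunction β w x)) :
    crossProduct (curl (beltramiField β w w₁) x).ofLp (beltramiField β w w₁ x).ofLp = 0 := by
  rw [beltramiField, (h.swirlField_off_axis hβ hx hγ).2.2]
  have e : (1 + 1 / β) * (streamFunction β w x * |streamFunction β w x| ^ (2 / β)) / radiusSq x =
      (1 + 1 / β) * |streamFunction β w x| ^ (1 / β) * swirlCoeff β (circulation β) w x := by
    have : |streamFunction β w x| ^ (2 / β) * streamFunction β w x =
        |streamFunction β w x| ^ (1 / β) * |streamFunction β w x| ^ (1 / β) * streamFunction β w x := by
      rcases eq_or_ne (streamFunction β w x) 0 with h0 | h0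
      · rw [h0, mul_zero, mul_zero]
      · rw [← Real.rpow_add (abs_pos.2 h0)]; congr 2; ring
    rw [swirlCoeff, circulation, mul_comm (streamFunction β w x), this]
    ring
  rw [e, mul_smul _ (swirlCoeff β (circulation β) w x), ← smul_add, ← smul_add, WithLp.ofLp_smul,
    map_smul, LinearMap.smul_apply]
  rw [show radialCoeff β w w₁ x • horizontal x + axialCoeff β w w₁ x • eZ +
    swirlCoeff β (circulation β) w x • angular x = swirlField β (circulation β) w w₁ x from rfl,
    cross_self, smul_zero]

/-- The coefficients involve w, w' and w/(1 - t²). Their derivatives w', w'' and `quotDeriv` all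
satisfy `HasAxisDeriv`, so each composition with cos θ is C². -/
theorem contDiffOn_poloidal (h : IsProfile β w w₁) (hβ : 0 < β) :
    ContDiffOn ℝ 2 (radialCoeff β w w₁) {0}ᶜ ∧ ContDiffOn ℝ 2 (axialCoeff β w w₁) {0}ᶜ := by
  obtain ⟨K, hK⟩ := h.exists_hasAxisDeriv_secondDeriv hβ
  have hw := HasAxisDeriv.contDiffOn_two_comp h.continuousOn_w (fun t ht => h.hasDerivAt ht)
    (h.hasAxisDeriv_slope hβ)
  have hw₁ := HasAxisDeriv.contDiffOn_two_comp h.continuousOn (fun t ht => h.hasDerivAt_slope ht) hK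
  have hφ := HasAxisDeriv.contDiffOn_two_comp h.continuousOn_profileQuot (fun t ht =>
    (h.hasDerivAt_profileQuot ht).congr_deriv (quotDeriv_of_mem w w₁ ht).symm)
    (h.hasAxisDeriv_quotDeriv hβ)
  exact ⟨(contDiffOn_norm_rpow _).mul (hw₁.neg.add (contDiffOn_const.mul (contDiffOn_cosPolar.mul hφ))),
    (contDiffOn_norm_rpow _).mul ((contDiffOn_cosPolar.mul hw₁).neg.sub (contDiffOn_const.mul hw))⟩

/-- The division by r² is absorbed into w/(1 - t²), which extends continuously to the axis. -/
theorem swirlCoeff_eq (h : IsProfile β w w₁) (hβ : β ≠ 0) (hx : x ∉ zAxis) :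
    swirlCoeff β (circulation β) w x = ‖x‖ ^ (-β - 3) *
      (profileQuot w w₁ (cosPolar x) * |w (cosPolar x)| ^ (1 / β)) := by
  have hx0 := ne_zero_of_notMem_zAxis hx
  have hn := norm_pos_iff.2 hx0
  have hT := one_sub_cosPolar_sq_pos hx
  have e : ‖x‖ ^ (-β - 1) = ‖x‖ ^ (-β - 3) * ‖x‖ ^ 2 := by
    rw [← Real.rpow_add_natCast hn.ne']; congr 1; push_cast; ring
  rw [swirlCoeff, streamFunction_eq, circulation_mul hβ hn, radiusSq_eq hx0, circulation, e,
    ← h.profileQuot_mul (cosPolar_mem_Ioo hx)]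
  field_simp

theorem contDiffOn_toroidal (h : IsProfile β w w₁) (hβ : 0 < β) :
    ContDiffOn ℝ 1 (fun x => swirlCoeff β (circulation β) w x • angular x) {0}ᶜ := by
  have hq : ContDiffOn ℝ 1 (fun x : Space3 => ‖x‖ ^ (-β - 3) • angular x) {0}ᶜ :=
    (contDiffOn_norm_rpow _).smul angular.contDiff.contDiffOn
  refine ((h.hasAxisDeriv_profileQuot_mul_rpow (r := 1 / β) (by positivity)).contDiffOn_smul hq
    fun x hx _ => ?_).congr fun x hx => ?_
  · rw [angular_eq_zero_of_mem_zAxis hx, smul_zero]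
  · by_cases hz : x ∈ zAxis
    · simp only [angular_eq_zero_of_mem_zAxis hz, smul_zero]
    · simp only [h.swirlCoeff_eq hβ.ne' hz, smul_smul, mul_comm]

/-- Squaring the swirl doubles the exponent: (Γ/r)² = ρ^(-2β-4) w φ|w|^(2/β) with φ = w/(1 - t²),
and the t-derivative is built from functions with `HasAxisDeriv`. This gives the pressure one
derivative more than the toroidal velocity is shown to have. -/
theorem contDiffOn_swirl_sq (h : IsProfile β w w₁) (hβ : 0 < β) :
    ContDiffOn ℝ 2 (fun x => swirlCoeff β (circulation β) w x ^ 2 * radiusSq x) {0}ᶜ := by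
  have hL := h.hasAxisDeriv_profileQuot_mul_rpow (r := 2 / β) (by positivity)
  have hP := HasAxisDeriv.contDiffOn_two_comp
    (F := fun t => w t * (profileQuot w w₁ t * |w t| ^ (2 / β)))
    (F' := fun t => (2 + 2 / β) * ((profileQuot w w₁ t * |w t| ^ (2 / β)) * w₁ t) +
      2 * (t * (profileQuot w w₁ t * (profileQuot w w₁ t * |w t| ^ (2 / β)))))
    (h.continuousOn_w.mul hL.continuousOn) (fun t ht => by
      refine ((h.hasDerivAt ht).fun_mul (hL.hasDerivAt t ht)).congr_deriv ?_
      have h1 := one_sub_sq_pos ht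
      have h2 := h.profileQuot_mul ht
      generalize profileQuot w w₁ t = φ at *
      generalize |w t| ^ (2 / β) = N at *
      rw [← h2]
      field_simp
      ring)
    (((HasAxisDeriv.const _).mul (hL.mul (h.hasAxisDeriv_slope hβ))).add
      ((HasAxisDeriv.const _).mul (HasAxisDeriv.id.mul (h.hasAxisDeriv_profileQuot.mul hL))))
  refine ((contDiffOn_norm_rpow (-2 * β - 4)).mul hP).congr fun x hx => ?_
  have hn := norm_pos_iff.2 hx
  by_cases hz : x ∈ zAxis
  · simp only [(mem_zAxis_iff x).1 hz, h.eq_zero_of_sq_eq_one (cosPolar_sq_of_mem_zAxis hx hz),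
      mul_zero, zero_mul]
  · have e : ‖x‖ ^ (-2 * β - 4) = ‖x‖ ^ (-β - 3) * ‖x‖ ^ (-β - 3) * ‖x‖ ^ 2 := by
      rw [← Real.rpow_add hn, ← Real.rpow_add_natCast hn.ne']; congr 1; push_cast; ring
    have e2 : |w (cosPolar x)| ^ (2 / β) = |w (cosPolar x)| ^ (1 / β) * |w (cosPolar x)| ^ (1 / β) := by
      rw [← Real.rpow_add_of_nonneg (abs_nonneg _) (by positivity) (by positivity)]; congr 1; ring
    simp only [h.swirlCoeff_eq hβ.ne' hz, radiusSq_eq hx, e, e2]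
    rw [← h.profileQuot_mul (cosPolar_mem_Ioo hz)]
    ring

/-- The azimuthal component of the rotation is a nonzero multiple of ψ|ψ|^(2/β). -/
theorem curl_beltramiField_ne_zero (h : IsProfile β w w₁) (hβ : β ≠ 0) (hβ1 : 1 + 1 / β ≠ 0)
    (hx : x ∉ zAxis) (hψ : streamFunction β w x ≠ 0) {γ' : ℝ}
    (hγ : HasDerivAt (circulation β) γ' (streamFunction β w x)) :
    curl (beltramiField β w w₁) x ≠ 0 := by
  intro h0
  have h1 := (h.swirlField_off_axis hβ hx hγ).2.2
  rw [beltramiField] at h0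
  have h2 : inner ℝ (curl (swirlField β (circulation β) w w₁) x) (angular x) = 0 := by
    rw [h0, inner_zero_left]
  have hr := ((notMem_zAxis_iff x).1 hx).ne'
  have hpow : |streamFunction β w x| ^ (2 / β) ≠ 0 :=
    (Real.rpow_pos_of_pos (abs_pos.2 hψ) _).ne'
  have h3 : inner ℝ (curl (swirlField β (circulation β) w w₁) x) (angular x) =
      (1 + 1 / β) * (streamFunction β w x * |streamFunction β w x| ^ (2 / β)) := by
    rw [h1]
    simp only [inner_eq_sum]
    simp
    field_simp
    simp only [radiusSq]
    ring
  rw [h3] at h2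
  exact mul_ne_zero hβ1 (mul_ne_zero hψ hpow) h2

end IsProfile

/-- The Beltrami solutions of class `C¹` for `α = β + 2 > 2`. -/
theorem exists_classical_beltrami {β : ℝ} (hβ : 0 < β) :
    ∃ (u : Space3 → Space3) (p : Space3 → ℝ),
      IsClassicalHomogeneousSolution (β + 2) u p ∧ IsBeltrami u ∧ IsRotational u ∧
      IsAxisymmetricOn u p {0}ᶜ ∧
      ContDiffOn ℝ 2 (poloidal u) {0}ᶜ ∧ ContDiffOn ℝ 2 p {0}ᶜ ∧
      ContDiffOn ℝ 1 (toroidal u) {0}ᶜ ∧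
      IsObtainedFromDirichlet (β + 2) u := by
  obtain ⟨w, w₁, h⟩ := exists_isProfile (Or.inl hβ)
  have hγ : ∀ s, HasDerivAt (circulation β) ((1 + 1 / β) * |s| ^ (1 / β)) s :=
    hasDerivAt_mul_abs_rpow (by positivity)
  obtain ⟨hA, hB⟩ := h.contDiffOn_poloidal hβ
  have hD := h.contDiffOn_toroidal hβ
  have hpol : ContDiffOn ℝ 2 (fun x => radialCoeff β w w₁ x • horizontal x +
      axialCoeff β w w₁ x • eZ) {0}ᶜ :=
    (hA.smul horizontal.contDiff.contDiffOn).add (hB.smul contDiffOn_const)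
  have hu : ContDiffOn ℝ 1 (beltramiField β w w₁) {0}ᶜ := (hpol.of_le (by norm_num)).add hD
  have hp : ContDiffOn ℝ 2 (bernoulliPressure (beltramiField β w w₁)) {0}ᶜ := by
    have h1 := (((((hA.pow 2).mul contDiff_radiusSq.contDiffOn).add (hB.pow 2)).add
      (h.contDiffOn_swirl_sq hβ)).div_const 2).neg
    refine h1.congr fun x _ => ?_
    rw [bernoulliPressure, beltramiField, swirlField, norm_axisymField_sq]
  have hcurl := continuousOn_curl isOpen_compl_origin hu
  have hbel : IsBeltrami (beltramiField β w w₁) := by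
    intro x hx
    refine eq_zero_of_eq_zero_off_axis
      (f := fun x => crossProduct (curl (beltramiField β w w₁) x).ofLp (beltramiField β w w₁ x).ofLp)
      ?_ (fun x hx => h.crossProduct_curl_off_axis hβ.ne' hx (hγ _)) hx
    have hc : ∀ i, ContinuousOn (fun x => curl (beltramiField β w w₁) x i) {0}ᶜ := fun i =>
      (EuclideanSpace.proj i : Space3 →L[ℝ] ℝ).continuous.comp_continuousOn hcurl
    have hv : ∀ i, ContinuousOn (fun x => beltramiField β w w₁ x i) {0}ᶜ := fun i =>
      (EuclideanSpace.proj i : Space3 →L[ℝ] ℝ).continuous.comp_continuousOn hu.continuousOn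
    simp only [cross_apply]
    refine continuousOn_pi.2 fun i => ?_
    fin_cases i
    · exact ((hc 1).mul (hv 2)).sub ((hc 2).mul (hv 1))
    · exact ((hc 2).mul (hv 0)).sub ((hc 0).mul (hv 2))
    · exact ((hc 0).mul (hv 1)).sub ((hc 1).mul (hv 0))
  have hdiv : ∀ x, x ≠ 0 → divergence (beltramiField β w w₁) x = 0 := fun x hx =>
    eq_zero_of_eq_zero_off_axis (continuousOn_divergence isOpen_compl_origin hu)
      (fun x hx => (h.swirlField_off_axis hβ.ne' hx (hγ _)).2.1) hx
  have hhom := isHomogeneousOn_beltramiField (w := w) (w₁ := w₁) hβ.ne' {0}ᶜ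
  refine ⟨beltramiField β w w₁, bernoulliPressure (beltramiField β w w₁),
    ⟨hu, hp.of_le (by norm_num), hhom, hhom.bernoulliPressure, fun x hx => ⟨?_, hdiv x hx⟩⟩, hbel, ?_,
    isAxisymmetricOn_beltramiField _, ?_, hp, ?_, h.isObtainedFromDirichlet (Or.inl hβ)⟩
  · exact euler_of_isBeltrami hbel hx
      ((hu.differentiableOn one_ne_zero).differentiableAt (isOpen_compl_origin.mem_nhds hx))
  · obtain ⟨x, hx, hψ⟩ := h.exists_streamFunction_ne_zero
    exact ⟨x, ne_zero_of_notMem_zAxis hx, h.curl_beltramiField_ne_zero hβ.ne' (by positivity) hx hψ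
      (hγ _)⟩
  · rw [beltramiField, swirlField, poloidal_axisymField]; exact hpol
  · rw [beltramiField, swirlField, toroidal_axisymField]; exact hD

/-! ### Regularity of the continuous fields for α < 0. -/

/-- A function of positive degree of homogeneity that is continuous off the origin is continuous. -/
theorem continuous_of_homogeneous {F : Type*} [NormedAddCommGroup F] [NormedSpace ℝ F]
    {f : Space3 → F} {d : ℝ} (hd : 0 < d) (hf : ContinuousOn f {0}ᶜ)
    (hh : ∀ l : ℝ, 0 < l → ∀ x, f (l • x) = l ^ d • f x) : Continuous f := by
  have h0 : f 0 = 0 := by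
    have h1 := hh 2 two_pos 0
    rw [smul_zero] at h1
    have h2 : ((2 : ℝ) ^ d - 1) • f 0 = 0 := by rw [sub_smul, one_smul, ← h1, sub_self]
    refine (smul_eq_zero.1 h2).resolve_left (sub_ne_zero.2 (Real.one_lt_rpow one_lt_two hd).ne')
  obtain ⟨M, hM⟩ := (isCompact_sphere (0 : Space3) 1).exists_bound_of_continuousOn
    (hf.mono fun x hx => by
      rw [mem_sphere_zero_iff_norm] at hx
      intro h; rw [mem_singleton_iff.1 h, norm_zero] at hx; norm_num at hx)
  have hb : ∀ x, ‖f x‖ ≤ M * ‖x‖ ^ d := by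
    intro x
    rcases eq_or_ne x 0 with rfl | hx
    · rw [h0, norm_zero, norm_zero, Real.zero_rpow hd.ne', mul_zero]
    · have hn := norm_pos_iff.2 hx
      have h1 := hh ‖x‖ hn (‖x‖⁻¹ • x)
      rw [smul_smul, mul_inv_cancel₀ hn.ne', one_smul] at h1
      rw [h1, norm_smul, Real.norm_of_nonneg (Real.rpow_nonneg hn.le _), mul_comm]
      refine mul_le_mul_of_nonneg_right (hM _ ?_) (Real.rpow_nonneg hn.le _)
      rw [mem_sphere_zero_iff_norm, norm_smul, norm_inv, norm_norm, inv_mul_cancel₀ hn.ne']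
  rw [continuous_iff_continuousAt]
  intro x
  rcases eq_or_ne x 0 with rfl | hx
  · rw [ContinuousAt, h0]
    have hc : Continuous fun x : Space3 => M * ‖x‖ ^ d :=
      continuous_const.mul (continuous_norm.rpow_const fun _ => Or.inr hd.le)
    have := hc.tendsto 0
    rw [norm_zero, Real.zero_rpow hd.ne', mul_zero] at this
    exact squeeze_zero_norm hb this
  · exact hf.continuousAt (isOpen_compl_origin.mem_nhds hx)

theorem continuous_circulation {β : ℝ} (hβ : -1 < 1 / β) : Continuous (circulation β) :=
  continuous_mul_abs_rpow hβ

theorem ContDiffOn.comp_cosPolar {n : WithTop ℕ∞} {F : ℝ → ℝ} (hF : ContDiffOn ℝ n F (Ioo (-1) 1)) :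
    ContDiffOn ℝ n (fun x => F (cosPolar x)) zAxisᶜ :=
  hF.comp (contDiffOn_cosPolar.mono fun _ hx => ne_zero_of_notMem_zAxis hx)
    fun _ hx => cosPolar_mem_Ioo hx

theorem norm_angular (x : Space3) : ‖angular x‖ = cylRadius x := by
  refine (pow_left_inj₀ (norm_nonneg _) (cylRadius_nonneg x) two_ne_zero).1 ?_
  rw [cylRadius_sq, normsq_eq_sum, radiusSq]; simp; ring

theorem cylRadius_eq {x : Space3} (hx : x ≠ 0) :
    cylRadius x = ‖x‖ * (1 - cosPolar x ^ 2) ^ (1 / 2 : ℝ) := by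
  change √(radiusSq x) = _
  rw [radiusSq_eq hx, Real.sqrt_mul (sq_nonneg _), Real.sqrt_sq (norm_nonneg x), Real.sqrt_eq_rpow]

namespace IsProfile

variable {β : ℝ} {w w₁ : ℝ → ℝ} {x : Space3}

theorem contDiffOn_profileQuot (h : IsProfile β w w₁) (hβ : 0 < β ∨ β < -2) :
    ContDiffOn ℝ 1 (profileQuot w w₁) (Ioo (-1) 1) := by
  refine (((h.contDiffOn_two hβ).of_le (by norm_num)).div (g := fun t : ℝ => 1 - t ^ 2)
    (by fun_prop) fun t ht => (one_sub_sq_pos ht).ne').congr fun t ht => ?_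
  rw [profileQuot, if_neg (by linarith [one_sub_sq_pos ht]), Pi.div_apply]

theorem contDiffOn_coeff_off_axis (h : IsProfile β w w₁) (hβ : 0 < β ∨ β < -2) :
    ContDiffOn ℝ 1 (radialCoeff β w w₁) zAxisᶜ ∧ ContDiffOn ℝ 1 (axialCoeff β w w₁) zAxisᶜ ∧
      ContDiffOn ℝ 1 (streamFunction β w) zAxisᶜ := by
  have hsub : (zAxisᶜ : Set Space3) ⊆ {0}ᶜ := fun _ hx => ne_zero_of_notMem_zAxis hx
  have hw := ContDiffOn.comp_cosPolar ((h.contDiffOn_two hβ).of_le (by norm_num : (1 : WithTop ℕ∞) ≤ 2))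
  have hw₁ := ContDiffOn.comp_cosPolar (h.contDiffOn_deriv hβ)
  have hφ := ContDiffOn.comp_cosPolar (h.contDiffOn_profileQuot hβ)
  have hT : ContDiffOn ℝ 1 cosPolar zAxisᶜ := contDiffOn_cosPolar.mono hsub
  have hn : ∀ q : ℝ, ContDiffOn ℝ 1 (fun x : Space3 => ‖x‖ ^ q) zAxisᶜ := fun q =>
    (contDiffOn_norm_rpow q).mono hsub
  refine ⟨(hn _).mul (hw₁.neg.add (contDiffOn_const.mul (hT.mul hφ))),
    (hn _).mul ((hT.mul hw₁).neg.sub (contDiffOn_const.mul hw)), ?_⟩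
  rw [streamFunction_eq]
  exact (hn _).mul hw

theorem contDiffOn_swirlField (h : IsProfile β w w₁) (hβ : 0 < β ∨ β < -2) {γ : ℝ → ℝ}
    (hγ : ContDiff ℝ 1 γ) : ContDiffOn ℝ 1 (swirlField β γ w w₁) zAxisᶜ := by
  obtain ⟨hA, hB, hψ⟩ := h.contDiffOn_coeff_off_axis hβ
  have hD : ContDiffOn ℝ 1 (swirlCoeff β γ w) zAxisᶜ :=
    (hγ.comp_contDiffOn hψ).div contDiff_radiusSq.contDiffOn fun x hx =>
      ((notMem_zAxis_iff x).1 hx).ne'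
  exact ((hA.smul horizontal.contDiff.contDiffOn).add (hB.smul contDiffOn_const)).add
    (hD.smul angular.contDiff.contDiffOn)

/-- The degree -β - 2 is positive, which gives continuity at the origin. Elsewhere continuity of w,
w' and w/(1 - t²) on [-1, 1] suffices. -/
theorem continuous_poloidal (h : IsProfile β w w₁) (hβ : β < -2) :
    Continuous fun x => radialCoeff β w w₁ x • horizontal x + axialCoeff β w w₁ x • eZ := by
  refine continuous_of_homogeneous (d := -β - 2) (by linarith) ?_ fun l hl x => ?_
  · have hn : ∀ q : ℝ, ContinuousOn (fun x : Space3 => ‖x‖ ^ q) {0}ᶜ := fun q =>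
      (contDiffOn_norm_rpow q (n := 0)).continuousOn
    have hT : ContinuousOn cosPolar {0}ᶜ := (contDiffOn_cosPolar (n := 0)).continuousOn
    have hw := ContinuousOn.comp_cosPolar h.continuousOn_w
    have hw₁ := ContinuousOn.comp_cosPolar h.continuousOn
    have hφ := ContinuousOn.comp_cosPolar h.continuousOn_profileQuot
    exact (((hn _).mul (hw₁.neg.add (continuousOn_const.mul (hT.mul hφ)))).smul
      horizontal.continuous.continuousOn).add
      (((hn _).mul ((hT.mul hw₁).neg.sub (continuousOn_const.mul hw))).smul continuousOn_const)
  · have e : l ^ (-β - 2) = l ^ (-β - 3) * l := by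
      rw [← Real.rpow_add_one hl.ne']; congr 1; ring
    rw [radialCoeff_smul hl, axialCoeff_smul hl, map_smul, smul_add, smul_smul, smul_smul, smul_smul, e]
    congr 2; ring

/-- Writing w = φ(1 - t²) trades the singular 1/r for the power (1 - t²)^(1/2 + 1/β). Its exponent
is positive precisely because β < -2, so the toroidal part tends to 0 at the axis. -/
theorem norm_toroidal (h : IsProfile β w w₁) (hβ : β < -2) (hx : x ≠ 0) :
    ‖swirlCoeff β (circulation β) w x • angular x‖ = ‖x‖ ^ (-β - 2) *
      (|profileQuot w w₁ (cosPolar x)| ^ (1 + 1 / β) * (1 - cosPolar x ^ 2) ^ (1 / 2 + 1 / β)) := by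
  have hβ1 : -(1 / 2) < 1 / β := by
    rw [lt_div_iff_of_neg (by linarith)]; linarith
  by_cases hz : x ∈ zAxis
  · rw [angular_eq_zero_of_mem_zAxis hz, smul_zero, norm_zero, cosPolar_sq_of_mem_zAxis hx hz,
      sub_self, Real.zero_rpow (by linarith), mul_zero, mul_zero]
  · have hT := one_sub_cosPolar_sq_pos hz
    have hn := norm_pos_iff.2 hx
    rw [norm_smul, norm_angular, cylRadius_eq hx, h.swirlCoeff_eq (by linarith) hz,
      ← h.profileQuot_mul (cosPolar_mem_Ioo hz), Real.norm_eq_abs, abs_mul, abs_mul,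
      abs_of_pos (Real.rpow_pos_of_pos hn _), abs_of_nonneg (Real.rpow_nonneg (abs_nonneg _) _),
      abs_mul, abs_of_pos hT, Real.mul_rpow (abs_nonneg _) hT.le, Real.rpow_add hT]
    have e : ‖x‖ ^ (-β - 2) = ‖x‖ ^ (-β - 3) * ‖x‖ := by
      rw [← Real.rpow_add_one hn.ne']; congr 1; ring
    have e2 : |profileQuot w w₁ (cosPolar x)| * |profileQuot w w₁ (cosPolar x)| ^ (1 / β) =
        |profileQuot w w₁ (cosPolar x)| ^ (1 + 1 / β) := by
      rcases eq_or_ne (profileQuot w w₁ (cosPolar x)) 0 with h0 | h0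
      · rw [h0, abs_zero, zero_mul, Real.zero_rpow (by linarith)]
      · rw [Real.rpow_add (abs_pos.2 h0), Real.rpow_one]
    rw [e, ← e2]
    ring

theorem continuous_toroidal (h : IsProfile β w w₁) (hβ : β < -2) :
    Continuous fun x => swirlCoeff β (circulation β) w x • angular x := by
  have hβ1 : -(1 / 2) < 1 / β := by
    rw [lt_div_iff_of_neg (by linarith)]; linarith
  refine continuous_of_homogeneous (d := -β - 2) (by linarith) (fun x hx => ?_) fun l hl x => ?_
  · refine ContinuousAt.continuousWithinAt ?_
    have hnhds := isOpen_compl_origin.mem_nhds hx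
    by_cases hz : x ∈ zAxis
    · have hH : ContinuousOn (fun t => |profileQuot w w₁ t| ^ (1 + 1 / β) *
          (1 - t ^ 2) ^ (1 / 2 + 1 / β)) (Icc (-1) 1) :=
        (h.continuousOn_profileQuot.abs.rpow_const fun _ _ => Or.inr (by linarith)).mul
          (ContinuousOn.rpow_const (by fun_prop) fun _ _ => Or.inr (by linarith))
      have h1 := ((contDiffOn_norm_rpow (-β - 2) (n := 0)).continuousOn.mul
        (ContinuousOn.comp_cosPolar hH)).continuousAt hnhds
      rw [ContinuousAt, angular_eq_zero_of_mem_zAxis hz, smul_zero]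
      have h2 := h1.tendsto
      simp only [Pi.mul_apply] at h2
      rw [← h.norm_toroidal hβ hx, angular_eq_zero_of_mem_zAxis hz, smul_zero, norm_zero] at h2
      refine squeeze_zero_norm' ?_ h2
      filter_upwards [hnhds] with y hy using (h.norm_toroidal hβ hy).le
    · obtain ⟨_, _, hψ⟩ := h.contDiffOn_coeff_off_axis (Or.inr hβ)
      have h1 := hψ.continuousOn.continuousAt (isOpen_compl_zAxis.mem_nhds hz)
      have h2 : ContinuousAt (swirlCoeff β (circulation β) w) x :=
        ((continuous_circulation (by linarith)).continuousAt.comp h1).div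
          continuous_radiusSq.continuousAt ((notMem_zAxis_iff x).1 hz).ne'
      exact h2.smul angular.continuous.continuousAt
  · have e : l ^ (-β - 2) = l ^ (-β - 3) * l := by
      rw [← Real.rpow_add_one hl.ne']; congr 1; ring
    rw [swirlCoeff_smul (by linarith) hl, map_smul, smul_smul, smul_smul, e]
    congr 1; ring

/-- Γ itself is not covered by the C¹ calculus at ψ = 0, since 1 + 1/β < 1. The pressure, however,
contains only Γ² = |ψ|^(2 + 2/β), whose exponent exceeds 1. -/
theorem contDiffOn_pressure_off_axis (h : IsProfile β w w₁) (hβ : β < -2) :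
    ContDiffOn ℝ 1 (bernoulliPressure (beltramiField β w w₁)) zAxisᶜ := by
  obtain ⟨hA, hB, hψ⟩ := h.contDiffOn_coeff_off_axis (Or.inr hβ)
  have hr : -1 < 2 / β := exponent_gt (Or.inr hβ)
  have hg : ContDiff ℝ 1 fun s : ℝ => |s| ^ (2 / β + 2) := by
    have hd : ∀ s, HasDerivAt (fun s : ℝ => |s| ^ (2 / β + 2)) ((2 / β + 2) * (s * |s| ^ (2 / β))) s := by
      intro s
      refine (hasDerivAt_abs_rpow s (p := 2 / β + 2) (by linarith)).congr_deriv ?_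
      rw [add_sub_cancel_right]; ring
    rw [contDiff_one_iff_deriv]
    refine ⟨fun s => (hd s).differentiableAt, ?_⟩
    rw [show deriv (fun s : ℝ => |s| ^ (2 / β + 2)) = _ from funext fun s => (hd s).deriv]
    exact continuous_const.mul (continuous_mul_abs_rpow hr)
  have hD : ContDiffOn ℝ 1 (fun x => |streamFunction β w x| ^ (2 / β + 2) / radiusSq x) zAxisᶜ :=
    (hg.comp_contDiffOn hψ).div contDiff_radiusSq.contDiffOn fun x hx =>
      ((notMem_zAxis_iff x).1 hx).ne'
  have h1 := (((((hA.pow 2).mul contDiff_radiusSq.contDiffOn).add (hB.pow 2)).add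
    hD).div_const 2).neg
  refine h1.congr fun x hx => ?_
  have hr0 := ((notMem_zAxis_iff x).1 hx).ne'
  rw [bernoulliPressure, beltramiField, swirlField, norm_axisymField_sq]
  have e : swirlCoeff β (circulation β) w x ^ 2 * radiusSq x =
      |streamFunction β w x| ^ (2 / β + 2) / radiusSq x := by
    have : circulation β (streamFunction β w x) ^ 2 = |streamFunction β w x| ^ (2 / β + 2) := by
      rw [circulation, mul_pow, ← sq_abs (streamFunction β w x)]
      rcases eq_or_ne (streamFunction β w x) 0 with h0 | h0
      · rw [h0, abs_zero, zero_pow two_ne_zero, zero_mul, Real.zero_rpow (by linarith)]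
      · have hp := abs_pos.2 h0
        rw [← Real.rpow_mul_natCast hp.le, ← Real.rpow_natCast, ← Real.rpow_add hp]
        congr 1; push_cast; ring
    rw [← this, swirlCoeff]
    field_simp
  rw [e]

end IsProfile

/-! ### The weak formulation -/

section CompactSupport

variable {F : Type*} [NormedAddCommGroup F] {f : Space3 → F} {K O : Set Space3}

theorem tsupport_subset_of_eq_zero (hK : IsCompact K) (h0 : ∀ x, x ∉ K → f x = 0) :
    tsupport f ⊆ K := by
  refine closure_minimal (fun x hx => ?_) hK.isClosed
  by_contra hxK
  exact hx (h0 x hxK)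

theorem continuous_of_eq_zero_off_compact (hO : IsOpen O) (hf : ContinuousOn f O) (hK : IsCompact K)
    (hKO : K ⊆ O) (h0 : ∀ x, x ∉ K → f x = 0) : Continuous f :=
  continuous_of_tsupport_subset hO hf ((tsupport_subset_of_eq_zero hK h0).trans hKO)

theorem integrable_of_eq_zero_off_compact (hf : Continuous f) (hK : IsCompact K)
    (h0 : ∀ x, x ∉ K → f x = 0) : Integrable f :=
  hf.integrable_of_hasCompactSupport
    (hK.of_isClosed_subset (isClosed_tsupport _) (tsupport_subset_of_eq_zero hK h0))

end CompactSupport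

theorem contDiff_of_eq_zero_off_compact {F : Type*} [NormedAddCommGroup F] [NormedSpace ℝ F]
    {f : Space3 → F} {K O : Set Space3} (hO : IsOpen O) (hf : ContDiffOn ℝ 1 f O) (hK : IsCompact K)
    (hKO : K ⊆ O) (h0 : ∀ x, x ∉ K → f x = 0) : ContDiff ℝ 1 f := by
  rw [contDiff_iff_contDiffAt]
  intro x
  by_cases hx : x ∈ K
  · exact hf.contDiffAt (hO.mem_nhds (hKO hx))
  · refine (contDiffAt_const (c := (0 : F))).congr_of_eventuallyEq ?_
    filter_upwards [hK.isClosed.isOpen_compl.mem_nhds hx] with y hy using h0 y hy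

theorem integral_divergence_eq_zero {Y : Space3 → Space3} {K O : Set Space3} (hO : IsOpen O)
    (hY : ContDiffOn ℝ 1 Y O) (hK : IsCompact K) (hKO : K ⊆ O) (h0 : ∀ x, x ∉ K → Y x = 0) :
    ∫ x, divergence Y x = 0 := by
  have hYc := contDiff_of_eq_zero_off_compact hO hY hK hKO h0
  have hcomp : ∀ i, ContDiff ℝ 1 fun x => Y x i := fun i =>
    (EuclideanSpace.proj i : Space3 →L[ℝ] ℝ).contDiff.comp hYc
  have hYd : ∀ x, DifferentiableAt ℝ Y x := fun x => hYc.differentiable one_ne_zero x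
  have h0' : ∀ i x, x ∉ K → Y x i = 0 := fun i x hx => by rw [h0 x hx]; rfl
  have hpd : ∀ i x, fderiv ℝ (fun x => Y x i) x (EuclideanSpace.single i 1) = pderiv Y i i x :=
    fun i x => fderiv_component (hYd x) i _
  have hi : ∀ i, Integrable (pderiv Y i i) ∧ ∫ x, pderiv Y i i x = 0 := by
    intro i
    have hs : HasCompactSupport fun x => Y x i := hK.of_isClosed_subset (isClosed_tsupport _)
      (tsupport_subset_of_eq_zero hK (h0' i))
    have hc : Continuous (pderiv Y i i) := by
      have := ((hcomp i).continuous_fderiv one_ne_zero).clm_apply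
        (continuous_const (y := (EuclideanSpace.single i 1 : Space3)))
      rwa [funext (hpd i)] at this
    constructor
    · refine integrable_of_eq_zero_off_compact hc hK fun x hx => ?_
      have : Y =ᶠ[𝓝 x] fun _ => 0 := by
        filter_upwards [hK.isClosed.isOpen_compl.mem_nhds hx] with y hy using h0 y hy
      rw [pderiv, this.fderiv_eq]; simp
    · have := integral_fderiv_apply_eq_neg (W := fun _ => (EuclideanSpace.single i 1 : Space3))
        isOpen_univ (hcomp i) hs (subset_univ _) contDiffOn_const
      simp only [hpd] at this
      rw [this]
      simp [divergence, pderiv]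
  unfold divergence
  rw [integral_finsetSum _ fun i _ => (hi i).1]
  exact Finset.sum_eq_zero fun i _ => (hi i).2

/-- The integrand of the weak form of the momentum equation tested with `Φ` and the continuity
equation tested with `η`. -/
noncomputable def weakIntegrand (u : Space3 → Space3) (p : Space3 → ℝ) (Φ : Space3 → Space3)
    (η : Space3 → ℝ) (x : Space3) : ℝ :=
  inner ℝ (u x) (fderiv ℝ Φ x (u x)) + p x * divergence Φ x + fderiv ℝ η x (u x)

/-- The corresponding flux. -/
noncomputable def weakFlux (u : Space3 → Space3) (Φ : Space3 → Space3) (η : Space3 → ℝ)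
    (x : Space3) : Space3 :=
  (inner ℝ (u x) (Φ x) + η x) • u x + bernoulliPressure u x • Φ x

theorem divergence_add {u w : Space3 → Space3} {x : Space3}
    (hu : DifferentiableAt ℝ u x) (hw : DifferentiableAt ℝ w x) :
    divergence (fun y => u y + w y) x = divergence u x + divergence w x := by
  rw [divergence_eq_of_hasFDerivAt (hu.hasFDerivAt.fun_add hw.hasFDerivAt)]
  simp [divergence, pderiv, Fin.sum_univ_three]
  ring

theorem hasFDerivAt_bernoulliPressure {u : Space3 → Space3} {x : Space3}
    (hu : DifferentiableAt ℝ u x) :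
    HasFDerivAt (bernoulliPressure u) (-(innerSL ℝ (u x)).comp (fderiv ℝ u x)) x := by
  have := ((hu.hasFDerivAt.norm_sq).const_mul (2 : ℝ)⁻¹).fun_neg
  refine (this.congr_of_eventuallyEq (Eventually.of_forall fun y => ?_)).congr_fderiv ?_
  · simp only [bernoulliPressure]; ring
  · ext v; simp

/-- The last bracket is ((∇ × u) × u) · Φ, as `inner_fderiv_sub_eq` shows. The weak equations with
Bernoulli pressure thus reduce to an exact divergence plus the Beltrami defect. -/
theorem divergence_weakFlux {u Φ : Space3 → Space3} {η : Space3 → ℝ} {x : Space3}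
    (hu : DifferentiableAt ℝ u x) (hΦ : DifferentiableAt ℝ Φ x) (hη : DifferentiableAt ℝ η x)
    (hdiv : divergence u x = 0) :
    divergence (weakFlux u Φ η) x = weakIntegrand u (bernoulliPressure u) Φ η x +
      (inner ℝ (fderiv ℝ u x (u x)) (Φ x) - inner ℝ (fderiv ℝ u x (Φ x)) (u x)) := by
  have h1 := hu.inner ℝ hΦ
  have hp := hasFDerivAt_bernoulliPressure hu
  have e1 := divergence_smul (h1.fun_add hη) hu
  have e2 := divergence_smul hp.differentiableAt hΦ
  have e := divergence_add ((h1.fun_add hη).fun_smul hu) (hp.differentiableAt.fun_smul hΦ)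
  rw [e1, e2, hdiv, hp.fderiv, fderiv_fun_add h1 hη] at e
  have e3 : divergence (weakFlux u Φ η) x = _ := e
  rw [e3, weakIntegrand]
  simp only [add_apply, neg_apply, fderiv_inner_apply ℝ hu hΦ, ContinuousLinearMap.comp_apply,
    innerSL_apply_apply, real_inner_comm (fderiv ℝ u x (Φ x))]
  ring

theorem inner_fderiv_sub_eq (u : Space3 → Space3) (x v : Space3) :
    inner ℝ (fderiv ℝ u x (u x)) v - inner ℝ (fderiv ℝ u x v) (u x) =
      v 0 * (curl u x 1 * u x 2 - curl u x 2 * u x 1) +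
      v 1 * (curl u x 2 * u x 0 - curl u x 0 * u x 2) +
      v 2 * (curl u x 0 * u x 1 - curl u x 1 * u x 0) := by
  simp only [inner_eq_sum, fderiv_apply_eq_pderiv, curl, PiLp.toLp_apply, Matrix.cons_val_zero,
    Matrix.cons_val_one, Matrix.cons_val]
  ring

/-- For a general circulation γ the Beltrami defect is γγ'(ψ) - (1 + 1/β)ψ|ψ|^(2/β) times a factor
that does not involve γ. An approximation of γ therefore needs only γγ' to converge. -/
theorem IsProfile.inner_fderiv_swirlField_sub {β : ℝ} {w w₁ : ℝ → ℝ} (h : IsProfile β w w₁)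
    (hβ : β ≠ 0) {x : Space3} (hx : x ∉ zAxis) {γ : ℝ → ℝ} {γ' : ℝ}
    (hγ : HasDerivAt γ γ' (streamFunction β w x)) (v : Space3) :
    inner ℝ (fderiv ℝ (swirlField β γ w w₁) x (swirlField β γ w w₁ x)) v -
      inner ℝ (fderiv ℝ (swirlField β γ w w₁) x v) (swirlField β γ w w₁ x) =
    (γ' * γ (streamFunction β w x) - (1 + 1 / β) *
      (streamFunction β w x * |streamFunction β w x| ^ (2 / β))) *
      ((radialCoeff β w w₁ x * radiusSq x * v 2 -
        axialCoeff β w w₁ x * (x 0 * v 0 + x 1 * v 1)) / radiusSq x) := by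
  rw [inner_fderiv_sub_eq, (h.swirlField_off_axis hβ hx hγ).2.2]
  have hr := ((notMem_zAxis_iff x).1 hx).ne'
  simp only [swirlField, axisymField, swirlCoeff]
  simp
  field_simp
  simp only [radiusSq]
  ring

/-! ### Regularised circulation -/

/-- A smooth approximation of the circulation function. -/
noncomputable def regCirculation (β ε s : ℝ) : ℝ := s * (s ^ 2 + ε ^ 2) ^ (1 / (2 * β))

section regCirculation

variable {β ε : ℝ}

/-- The derivative of the regularised circulation. -/
noncomputable def regCirculationDeriv (β ε s : ℝ) : ℝ :=
  (s ^ 2 + ε ^ 2) ^ (1 / (2 * β) - 1) * (s ^ 2 * (1 + 1 / β) + ε ^ 2)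

theorem hasDerivAt_regCirculation (hβ : β ≠ 0) (hε : 0 < ε) (s : ℝ) :
    HasDerivAt (regCirculation β ε) (regCirculationDeriv β ε s) s := by
  have hpos : 0 < s ^ 2 + ε ^ 2 := by positivity
  have h1 : HasDerivAt (fun s : ℝ => s ^ 2 + ε ^ 2) (2 * s) s := by
    simpa using ((hasDerivAt_id s).pow 2).add_const (ε ^ 2)
  refine ((hasDerivAt_id s).fun_mul (h1.rpow_const (p := 1 / (2 * β)) (Or.inl hpos.ne'))).congr_deriv ?_
  rw [regCirculationDeriv]
  have e : (s ^ 2 + ε ^ 2) ^ (1 / (2 * β)) =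
      (s ^ 2 + ε ^ 2) ^ (1 / (2 * β) - 1) * (s ^ 2 + ε ^ 2) := by
    rw [← Real.rpow_add_one hpos.ne']; congr 1; ring
  simp only [id]
  rw [e]
  field_simp
  ring

theorem contDiff_regCirculation (β : ℝ) (hε : 0 < ε) : ContDiff ℝ 1 (regCirculation β ε) := by
  have hpos : ∀ s : ℝ, s ^ 2 + ε ^ 2 ≠ 0 := fun s => by positivity
  exact contDiff_id.mul (ContDiff.rpow_const_of_ne (by fun_prop) hpos)

theorem abs_rpow_eq_sq_rpow (s r : ℝ) : |s| ^ r = (s ^ 2) ^ (r / 2) := by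
  rw [← sq_abs, ← Real.rpow_natCast, ← Real.rpow_mul (abs_nonneg s)]
  congr 1; push_cast; ring

/-- The exponent 1/(2β) is negative, so enlarging s² to s² + ε² can only decrease the power. -/
theorem abs_regCirculation_le (hβ : β < 0) (s : ℝ) :
    |regCirculation β ε s| ≤ |circulation β s| := by
  rcases eq_or_ne s 0 with rfl | hs
  · simp [regCirculation, circulation]
  have hs2 : 0 < s ^ 2 := by positivity
  rw [regCirculation, circulation, abs_mul, abs_mul]
  refine mul_le_mul_of_nonneg_left ?_ (abs_nonneg s)
  rw [abs_of_nonneg (by positivity), abs_of_nonneg (by positivity), abs_rpow_eq_sq_rpow,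
    div_div, mul_comm β 2]
  exact Real.rpow_le_rpow_of_nonpos hs2 (by nlinarith [sq_nonneg ε])
    (div_nonpos_of_nonneg_of_nonpos zero_le_one (by linarith))

/-- For β < -1 one has 0 ≤ 1 + 1/β ≤ 1, so the derivative is at most (s² + ε²)^(1/(2β)). The product
is dominated uniformly in ε although the derivative alone is not. -/
theorem abs_deriv_mul_regCirculation_le (hβ : β < -1) (hε : 0 < ε) (s : ℝ) :
    |regCirculationDeriv β ε s * regCirculation β ε s| ≤ |s * |s| ^ (2 / β)| := by
  rcases eq_or_ne s 0 with rfl | hs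
  · simp [regCirculation]
  have hs2 : 0 < s ^ 2 := by positivity
  have hpos : 0 < s ^ 2 + ε ^ 2 := by positivity
  have h1 : 0 ≤ 1 + 1 / β := by
    have : -1 ≤ 1 / β := by rw [le_div_iff_of_neg (by linarith)]; linarith
    linarith
  have h2 : 1 / β ≤ 0 := div_nonpos_of_nonneg_of_nonpos zero_le_one (by linarith)
  have hd0 : 0 ≤ regCirculationDeriv β ε s := by
    rw [regCirculationDeriv]; positivity
  have hd1 : regCirculationDeriv β ε s ≤ (s ^ 2 + ε ^ 2) ^ (1 / (2 * β)) := by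
    have e : (s ^ 2 + ε ^ 2) ^ (1 / (2 * β)) =
        (s ^ 2 + ε ^ 2) ^ (1 / (2 * β) - 1) * (s ^ 2 + ε ^ 2) := by
      rw [← Real.rpow_add_one hpos.ne']; congr 1; ring
    rw [e, regCirculationDeriv]
    refine mul_le_mul_of_nonneg_left ?_ (by positivity)
    nlinarith
  rw [abs_mul, abs_of_nonneg hd0, regCirculation, abs_mul, abs_mul,
    abs_of_nonneg (Real.rpow_nonneg hpos.le _), abs_of_nonneg (Real.rpow_nonneg (abs_nonneg s) _)]
  calc regCirculationDeriv β ε s * (|s| * (s ^ 2 + ε ^ 2) ^ (1 / (2 * β)))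
      ≤ (s ^ 2 + ε ^ 2) ^ (1 / (2 * β)) * (|s| * (s ^ 2 + ε ^ 2) ^ (1 / (2 * β))) := by gcongr
    _ = |s| * (s ^ 2 + ε ^ 2) ^ (1 / β) := by
        rw [mul_left_comm, ← Real.rpow_add hpos]; congr 2; field_simp; norm_num
    _ ≤ |s| * (s ^ 2) ^ (1 / β) := by
        refine mul_le_mul_of_nonneg_left (Real.rpow_le_rpow_of_nonpos hs2 ?_ h2) (abs_nonneg s)
        nlinarith [sq_nonneg ε]
    _ = |s| * |s| ^ (2 / β) := by rw [abs_rpow_eq_sq_rpow]; congr 2; ring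

theorem tendsto_sq_add_sq (s : ℝ) : Tendsto (fun ε : ℝ => s ^ 2 + ε ^ 2) (𝓝[>] 0) (𝓝 (s ^ 2)) := by
  have : Continuous fun ε : ℝ => s ^ 2 + ε ^ 2 := by fun_prop
  have := (this.tendsto 0).mono_left (nhdsWithin_le_nhds (s := Ioi 0))
  simpa using this

theorem tendsto_regCirculation (β s : ℝ) :
    Tendsto (fun ε => regCirculation β ε s) (𝓝[>] 0) (𝓝 (circulation β s)) := by
  rcases eq_or_ne s 0 with rfl | hs
  · simp [regCirculation, circulation]
  rw [circulation, abs_rpow_eq_sq_rpow, div_div, mul_comm β 2]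
  exact ((tendsto_sq_add_sq s).rpow_const (Or.inl (by positivity))).const_mul s

theorem tendsto_deriv_mul_regCirculation (hβ : β ≠ 0) (s : ℝ) :
    Tendsto (fun ε => regCirculationDeriv β ε s * regCirculation β ε s) (𝓝[>] 0)
      (𝓝 ((1 + 1 / β) * (s * |s| ^ (2 / β)))) := by
  rcases eq_or_ne s 0 with rfl | hs
  · simp [regCirculation]
  have hs2 : 0 < s ^ 2 := by positivity
  have h1 := ((tendsto_sq_add_sq s).rpow_const (p := 1 / (2 * β) - 1) (Or.inl hs2.ne')).mul
    -- The argument s * 0 encodes the limit ε² → 0.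
    ((tendsto_sq_add_sq (s * 0)).const_add (s ^ 2 * (1 + 1 / β)))
  have h2 := h1.mul (((tendsto_sq_add_sq s).rpow_const (p := 1 / (2 * β)) (Or.inl hs2.ne')).const_mul s)
  have e : (s ^ 2) ^ (1 / (2 * β) - 1) * (s ^ 2 * (1 + 1 / β) + (s * 0) ^ 2) *
      (s * (s ^ 2) ^ (1 / (2 * β))) = (1 + 1 / β) * (s * |s| ^ (2 / β)) := by
    have e1 : (s ^ 2) ^ (1 / (2 * β)) = (s ^ 2) ^ (1 / (2 * β) - 1) * s ^ 2 := by
      rw [← Real.rpow_add_one hs2.ne']; congr 1; ring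
    have e2 : |s| ^ (2 / β) = (s ^ 2) ^ (1 / (2 * β)) * (s ^ 2) ^ (1 / (2 * β)) := by
      rw [← Real.rpow_add hs2, abs_rpow_eq_sq_rpow]; congr 1; field_simp; norm_num
    rw [e2, e1]; ring
  rw [e] at h2
  refine h2.congr fun ε => ?_
  rw [regCirculationDeriv, regCirculation, mul_zero, zero_pow two_ne_zero, zero_add]

end regCirculation

/-! ### The weak equations off the axis. -/

theorem norm_axisymField_le {A B D D' : Space3 → ℝ} {x : Space3} (h : |D x| ≤ |D' x|) :
    ‖axisymField A B D x‖ ≤ ‖axisymField A B D' x‖ := by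
  refine (pow_le_pow_iff_left₀ (norm_nonneg _) (norm_nonneg _) two_ne_zero).1 ?_
  rw [norm_axisymField_sq, norm_axisymField_sq]
  have h2 : D x ^ 2 ≤ D' x ^ 2 := sq_le_sq.2 h
  have := mul_le_mul_of_nonneg_right h2 (radiusSq_nonneg x)
  linarith

theorem abs_bernoulliPressure (u : Space3 → Space3) (x : Space3) :
    |bernoulliPressure u x| = ‖u x‖ ^ 2 / 2 := by
  rw [bernoulliPressure, abs_neg, abs_of_nonneg (by positivity)]

theorem abs_weakIntegrand_le {u v Φ : Space3 → Space3} {η : Space3 → ℝ} {x : Space3}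
    (h : ‖u x‖ ≤ ‖v x‖) : |weakIntegrand u (bernoulliPressure u) Φ η x| ≤
      ‖v x‖ ^ 2 * ‖fderiv ℝ Φ x‖ + ‖v x‖ ^ 2 / 2 * |divergence Φ x| + ‖fderiv ℝ η x‖ * ‖v x‖ := by
  have h1 : |inner ℝ (u x) (fderiv ℝ Φ x (u x))| ≤ ‖v x‖ ^ 2 * ‖fderiv ℝ Φ x‖ := by
    calc |inner ℝ (u x) (fderiv ℝ Φ x (u x))| ≤ ‖u x‖ * ‖fderiv ℝ Φ x (u x)‖ :=
          abs_real_inner_le_norm _ _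
      _ ≤ ‖u x‖ * (‖fderiv ℝ Φ x‖ * ‖u x‖) := by gcongr; exact ContinuousLinearMap.le_opNorm _ _
      _ ≤ ‖v x‖ * (‖fderiv ℝ Φ x‖ * ‖v x‖) := by gcongr
      _ = _ := by ring
  have h2 : |bernoulliPressure u x * divergence Φ x| ≤ ‖v x‖ ^ 2 / 2 * |divergence Φ x| := by
    rw [abs_mul, abs_bernoulliPressure]; gcongr
  have h3 : |fderiv ℝ η x (u x)| ≤ ‖fderiv ℝ η x‖ * ‖v x‖ := by
    rw [← Real.norm_eq_abs]
    exact ((fderiv ℝ η x).le_opNorm (u x)).trans (mul_le_mul_of_nonneg_left h (norm_nonneg _))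
  rw [weakIntegrand]
  exact (abs_add_le _ _).trans (add_le_add ((abs_add_le _ _).trans (add_le_add h1 h2)) h3)

theorem weakIntegrand_eq_zero_of_notMem {u : Space3 → Space3} {p : Space3 → ℝ} {Φ : Space3 → Space3}
    {η : Space3 → ℝ} {x : Space3} (hΦ : x ∉ tsupport Φ) (hη : x ∉ tsupport η) :
    weakIntegrand u p Φ η x = 0 := by
  have h1 := notMem_tsupport_iff_eventuallyEq.1 hΦ
  have h2 := notMem_tsupport_iff_eventuallyEq.1 hη
  have h3 : fderiv ℝ Φ x = 0 := by rw [h1.fderiv_eq]; simp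
  have h4 : fderiv ℝ η x = 0 := by rw [h2.fderiv_eq]; simp
  simp [weakIntegrand, divergence, pderiv, h3, h4]

theorem continuous_divergence {Φ : Space3 → Space3} (hΦ : ContDiff ℝ 1 Φ) :
    Continuous (divergence Φ) :=
  continuousOn_univ.1 (continuousOn_divergence isOpen_univ hΦ.contDiffOn)

theorem continuous_weakIntegrand {u : Space3 → Space3} {p : Space3 → ℝ} {Φ : Space3 → Space3}
    {η : Space3 → ℝ} (hu : Continuous u) (hp : Continuous p) (hΦ : ContDiff ℝ 1 Φ)
    (hη : ContDiff ℝ 1 η) : Continuous (weakIntegrand u p Φ η) :=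
  ((hu.inner ((hΦ.continuous_fderiv one_ne_zero).clm_apply hu)).add
    (hp.mul (continuous_divergence hΦ))).add ((hη.continuous_fderiv one_ne_zero).clm_apply hu)

namespace IsProfile

variable {β : ℝ} {w w₁ : ℝ → ℝ}

theorem continuous_beltramiField (h : IsProfile β w w₁) (hβ : β < -2) :
    Continuous (beltramiField β w w₁) :=
  (h.continuous_poloidal hβ).add (h.continuous_toroidal hβ)

/-- The weak equations hold off the axis. -/
theorem integral_weakIntegrand_off_axis (h : IsProfile β w w₁) (hβ : β < -2)
    {Φ : Space3 → Space3} {η : Space3 → ℝ} (hΦ : ContDiff ℝ 1 Φ) (hη : ContDiff ℝ 1 η)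
    (hΦc : HasCompactSupport Φ) (hηc : HasCompactSupport η) (hΦs : tsupport Φ ⊆ zAxisᶜ)
    (hηs : tsupport η ⊆ zAxisᶜ) :
    ∫ x, weakIntegrand (beltramiField β w w₁) (bernoulliPressure (beltramiField β w w₁)) Φ η x = 0 := by
  have hβ0 : β ≠ 0 := by linarith
  have hO := isOpen_compl_zAxis
  set K : Set Space3 := tsupport Φ ∪ tsupport η with hKdef
  have hK : IsCompact K := hΦc.isCompact.union hηc.isCompact
  have hKO : K ⊆ zAxisᶜ := union_subset hΦs hηs
  have hKΦ : ∀ x, x ∉ K → Φ x = 0 := fun x hx => image_eq_zero_of_notMem_tsupport fun h => hx (Or.inl h)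
  have hKη : ∀ x, x ∉ K → η x = 0 := fun x hx => image_eq_zero_of_notMem_tsupport fun h => hx (Or.inr h)
  set u := beltramiField β w w₁ with hu
  have huc : Continuous u := h.continuous_beltramiField hβ
  -- Only the circulation is regularised. Each of these fields is C¹ off the axis and
  -- divergence-free there, so the divergence theorem applies, and the price is the Beltrami defect.
  set v : ℝ → Space3 → Space3 := fun ε => swirlField β (regCirculation β ε) w w₁ with hv
  set m : Space3 → ℝ := fun x => (radialCoeff β w w₁ x * radiusSq x * Φ x 2 -
    axialCoeff β w w₁ x * (x 0 * Φ x 0 + x 1 * Φ x 1)) / radiusSq x with hm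
  obtain ⟨hA, hB, hψ⟩ := h.contDiffOn_coeff_off_axis (Or.inr hβ)
  have hproj : ∀ i : Fin 3, Continuous fun x : Space3 => x i := fun i =>
    (EuclideanSpace.proj i : Space3 →L[ℝ] ℝ).continuous
  have hΦi : ∀ i : Fin 3, Continuous fun x : Space3 => Φ x i := fun i =>
    (hproj i).comp hΦ.continuous
  have hmc : ContinuousOn m zAxisᶜ := by
    refine ContinuousOn.div ?_ continuous_radiusSq.continuousOn fun x hx =>
      ((notMem_zAxis_iff x).1 hx).ne'
    exact ((hA.continuousOn.mul continuous_radiusSq.continuousOn).mul (hΦi 2).continuousOn).sub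
      (hB.continuousOn.mul (((hproj 0).mul (hΦi 0)).add ((hproj 1).mul (hΦi 1))).continuousOn)
  have hm0 : ∀ x, x ∉ K → m x = 0 := fun x hx => by simp [hm, hKΦ x hx]
  set b₁ : Space3 → ℝ := fun x => |streamFunction β w x * |streamFunction β w x| ^ (2 / β)| * |m x|
  have hb₁0 : ∀ x, x ∉ K → b₁ x = 0 := fun x hx => by simp [b₁, hm0 x hx]
  have hb₁ : Continuous b₁ := continuous_of_eq_zero_off_compact hO
    (((continuous_mul_abs_rpow (exponent_gt (Or.inr hβ))).comp_continuousOn hψ.continuousOn).abs.mul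
      hmc.abs) hK hKO hb₁0
  set b₂ : Space3 → ℝ := fun x => ‖u x‖ ^ 2 * ‖fderiv ℝ Φ x‖ + ‖u x‖ ^ 2 / 2 * |divergence Φ x| +
    ‖fderiv ℝ η x‖ * ‖u x‖
  have hb₂ : Continuous b₂ := by
    have h1 := hΦ.continuous_fderiv one_ne_zero
    have h2 := hη.continuous_fderiv one_ne_zero
    have h3 := continuous_divergence hΦ
    fun_prop
  have hb₂0 : ∀ x, x ∉ K → b₂ x = 0 := by
    intro x hx
    have h1 := notMem_tsupport_iff_eventuallyEq.1 fun h => hx (Or.inl h)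
    have h2 := notMem_tsupport_iff_eventuallyEq.1 fun h => hx (Or.inr h)
    have h3 : fderiv ℝ Φ x = 0 := by rw [h1.fderiv_eq]; simp
    have h4 : fderiv ℝ η x = 0 := by rw [h2.fderiv_eq]; simp
    simp [b₂, divergence, pderiv, h3, h4]
  have hvC : ∀ ε, 0 < ε → ContDiffOn ℝ 1 (v ε) zAxisᶜ := fun ε hε =>
    h.contDiffOn_swirlField (Or.inr hβ) (contDiff_regCirculation β hε)
  have hvle : ∀ ε x, ‖v ε x‖ ≤ ‖u x‖ := by
    intro ε x
    refine norm_axisymField_le ?_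
    rw [swirlCoeff, swirlCoeff, abs_div, abs_div]
    exact div_le_div_of_nonneg_right (abs_regCirculation_le (by linarith) _) (abs_nonneg _)
  have hvt : ∀ x, Tendsto (fun ε => v ε x) (𝓝[>] 0) (𝓝 (u x)) := by
    intro x
    exact tendsto_const_nhds.add (((tendsto_regCirculation β _).div_const _).smul_const _)
  set Y : ℝ → Space3 → Space3 := fun ε => weakFlux (v ε) Φ η with hY
  have hY0 : ∀ ε x, x ∉ K → Y ε x = 0 := fun ε x hx => by simp [hY, weakFlux, hKΦ x hx, hKη x hx]
  have hYC : ∀ ε, 0 < ε → ContDiffOn ℝ 1 (Y ε) zAxisᶜ := by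
    intro ε hε
    have h1 := hvC ε hε
    exact (((h1.inner ℝ hΦ.contDiffOn).add hη.contDiffOn).smul h1).add
      (((h1.norm_sq ℝ).div_const 2).neg.smul hΦ.contDiffOn)
  have hdivY : ∀ ε, 0 < ε → ∀ x, x ∈ K → divergence (Y ε) x =
      weakIntegrand (v ε) (bernoulliPressure (v ε)) Φ η x +
      (regCirculationDeriv β ε (streamFunction β w x) * regCirculation β ε (streamFunction β w x) -
        (1 + 1 / β) * (streamFunction β w x * |streamFunction β w x| ^ (2 / β))) * m x := by
    intro ε hε x hx
    have hxO := hKO hx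
    have hγ := hasDerivAt_regCirculation hβ0 hε (streamFunction β w x)
    obtain ⟨h1, h2, _⟩ := h.swirlField_off_axis hβ0 hxO hγ
    rw [hY, divergence_weakFlux h1 (hΦ.differentiable one_ne_zero x) (hη.differentiable one_ne_zero x) h2,
      h.inner_fderiv_swirlField_sub hβ0 hxO hγ]
  have hdivY0 : ∀ ε x, x ∉ K → divergence (Y ε) x = 0 := by
    intro ε x hx
    have : Y ε =ᶠ[𝓝 x] fun _ => 0 := by
      filter_upwards [hK.isClosed.isOpen_compl.mem_nhds hx] with y hy using hY0 ε y hy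
    simp [divergence, pderiv, this.fderiv_eq]
  have hzero : ∀ ε, 0 < ε → ∫ x, divergence (Y ε) x = 0 := fun ε hε =>
    integral_divergence_eq_zero hO (hYC ε hε) hK hKO (hY0 ε)
  have hE0 : ∀ x, x ∉ K → weakIntegrand u (bernoulliPressure u) Φ η x = 0 := fun x hx =>
    weakIntegrand_eq_zero_of_notMem (fun h => hx (Or.inl h)) fun h => hx (Or.inr h)
  have hlim : Tendsto (fun ε => ∫ x, divergence (Y ε) x) (𝓝[>] 0)
      (𝓝 (∫ x, weakIntegrand u (bernoulliPressure u) Φ η x)) := by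
    -- The bound `b₂` controls the weak integrand through |v ε| ≤ |u|, and 2 `b₁` controls the two
    -- terms of the defect. Both are continuous and vanish off K.
    refine tendsto_integral_filter_of_dominated_convergence (fun x => b₂ x + 2 * b₁ x) ?_ ?_ ?_ ?_
    · filter_upwards [self_mem_nhdsWithin] with ε hε
      exact (continuous_divergence (contDiff_of_eq_zero_off_compact hO (hYC ε hε) hK hKO
        (hY0 ε))).aestronglyMeasurable
    · filter_upwards [self_mem_nhdsWithin] with ε hε
      refine Eventually.of_forall fun x => ?_
      by_cases hx : x ∈ K
      · rw [hdivY ε hε x hx, Real.norm_eq_abs]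
        refine (abs_add_le _ _).trans (add_le_add (abs_weakIntegrand_le (hvle ε x)) ?_)
        have h1 := abs_deriv_mul_regCirculation_le (β := β) (by linarith) hε (streamFunction β w x)
        have h2 : |(1 + 1 / β) * (streamFunction β w x * |streamFunction β w x| ^ (2 / β))| ≤
            |streamFunction β w x * |streamFunction β w x| ^ (2 / β)| := by
          rw [abs_mul]
          refine mul_le_of_le_one_left (abs_nonneg _) ?_
          have h3 : -1 ≤ 1 / β := by rw [le_div_iff_of_neg (by linarith)]; linarith
          have h4 : 1 / β ≤ 0 := div_nonpos_of_nonneg_of_nonpos zero_le_one (by linarith)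
          rw [abs_of_nonneg (by linarith)]; linarith
        have h3 := abs_add_le
          (regCirculationDeriv β ε (streamFunction β w x) * regCirculation β ε (streamFunction β w x))
          (-((1 + 1 / β) * (streamFunction β w x * |streamFunction β w x| ^ (2 / β))))
        rw [abs_neg, ← sub_eq_add_neg] at h3
        rw [abs_mul]
        calc _ ≤ 2 * |streamFunction β w x * |streamFunction β w x| ^ (2 / β)| * |m x| :=
              mul_le_mul_of_nonneg_right (by linarith) (abs_nonneg _)
          _ = 2 * b₁ x := mul_assoc _ _ _
      · rw [hdivY0 ε x hx, hb₂0 x hx, hb₁0 x hx]; simp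
    · exact (integrable_of_eq_zero_off_compact hb₂ hK hb₂0).add
        ((integrable_of_eq_zero_off_compact hb₁ hK hb₁0).const_mul 2)
    · refine Eventually.of_forall fun x => ?_
      by_cases hx : x ∈ K
      · have h1 : Tendsto (fun ε => weakIntegrand (v ε) (bernoulliPressure (v ε)) Φ η x) (𝓝[>] 0)
            (𝓝 (weakIntegrand u (bernoulliPressure u) Φ η x)) := by
          have hc : Continuous fun z : Space3 => inner ℝ z (fderiv ℝ Φ x z) +
              -(‖z‖ ^ 2 / 2) * divergence Φ x + fderiv ℝ η x z := by fun_prop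
          exact (hc.tendsto (u x)).comp (hvt x)
        have h2 := ((tendsto_deriv_mul_regCirculation hβ0 (streamFunction β w x)).sub_const
          ((1 + 1 / β) * (streamFunction β w x * |streamFunction β w x| ^ (2 / β)))).mul_const (m x)
        have h3 := h1.add h2
        rw [sub_self, zero_mul, add_zero] at h3
        refine h3.congr' ?_
        filter_upwards [self_mem_nhdsWithin] with ε hε using (hdivY ε hε x hx).symm
      · rw [hE0 x hx]
        exact tendsto_const_nhds.congr fun ε => (hdivY0 ε x hx).symm
  refine tendsto_nhds_unique hlim (tendsto_const_nhds.congr' ?_)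
  filter_upwards [self_mem_nhdsWithin] with ε hε using (hzero ε hε).symm

end IsProfile

/-! ### The axis is removable -/

/-- A smooth function that vanishes near the axis and is `1` away from it. -/
noncomputable def axisCutoff (δ : ℝ) (x : Space3) : ℝ :=
  Real.smoothTransition (radiusSq x / δ ^ 2 - 1)

theorem contDiff_axisCutoff (δ : ℝ) : ContDiff ℝ 1 (axisCutoff δ) :=
  (Real.smoothTransition.contDiff (n := 1)).comp ((contDiff_radiusSq.div_const _).sub contDiff_const)

theorem tsupport_axisCutoff {δ : ℝ} (hδ : 0 < δ) : tsupport (axisCutoff δ) ⊆ zAxisᶜ := by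
  have hcl : IsClosed {x : Space3 | δ ^ 2 ≤ radiusSq x} :=
    isClosed_le continuous_const continuous_radiusSq
  have hsub : tsupport (axisCutoff δ) ⊆ {x : Space3 | δ ^ 2 ≤ radiusSq x} := by
    refine closure_minimal (fun x hx => ?_) hcl
    by_contra hlt
    refine hx (Real.smoothTransition.zero_of_nonpos ?_)
    have : radiusSq x / δ ^ 2 ≤ 1 := (div_le_one (by positivity)).2 (not_le.1 hlt).le
    linarith
  refine hsub.trans fun x hx => (notMem_zAxis_iff x).2 (lt_of_lt_of_le (by positivity) hx)

theorem axisCutoff_eventuallyEq_one {δ : ℝ} (hδ : 0 < δ) {x : Space3} (hx : 2 * δ ^ 2 < radiusSq x) :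
    axisCutoff δ =ᶠ[𝓝 x] fun _ => 1 := by
  filter_upwards [(isOpen_lt continuous_const continuous_radiusSq).mem_nhds hx] with y hy
  refine Real.smoothTransition.one_of_one_le ?_
  have : 2 ≤ radiusSq y / δ ^ 2 := (le_div_iff₀ (by positivity)).2 (le_of_lt hy)
  linarith

theorem norm_horizontal (x : Space3) : ‖horizontal x‖ = cylRadius x := by
  refine (pow_left_inj₀ (norm_nonneg _) (cylRadius_nonneg x) two_ne_zero).1 ?_
  rw [cylRadius_sq, normsq_eq_sum, radiusSq]; simp

theorem hasFDerivAt_radiusSq (x : Space3) :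
    HasFDerivAt radiusSq (innerSL ℝ ((2 : ℝ) • horizontal x)) x := by
  have hp : ∀ i : Fin 3, HasFDerivAt (fun y : Space3 => y i) (EuclideanSpace.proj i : Space3 →L[ℝ] ℝ) x :=
    fun i => (EuclideanSpace.proj i : Space3 →L[ℝ] ℝ).hasFDerivAt
  refine HasFDerivAt.congr_fderiv (((hp 0).pow 2).fun_add ((hp 1).pow 2)) ?_
  ext v
  simp [inner_eq_sum]
  ring

/-- The gradient of r²/δ² - 1 has norm 2r/δ² ≤ 6/δ for r ≤ 3δ. This range contains the box |x₀|,
|x₁| ≤ 2δ used later, where r² ≤ 8δ². -/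
theorem exists_norm_fderiv_axisCutoff_le : ∃ L : ℝ, 0 ≤ L ∧ ∀ δ : ℝ, 0 < δ → ∀ x : Space3,
    radiusSq x ≤ 9 * δ ^ 2 → ‖fderiv ℝ (axisCutoff δ) x‖ ≤ L / δ := by
  have hS : ContDiff ℝ 1 Real.smoothTransition := Real.smoothTransition.contDiff
  obtain ⟨M, hM⟩ := (isCompact_Icc (a := (-1 : ℝ)) (b := 8)).exists_bound_of_continuousOn
    (hS.continuous_deriv le_rfl).continuousOn
  have hM0 : 0 ≤ M := (norm_nonneg _).trans (hM 0 ⟨by norm_num, by norm_num⟩)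
  refine ⟨M * 6, by positivity, fun δ hδ x hx => ?_⟩
  have hs : radiusSq x / δ ^ 2 - 1 ∈ Icc (-1 : ℝ) 8 := by
    have h1 : 0 ≤ radiusSq x / δ ^ 2 := div_nonneg (radiusSq_nonneg x) (sq_nonneg δ)
    have h2 : radiusSq x / δ ^ 2 ≤ 9 := (div_le_iff₀ (by positivity)).2 hx
    exact ⟨by linarith, by linarith⟩
  have h1 : HasFDerivAt (fun y => radiusSq y / δ ^ 2 - 1)
      ((δ ^ 2)⁻¹ • innerSL ℝ ((2 : ℝ) • horizontal x)) x := by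
    have := ((hasFDerivAt_radiusSq x).const_mul (δ ^ 2)⁻¹).sub_const 1
    refine this.congr_of_eventuallyEq (Eventually.of_forall fun y => ?_)
    simp only [div_eq_inv_mul]
  have h2 : HasFDerivAt (axisCutoff δ) _ x :=
    ((hS.differentiable one_ne_zero _).hasDerivAt).comp_hasFDerivAt x h1
  have hr : cylRadius x ≤ 3 * δ := by
    refine abs_le_of_sq_le_sq' ?_ (by positivity) |>.2
    rw [cylRadius_sq]; linarith
  rw [h2.fderiv, norm_smul, norm_smul, innerSL_apply_norm, norm_smul, norm_horizontal, norm_inv,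
    Real.norm_of_nonneg (sq_nonneg δ), Real.norm_of_nonneg (zero_le_two (α := ℝ))]
  calc _ ≤ M * ((δ ^ 2)⁻¹ * (2 * (3 * δ))) := by
        gcongr
        · have := cylRadius_nonneg x
          positivity
        · exact hM _ hs
    _ = M * 6 / δ := by field_simp; ring

theorem volume_real_box {a R : ℝ} (ha : 0 ≤ a) (hR : 0 ≤ R) :
    volume.real {x : Space3 | |x 0| ≤ a ∧ |x 1| ≤ a ∧ |x 2| ≤ R} = 8 * a ^ 2 * R ∧
    volume {x : Space3 | |x 0| ≤ a ∧ |x 1| ≤ a ∧ |x 2| ≤ R} < ⊤ := by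
  have hset : {x : Space3 | |x 0| ≤ a ∧ |x 1| ≤ a ∧ |x 2| ≤ R} =
      WithLp.ofLp ⁻¹' (Icc ![-a, -a, -R] ![a, a, R]) := by
    ext x
    simp [Pi.le_def, Fin.forall_fin_succ, abs_le]
    tauto
  have hvol : volume {x : Space3 | |x 0| ≤ a ∧ |x 1| ≤ a ∧ |x 2| ≤ R} =
      volume (Icc ![-a, -a, -R] ![a, a, R]) := by
    rw [hset]
    exact (PiLp.volume_preserving_ofLp (Fin 3)).measure_preimage measurableSet_Icc.nullMeasurableSet
  constructor
  · rw [Measure.real, hvol, Real.volume_Icc_pi_toReal]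
    · simp [Fin.prod_univ_three]; ring
    · intro i; fin_cases i <;> simp <;> linarith
  · rw [hvol, Real.volume_Icc_pi]
    exact ENNReal.prod_lt_top fun i _ => ENNReal.ofReal_lt_top

theorem weakIntegrand_smul {u : Space3 → Space3} {p χ η : Space3 → ℝ} {Φ : Space3 → Space3}
    {x : Space3} (hχ : DifferentiableAt ℝ χ x) (hΦ : DifferentiableAt ℝ Φ x)
    (hη : DifferentiableAt ℝ η x) :
    weakIntegrand u p (fun y => χ y • Φ y) (fun y => χ y * η y) x =
      χ x * weakIntegrand u p Φ η x + (fderiv ℝ χ x (u x) * inner ℝ (u x) (Φ x) +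
        p x * fderiv ℝ χ x (Φ x) + η x * fderiv ℝ χ x (u x)) := by
  rw [weakIntegrand, divergence_smul hχ hΦ, fderiv_fun_smul hχ hΦ, fderiv_fun_mul hχ hη, weakIntegrand]
  simp only [add_apply, smul_apply, ContinuousLinearMap.smulRight_apply, inner_add_right,
    inner_smul_right, smul_eq_mul]
  ring

/-- Continuous fields that satisfy the weak equations off the axis satisfy them everywhere. -/
theorem integral_weakIntegrand_eq_zero {u : Space3 → Space3} {p : Space3 → ℝ} (hu : Continuous u)
    (hp : Continuous p)
    (hoff : ∀ (Φ : Space3 → Space3) (η : Space3 → ℝ), ContDiff ℝ 1 Φ → ContDiff ℝ 1 η →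
      HasCompactSupport Φ → HasCompactSupport η → tsupport Φ ⊆ zAxisᶜ → tsupport η ⊆ zAxisᶜ →
      ∫ x, weakIntegrand u p Φ η x = 0)
    {Φ : Space3 → Space3} {η : Space3 → ℝ} (hΦ : ContDiff ℝ 1 Φ) (hη : ContDiff ℝ 1 η)
    (hΦc : HasCompactSupport Φ) (hηc : HasCompactSupport η) :
    ∫ x, weakIntegrand u p Φ η x = 0 := by
  obtain ⟨L, hL0, hL⟩ := exists_norm_fderiv_axisCutoff_le
  set K : Set Space3 := tsupport Φ ∪ tsupport η with hKdef
  have hK : IsCompact K := hΦc.isCompact.union hηc.isCompact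
  have hE : Continuous (weakIntegrand u p Φ η) := continuous_weakIntegrand hu hp hΦ hη
  have hE0 : ∀ x, x ∉ K → weakIntegrand u p Φ η x = 0 := fun x hx =>
    weakIntegrand_eq_zero_of_notMem (fun h => hx (Or.inl h)) fun h => hx (Or.inr h)
  have hbdd : ∀ f : Space3 → ℝ, Continuous f → ∃ M, 0 ≤ M ∧ ∀ x ∈ K, ‖f x‖ ≤ M := by
    intro f hf
    obtain ⟨M, hM⟩ := hK.exists_bound_of_continuousOn hf.continuousOn
    exact ⟨max M 0, le_max_right _ _, fun x hx => (hM x hx).trans (le_max_left _ _)⟩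
  obtain ⟨M₁, hM₁0, hM₁⟩ := hbdd _ hE
  have hG : Continuous fun x => ‖u x‖ * (‖u x‖ * ‖Φ x‖) + |p x| * ‖Φ x‖ + |η x| * ‖u x‖ := by
    have h1 := hΦ.continuous
    have h2 := hη.continuous
    fun_prop
  obtain ⟨M₂, hM₂0, hM₂⟩ := hbdd _ hG
  obtain ⟨R, hR⟩ := hK.isBounded.subset_closedBall (0 : Space3)
  set R' := max R 0 with hR'
  have hR0 : 0 ≤ R' := le_max_right _ _
  have hχ : ∀ δ x, DifferentiableAt ℝ (axisCutoff δ) x := fun δ x =>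
    (contDiff_axisCutoff δ).differentiable one_ne_zero x
  set Ψ : ℝ → Space3 → ℝ := fun δ => weakIntegrand u p (fun y => axisCutoff δ y • Φ y)
    (fun y => axisCutoff δ y * η y) with hΨ
  have hΨeq : ∀ δ x, Ψ δ x = _ := fun δ x => weakIntegrand_smul (u := u) (p := p) (hχ δ x)
    (hΦ.differentiable one_ne_zero x) (hη.differentiable one_ne_zero x)
  have hΨc : ∀ δ, Continuous (Ψ δ) := fun δ => continuous_weakIntegrand hu hp
    ((contDiff_axisCutoff δ).smul hΦ) ((contDiff_axisCutoff δ).mul hη)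
  have hΦ0 : ∀ x, x ∉ K → Φ x = 0 := fun x hx => image_eq_zero_of_notMem_tsupport fun h => hx (Or.inl h)
  have hη0 : ∀ x, x ∉ K → η x = 0 := fun x hx => image_eq_zero_of_notMem_tsupport fun h => hx (Or.inr h)
  have hΨ0 : ∀ δ x, x ∉ K → Ψ δ x = 0 := fun δ x hx => by
    rw [hΨeq, hE0 x hx, hΦ0 x hx, hη0 x hx]; simp
  have hΨint : ∀ δ, 0 < δ → ∫ x, Ψ δ x = 0 := by
    intro δ hδ
    have h1 : HasCompactSupport fun y => axisCutoff δ y • Φ y :=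
      HasCompactSupport.smul_left (f := axisCutoff δ) hΦc
    have h2 : HasCompactSupport fun y => axisCutoff δ y * η y :=
      HasCompactSupport.mul_left (f := axisCutoff δ) hηc
    have h3 : tsupport (fun y => axisCutoff δ y • Φ y) ⊆ zAxisᶜ :=
      (tsupport_smul_subset_left _ _).trans (tsupport_axisCutoff hδ)
    have h4 : tsupport (fun y => axisCutoff δ y * η y) ⊆ zAxisᶜ :=
      tsupport_mul_subset_left.trans (tsupport_axisCutoff hδ)
    have h5 : ContDiff ℝ 1 fun y => axisCutoff δ y • Φ y := (contDiff_axisCutoff δ).smul hΦ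
    have h6 : ContDiff ℝ 1 fun y => axisCutoff δ y * η y := (contDiff_axisCutoff δ).mul hη
    exact hoff _ _ h5 h6 h1 h2 h3 h4
  have hbound : ∀ δ, 0 < δ → ‖∫ x, weakIntegrand u p Φ η x‖ ≤
      (M₁ + L / δ * M₂) * (8 * (2 * δ) ^ 2 * R') := by
    intro δ hδ
    -- The error lives in this box: at points of K outside it one has r² > 4δ² > 2δ², where the
    -- cutoff is locally 1.
    set B : Set Space3 := {x | |x 0| ≤ 2 * δ ∧ |x 1| ≤ 2 * δ ∧ |x 2| ≤ R'} with hB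
    obtain ⟨hvol, hfin⟩ := volume_real_box (a := 2 * δ) (R := R') (by positivity) hR0
    have hd : ∫ x, weakIntegrand u p Φ η x = ∫ x, (weakIntegrand u p Φ η x - Ψ δ x) := by
      rw [integral_sub (integrable_of_eq_zero_off_compact hE hK hE0)
        (integrable_of_eq_zero_off_compact (hΨc δ) hK (hΨ0 δ)), hΨint δ hδ, sub_zero]
    have hout : ∀ x, x ∉ B → weakIntegrand u p Φ η x - Ψ δ x = 0 := by
      intro x hx
      by_cases hxK : x ∈ K
      · have hx2 : |x 2| ≤ R' := by
          have h1 : ‖x‖ ≤ R := by simpa using hR hxK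
          have h2 : |x 2| ≤ ‖x‖ := PiLp.norm_apply_le x 2
          exact (h2.trans h1).trans (le_max_left _ _)
        have hr : 2 * δ ^ 2 < radiusSq x := by
          have h3 : 2 * δ < |x 0| ∨ 2 * δ < |x 1| := by
            by_contra! hcon
            exact hx ⟨hcon.1, hcon.2, hx2⟩
          rw [radiusSq, ← sq_abs (x 0), ← sq_abs (x 1)]
          rcases h3 with h3 | h3 <;> nlinarith [sq_nonneg |x 0|, sq_nonneg |x 1|]
        have hev := axisCutoff_eventuallyEq_one hδ hr
        have hd0 : fderiv ℝ (axisCutoff δ) x = 0 := by rw [hev.fderiv_eq]; simp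
        rw [hΨeq, hd0, hev.eq_of_nhds]; simp
      · rw [hE0 x hxK, hΨ0 δ x hxK, sub_zero]
    have hin : ∀ x ∈ B, ‖weakIntegrand u p Φ η x - Ψ δ x‖ ≤ M₁ + L / δ * M₂ := by
      intro x hx
      by_cases hxK : x ∈ K
      · have hr : radiusSq x ≤ 9 * δ ^ 2 := by
          rw [radiusSq, ← sq_abs (x 0), ← sq_abs (x 1)]
          have h1 := pow_le_pow_left₀ (abs_nonneg _) hx.1 2
          have h2 := pow_le_pow_left₀ (abs_nonneg _) hx.2.1 2
          nlinarith
        have hD := hL δ hδ x hr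
        have hLδ : 0 ≤ L / δ := by positivity
        have hDv : ∀ v, |fderiv ℝ (axisCutoff δ) x v| ≤ L / δ * ‖v‖ := fun v =>
          ((fderiv ℝ (axisCutoff δ) x).le_opNorm v).trans
            (mul_le_mul_of_nonneg_right hD (norm_nonneg v))
        have e : weakIntegrand u p Φ η x - Ψ δ x = (1 - axisCutoff δ x) * weakIntegrand u p Φ η x +
            -(fderiv ℝ (axisCutoff δ) x (u x) * inner ℝ (u x) (Φ x) +
              p x * fderiv ℝ (axisCutoff δ) x (Φ x) + η x * fderiv ℝ (axisCutoff δ) x (u x)) := by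
          rw [hΨeq]; ring
        rw [e]
        refine (norm_add_le _ _).trans (add_le_add ?_ ?_)
        · have h0 : 0 ≤ axisCutoff δ x := Real.smoothTransition.nonneg _
          have h1 : axisCutoff δ x ≤ 1 := Real.smoothTransition.le_one _
          rw [norm_mul]
          refine (mul_le_of_le_one_left (norm_nonneg _) ?_).trans (hM₁ x hxK)
          rw [Real.norm_of_nonneg (by linarith)]; linarith
        · rw [norm_neg]
          have h1 : |fderiv ℝ (axisCutoff δ) x (u x) * inner ℝ (u x) (Φ x)| ≤
              L / δ * ‖u x‖ * (‖u x‖ * ‖Φ x‖) := by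
            rw [abs_mul]
            exact mul_le_mul (hDv _) (abs_real_inner_le_norm _ _) (abs_nonneg _) (by positivity)
          have h2 : |p x * fderiv ℝ (axisCutoff δ) x (Φ x)| ≤ |p x| * (L / δ * ‖Φ x‖) := by
            rw [abs_mul]; exact mul_le_mul_of_nonneg_left (hDv _) (abs_nonneg _)
          have h3 : |η x * fderiv ℝ (axisCutoff δ) x (u x)| ≤ |η x| * (L / δ * ‖u x‖) := by
            rw [abs_mul]; exact mul_le_mul_of_nonneg_left (hDv _) (abs_nonneg _)
          have h4 := (le_abs_self _).trans (hM₂ x hxK)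
          rw [Real.norm_eq_abs]
          calc _ ≤ L / δ * ‖u x‖ * (‖u x‖ * ‖Φ x‖) + |p x| * (L / δ * ‖Φ x‖) +
                |η x| * (L / δ * ‖u x‖) :=
                (abs_add_le _ _).trans (add_le_add ((abs_add_le _ _).trans (add_le_add h1 h2)) h3)
            _ = L / δ * (‖u x‖ * (‖u x‖ * ‖Φ x‖) + |p x| * ‖Φ x‖ + |η x| * ‖u x‖) := by ring
            _ ≤ L / δ * M₂ := mul_le_mul_of_nonneg_left h4 hLδ
      · rw [hE0 x hxK, hΨ0 δ x hxK, sub_zero, norm_zero]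
        positivity
    rw [hd, ← setIntegral_eq_integral_of_forall_compl_eq_zero hout, ← hvol]
    exact norm_setIntegral_le_of_norm_le_const hfin hin
  -- The integrand is O(1/δ) and the volume is O(δ²), so the error is O(δ).
  have hlim : Tendsto (fun δ : ℝ => (M₁ + L / δ * M₂) * (8 * (2 * δ) ^ 2 * R')) (𝓝[>] 0) (𝓝 0) := by
    have hc : Continuous fun δ : ℝ => (M₁ * δ + L * M₂) * (32 * δ * R') := by fun_prop
    have h1 := (hc.tendsto 0).mono_left (nhdsWithin_le_nhds (s := Ioi 0))
    simp only [mul_zero, zero_mul] at h1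
    refine h1.congr' ?_
    filter_upwards [self_mem_nhdsWithin] with δ hδ
    have : δ ≠ 0 := ne_of_gt hδ
    field_simp
    ring
  have h0 : ‖∫ x, weakIntegrand u p Φ η x‖ ≤ 0 := by
    refine ge_of_tendsto hlim ?_
    filter_upwards [self_mem_nhdsWithin] with δ hδ using hbound δ hδ
  exact norm_le_zero_iff.1 h0

/-! ### Rotational continuous fields -/

/-- The map `v ↦ a × v`. -/
noncomputable def crossCLM (a : Space3) : Space3 →L[ℝ] Space3 :=
  LinearMap.toContinuousLinearMap
    { toFun := fun v => !₂[a 1 * v 2 - a 2 * v 1, a 2 * v 0 - a 0 * v 2, a 0 * v 1 - a 1 * v 0]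
      map_add' := fun v z => by ext i; fin_cases i <;> simp <;> ring
      map_smul' := fun c v => by ext i; fin_cases i <;> simp <;> ring }

theorem crossCLM_apply (a v : Space3) : crossCLM a v =
    !₂[a 1 * v 2 - a 2 * v 1, a 2 * v 0 - a 0 * v 2, a 0 * v 1 - a 1 * v 0] := rfl

/-- The identity ∇ · (a × u) = -a · (∇ × u) lets the pairing of u with the rotation of a test field
η a be integrated by parts as a divergence. -/
theorem divergence_crossCLM {u : Space3 → Space3} {x : Space3} (hu : DifferentiableAt ℝ u x)
    (a : Space3) : divergence (fun y => crossCLM a (u y)) x = -inner ℝ (curl u x) a := by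
  have h : HasFDerivAt (fun y => crossCLM a (u y)) ((crossCLM a).comp (fderiv ℝ u x)) x :=
    (crossCLM a).hasFDerivAt.comp x hu.hasFDerivAt
  rw [divergence_eq_of_hasFDerivAt h, curl_inner]
  simp only [ContinuousLinearMap.comp_apply, crossCLM_apply, Fin.sum_univ_three, pderiv]
  simp
  ring

theorem inner_curl_smul_const {η : Space3 → ℝ} {x : Space3} (hη : DifferentiableAt ℝ η x)
    (a v : Space3) : inner ℝ v (curl (fun y => η y • a) x) = fderiv ℝ η x (crossCLM a v) := by
  have hp : ∀ i j, pderiv (fun y => η y • a) i j x =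
      fderiv ℝ η x (EuclideanSpace.single i 1) * a j := by
    intro i j
    rw [pderiv, (hη.hasFDerivAt.smul_const a).fderiv]
    simp
  rw [real_inner_comm, curl_inner, clm_eq_sum (fderiv ℝ η x), crossCLM_apply]
  simp only [hp, Fin.sum_univ_three]
  simp
  ring

/-- A field that is `C¹` with nonzero rotation near a point is rotational as a distribution. -/
theorem isDistributionallyRotational_of_curl_ne_zero {u : Space3 → Space3} {O : Set Space3}
    (hO : IsOpen O) (hu : ContDiffOn ℝ 1 u O) {x₀ : Space3} (hx₀ : x₀ ∈ O) (hne : curl u x₀ ≠ 0) :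
    IsDistributionallyRotational u := by
  -- The test field is f a with a bump f supported where (∇ × u) · a > 0, so the pairing is a
  -- positive integral.
  set a := curl u x₀ with ha
  have hcurl := continuousOn_curl hO hu
  have hg : ContinuousOn (fun x => inner ℝ (curl u x) a) O := hcurl.inner continuousOn_const
  have hpos : 0 < inner ℝ (curl u x₀) a := real_inner_self_pos.2 hne
  have hV : {x | 0 < inner ℝ (curl u x) a} ∩ O ∈ 𝓝 x₀ :=
    inter_mem ((hg.continuousAt (hO.mem_nhds hx₀)).eventually_const_lt hpos) (hO.mem_nhds hx₀)
  obtain ⟨δ, hδ, hball⟩ := Metric.nhds_basis_closedBall.mem_iff.1 hV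
  obtain ⟨f, hf, hfc, hfs, hf0, hfx⟩ : ∃ f : Space3 → ℝ, ContDiff ℝ ∞ f ∧ HasCompactSupport f ∧
      tsupport f = Metric.closedBall x₀ δ ∧ (∀ x, 0 ≤ f x) ∧ f x₀ = 1 := by
    let f : ContDiffBump x₀ := ⟨δ / 2, δ, by positivity, by linarith⟩
    exact ⟨f, f.contDiff, f.hasCompactSupport, f.tsupport_eq, fun _ => f.nonneg,
      f.one_of_mem_closedBall (Metric.mem_closedBall_self (by positivity))⟩
  have hfO : tsupport f ⊆ O := by rw [hfs]; exact fun x hx => (hball hx).2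
  have hf1 : ContDiff ℝ 1 f := hf.of_le (by exact_mod_cast le_top)
  have hfd : ∀ x, DifferentiableAt ℝ f x := fun x => hf1.differentiable one_ne_zero x
  have hΦc : HasCompactSupport fun y => f y • a :=
    HasCompactSupport.smul_right (f := f) (f' := fun _ => a) hfc
  refine ⟨fun y => f y • a, hf.smul contDiff_const, hΦc, ?_⟩
  have h1 : ∫ x, inner ℝ (u x) (curl (fun y => f y • a) x) =
      ∫ x, fderiv ℝ f x (crossCLM a (u x)) := by
    congr 1; funext x; exact inner_curl_smul_const (hfd x) a (u x)
  have h2 := integral_fderiv_apply_eq_neg hO hf1 hfc hfO ((crossCLM a).contDiff.comp_contDiffOn hu)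
  have h3 : ∀ x, f x * divergence (crossCLM a ∘ u) x = -(f x * inner ℝ (curl u x) a) := by
    intro x
    by_cases hx : x ∈ tsupport f
    · have := divergence_crossCLM ((hu.differentiableOn one_ne_zero).differentiableAt
        (hO.mem_nhds (hfO hx))) a
      rw [show crossCLM a ∘ u = fun y => crossCLM a (u y) from rfl, this]; ring
    · rw [image_eq_zero_of_notMem_tsupport hx]; ring
  have h4 : ∫ x, inner ℝ (u x) (curl (fun y => f y • a) x) = ∫ x, f x * inner ℝ (curl u x) a := by
    rw [h1]
    refine h2.trans ?_
    simp only [h3, integral_neg, neg_neg]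
  rw [h4]
  have hts : tsupport (fun x => f x * inner ℝ (curl u x) a) ⊆ tsupport f := tsupport_mul_subset_left
  have hcont : Continuous fun x => f x * inner ℝ (curl u x) a :=
    continuous_of_tsupport_subset hO (hf.continuous.continuousOn.mul hg) (hts.trans hfO)
  refine (hcont.integral_pos_of_hasCompactSupport_nonneg_nonzero
    (hfc.of_isClosed_subset (isClosed_tsupport _) hts) (fun x => ?_) (x := x₀) ?_).ne'
  · by_cases hx : x ∈ tsupport f
    · rw [hfs] at hx
      exact mul_nonneg (hf0 x) (le_of_lt (hball hx).1)
    · rw [image_eq_zero_of_notMem_tsupport hx, zero_mul]; exact le_rfl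
  · rw [hfx, one_mul]
    exact hpos.ne'

theorem contDiffAt_circulation (β : ℝ) {s : ℝ} (hs : s ≠ 0) : ContDiffAt ℝ 1 (circulation β) s :=
  contDiffAt_id.mul ((contDiffAt_abs hs).rpow_const_of_ne (abs_ne_zero.2 hs))

theorem IsProfile.isDistributionallyRotational {β : ℝ} {w w₁ : ℝ → ℝ} (h : IsProfile β w w₁)
    (hβ : β < -2) : IsDistributionallyRotational (beltramiField β w w₁) := by
  obtain ⟨x₀, hx₀, hψ₀⟩ := h.exists_streamFunction_ne_zero
  obtain ⟨hA, hB, hψ⟩ := h.contDiffOn_coeff_off_axis (Or.inr hβ)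
  -- Where ψ ≠ 0 the circulation is C¹, hence so is the field, and its rotation is nonzero there.
  set O : Set Space3 := zAxisᶜ ∩ streamFunction β w ⁻¹' {0}ᶜ with hOdef
  have hO : IsOpen O := hψ.continuousOn.isOpen_inter_preimage isOpen_compl_zAxis isOpen_compl_singleton
  have hsub : O ⊆ zAxisᶜ := inter_subset_left
  have hD : ContDiffOn ℝ 1 (swirlCoeff β (circulation β) w) O := by
    refine ContDiffOn.div (fun x hx => ?_) contDiff_radiusSq.contDiffOn fun x hx =>
      ((notMem_zAxis_iff x).1 hx.1).ne'
    exact (contDiffAt_circulation β hx.2).comp_contDiffWithinAt x ((hψ.mono hsub) x hx)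
  have hu : ContDiffOn ℝ 1 (beltramiField β w w₁) O :=
    (((hA.mono hsub).smul horizontal.contDiff.contDiffOn).add
      ((hB.mono hsub).smul contDiffOn_const)).add (hD.smul angular.contDiff.contDiffOn)
  have hβ1 : -(1 / 2) < 1 / β := by
    rw [lt_div_iff_of_neg (by linarith)]; linarith
  exact isDistributionallyRotational_of_curl_ne_zero hO hu ⟨hx₀, hψ₀⟩
    (h.curl_beltramiField_ne_zero (by linarith) (by linarith) hx₀ hψ₀
      ((contDiffAt_circulation β hψ₀).differentiableAt one_ne_zero).hasDerivAt)

/-- The continuous Beltrami solutions for `α = β + 2 < 0`. -/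
theorem exists_continuous_beltrami {β : ℝ} (hβ : β < -2) :
    ∃ (u : Space3 → Space3) (p : Space3 → ℝ),
      IsContinuousHomogeneousSolution (β + 2) u p ∧ IsBeltramiBernoulli u p ∧
      IsDistributionallyRotational u ∧
      IsAxisymmetricOn u p Set.univ ∧
      ContDiffOn ℝ 1 (poloidal u) zAxisᶜ ∧ ContDiffOn ℝ 1 p zAxisᶜ ∧
      Continuous (poloidal u) ∧ Continuous (toroidal u) ∧
      IsObtainedFromDirichlet (β + 2) u := by
  obtain ⟨w, w₁, h⟩ := exists_isProfile (Or.inr hβ)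
  have hβ0 : β ≠ 0 := by linarith
  have hu := h.continuous_beltramiField hβ
  have hp : Continuous (bernoulliPressure (beltramiField β w w₁)) :=
    ((hu.norm.pow 2).div_const 2).neg
  obtain ⟨hA, hB, -⟩ := h.contDiffOn_coeff_off_axis (Or.inr hβ)
  have hhom := isHomogeneousOn_beltramiField (w := w) (w₁ := w₁) hβ0 univ
  have hpol : poloidal (beltramiField β w w₁) = fun x => radialCoeff β w w₁ x • horizontal x +
      axialCoeff β w w₁ x • eZ := poloidal_axisymField
  have htor : toroidal (beltramiField β w w₁) = fun x =>
      swirlCoeff β (circulation β) w x • angular x := toroidal_axisymField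
  have hweak : ∀ (Φ : Space3 → Space3) (η : Space3 → ℝ), ContDiff ℝ 1 Φ → ContDiff ℝ 1 η →
      HasCompactSupport Φ → HasCompactSupport η →
      ∫ x, weakIntegrand (beltramiField β w w₁) (bernoulliPressure (beltramiField β w w₁)) Φ η x = 0 :=
    fun Φ η hΦ hη hΦc hηc => integral_weakIntegrand_eq_zero hu hp
      (fun _ _ h1 h2 h3 h4 h5 h6 => h.integral_weakIntegrand_off_axis hβ h1 h2 h3 h4 h5 h6)
      hΦ hη hΦc hηc
  refine ⟨beltramiField β w w₁, bernoulliPressure (beltramiField β w w₁),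
    ⟨hu, hp, hhom, hhom.bernoulliPressure, fun Φ hΦ hΦc => ?_, fun η hη hηc => ?_⟩, fun x => ?_,
    h.isDistributionallyRotational hβ, isAxisymmetricOn_beltramiField _, ?_,
    h.contDiffOn_pressure_off_axis hβ, ?_, ?_, h.isObtainedFromDirichlet (Or.inr hβ)⟩
  · have := hweak Φ 0 (hΦ.of_le (by exact_mod_cast le_top)) contDiff_const hΦc HasCompactSupport.zero
    simpa [weakIntegrand] using this
  · have := hweak 0 η contDiff_const (hη.of_le (by exact_mod_cast le_top)) HasCompactSupport.zero hηc
    simpa [weakIntegrand, divergence, pderiv] using this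
  · rw [bernoulliPressure]; ring
  · rw [hpol]
    exact (hA.smul horizontal.contDiff.contDiffOn).add (hB.smul contDiffOn_const)
  · rw [hpol]; exact h.continuous_poloidal hβ
  · rw [htor]; exact h.continuous_toroidal hβ

end

end HomogeneousEuler

/-! ### The main theorem. -/

open HomogeneousEuler
theorem theorem1p1 :
    -- no rotational Beltrami solutions of class C¹ for 1 ≤ α ≤ 2
    (∀ α : ℝ, 1 ≤ α → α ≤ 2 →
      ¬ ∃ (u : Space3 → Space3) (p : Space3 → ℝ),
        IsClassicalHomogeneousSolution α u p ∧ IsBeltrami u ∧ IsRotational u) ∧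
    -- no rotational Beltrami solutions of class C² for α < 1
    (∀ α : ℝ, α < 1 →
      ¬ ∃ (u : Space3 → Space3) (p : Space3 → ℝ),
        ContDiffOn ℝ 2 u {0}ᶜ ∧ ContDiffOn ℝ 2 p {0}ᶜ ∧
        IsClassicalHomogeneousSolution α u p ∧ IsBeltrami u ∧ IsRotational u) ∧
    -- axisymmetric rotational Beltrami solutions of class C¹ for α > 2
    (∀ α : ℝ, 2 < α →
      ∃ (u : Space3 → Space3) (p : Space3 → ℝ),
        IsClassicalHomogeneousSolution α u p ∧ IsBeltrami u ∧ IsRotational u ∧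
        IsAxisymmetricOn u p {0}ᶜ ∧
        ContDiffOn ℝ 2 (poloidal u) {0}ᶜ ∧ ContDiffOn ℝ 2 p {0}ᶜ ∧
        ContDiffOn ℝ 1 (toroidal u) {0}ᶜ ∧
        IsObtainedFromDirichlet α u) ∧
    -- axisymmetric rotational continuous Beltrami solutions in ℝ³ for α < 0
    (∀ α : ℝ, α < 0 →
      ∃ (u : Space3 → Space3) (p : Space3 → ℝ),
        IsContinuousHomogeneousSolution α u p ∧ IsBeltramiBernoulli u p ∧
        IsDistributionallyRotational u ∧
        IsAxisymmetricOn u p Set.univ ∧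
        ContDiffOn ℝ 1 (poloidal u) zAxisᶜ ∧ ContDiffOn ℝ 1 p zAxisᶜ ∧
        Continuous (poloidal u) ∧ Continuous (toroidal u) ∧
        IsObtainedFromDirichlet α u) := by
  refine ⟨fun α h1 h2 => ?_, fun α h1 => ?_, fun α h1 => ?_, fun α h1 => ?_⟩
  · rintro ⟨u, p, hs, hb, x, hx, hc⟩
    exact hc ((hs.isBeltramiHomogeneous hb).curl_eq_zero_of_one_le h1 h2 hx)
  · rintro ⟨u, p, hu, _, hs, hb, x, hx, hc⟩
    exact hc ((hs.isBeltramiHomogeneous hb).curl_eq_zero_of_lt_one hu h1 hx)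
  · obtain ⟨β, rfl⟩ : ∃ β, α = β + 2 := ⟨α - 2, by ring⟩
    exact exists_classical_beltrami (by linarith)
  · obtain ⟨β, rfl⟩ : ∃ β, α = β + 2 := ⟨α - 2, by ring⟩
    exact exists_continuous_beltrami (by linarith)
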